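/- Let $R$ be a reduced irreducible (crystallographic) root system in a finite-dimensional real inner product space $\mathfrak h$, with simple roots $\alpha_1,\dots,\alpha_n$, positive roots $R^+$, highest root $\varphi$ and coroots $\alpha^\vee=2\alpha/\langle\alpha,\alpha\rangle$. Let $W_0\subset GL(\mathfrak h)$ be the Weyl group, $w_0$ its longest element, $P=\{\lambda\in\mathfrak h:\langle\lambda,\alpha\rangle\in\mathbb Z\ \forall\alpha\in R\}$ the coweight lattice with basis $\omega_1,\dots,\omega_n$ dual to the $\alpha_i$, $Q^+=\sum_i\mathbb Z_{\ge0}\alpha_i^\vee$, and $\tilde W=P\rtimes W_0$ the extended affine Weyl group, acting on $\mathfrak h$, with translations $t_\mu$ ($\mu\in P$) and $s_i=s_{\alpha_i}$ ($1\le i\le n$), $s_0=t_{\varphi^\vee}s_\varphi$. The length $\ell(w)$ of $w\in\tilde W$ is the number of hyperplanes $\{\lambda:\langle\lambda,\alpha\rangle=k\}$ ($\alpha\in R^+$, $k\in\mathbb Z$) separating the fundamental alcove $c_0=\{\lambda:\langle\lambda,\alpha_i\rangle>0\ (1\le i\le n),\ \langle\lambda,\varphi\rangle<1\}$ from $wc_0$.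 Let $q_0,\dots,q_n>1$ be a reduced parameter system, i.e. $q_i=q_j$ whenever $s_i,s_j$ are conjugate in the affine Weyl group, and moreover $q_0=q_1$ in type $A_1$ and $q_0=q_n$ in type $C_n$ (equivalently, $q_i=q_j$ whenever $s_i,s_j$ are conjugate in $\tilde W$). Put $q_w=q_{i_1}\cdots q_{i_\ell}$ if $w=s_{i_1}\cdots s_{i_\ell}\gamma$ with $\ell=\ell(w)$ and $\ell(\gamma)=0$; put $q_\alpha=q_i$ if $\alpha\in W_0\alpha_i$; and $W_0(q)=\sum_{w\in W_0}q_w$. The extended affine Hecke algebra $\mathcal H$ is the unital $\mathbb C$-algebra with generators $T_w$ ($w\in\tilde W$), $T_1=1$, and defining relations $T_uT_v=T_{uv}$ if $\ell(uv)=\ell(u)+\ell(v)$, and $T_wT_{s_i}=T_{ws_i}+(q_i^{1/2}-q_i^{-1/2})T_w$ if $\ell(ws_i)=\ell(w)-1$. For $v\in\tilde W$ choose any expression $v=s_{i_1}\cdots s_{i_\ell}\gamma$ with $\ell(\gamma)=0$, and let $x_v=T_{s_{i_1}}^{\epsilon_1}\cdots T_{s_{i_\ell}}^{\epsilon_\ell}T_\gamma$,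 where $\epsilon_k=+1$ if the step from the alcove $s_{i_1}\cdots s_{i_{k-1}}c_0$ to $s_{i_1}\cdots s_{i_k}c_0$ crosses the hyperplane $\{\lambda:\langle\lambda,\alpha\rangle=m\}$ ($\alpha\in R^+$) between them from the side $\langle\lambda,\alpha\rangle<m$ to the side $\langle\lambda,\alpha\rangle>m$, and $\epsilon_k=-1$ otherwise. Write $x^\mu=x_{t_\mu}$ for $\mu\in P$, and $p(x)=\sum_\mu p_\mu x^\mu\in\mathcal H$ for $p=\sum_\mu p_\mu e^\mu$ in the group algebra $\mathbb C[P]$. Let $$\mathbf 1_0=\frac1{W_0(q)}\sum_{w\in W_0}q_w^{1/2}T_w .$$ Let $\mathbb T^n=\mathrm{Hom}(P,\mathbb T)$, where $\mathbb T$ is the circle group and $t\mapsto(t^{\omega_1},\dots,t^{\omega_n})$ are the coordinates; let $dt$ be normalised Haar measure, let $t^\mu$ be the value of $t$ at $\mu$, $p(t)=\sum_\mu p_\mu t^\mu$, and $$c(t)=\prod_{\alpha\in R^+}\frac{1-q_\alpha^{-1}t^{-\alpha^\vee}}{1-t^{-\alpha^\vee}} .$$ Then $x_v$ does not depend on the chosen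 expression of $v$, and there is a linear functional $\mathrm{Tr}:\mathcal H\to\mathbb C$ with $\mathrm{Tr}(T_w)=\delta_{w,1}$ for all $w\in\tilde W$ (unique, as the $T_w$ span $\mathcal H$). The integrals below converge absolutely, and the following hold. (1) For every $W_0$-invariant $p\in\mathbb C[P]^{W_0}$, $$\mathrm{Tr}(p(x)\mathbf 1_0)=\frac{1}{|W_0|\,q_{w_0}}\int_{\mathbb T^n}\frac{p(t)}{c(t)c(t^{-1})}\,dt .$$ (2) For every $\mu\in P$, $$\mathrm{Tr}(x^\mu\mathbf 1_0)=\frac1{W_0(q)}\int_{\mathbb T^n}\frac{t^\mu}{c(t^{-1})}\,dt ,$$ and $\mathrm{Tr}(x^\mu\mathbf 1_0)=0$ if $\mu\notin -Q^+$. -/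

import Mathlib

namespace AffineHecke

noncomputable section

open MeasureTheory

variable {ι V E : Type*} [AddCommGroup V] [Module ℝ V] [AddCommGroup E] [Module ℝ E]

/-! ### Root system, Weyl group, coweight lattice

A root system is given as a Mathlib `RootPairing ι ℝ V E`: the roots `α` live in `V`, the coroots
`α^∨` live in the space `E` on which the (affine) Weyl group acts, and `R.root' i : E → ℝ` is the
linear form `λ ↦ ⟨λ, α_i⟩`. -/

section Weyl

variable (R : RootPairing ι ℝ V E)

/-- The Weyl group, as the subgroup of `GL(E)` generated by the reflections
`s_α(λ) = λ - ⟨λ, α⟩ α^∨`. -/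
def weylGroup : Subgroup (E ≃ₗ[ℝ] E) :=
  Subgroup.closure (Set.range R.coreflection)

/-- The coweight lattice `P = {λ | ⟨λ, α⟩ ∈ ℤ for every root α}`. -/
def coweightLattice : AddSubgroup E where
  carrier := {x | ∀ i, ∃ k : ℤ, R.root' i x = k}
  zero_mem' := fun i => ⟨0, by simp⟩
  add_mem' := fun {x y} hx hy i => by
    obtain ⟨k, hk⟩ := hx i
    obtain ⟨l, hl⟩ := hy i
    exact ⟨k + l, by rw [map_add, hk, hl]; push_cast; rfl⟩
  neg_mem' := fun {x} hx i => by
    obtain ⟨k, hk⟩ := hx i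
    exact ⟨-k, by rw [map_neg, hk]; push_cast; rfl⟩

/-- The integer `⟨μ, α_i⟩`. -/
def coweightPairing (μ : coweightLattice R) (i : ι) : ℤ := (μ.2 i).choose

lemma coweightPairing_spec (μ : coweightLattice R) (i : ι) :
    R.root' i (μ : E) = (coweightPairing R μ i : ℝ) := (μ.2 i).choose_spec

variable {R} in
lemma mapsTo_coroot {w : E ≃ₗ[ℝ] E} (hw : w ∈ weylGroup R) :
    ∀ i, ∃ j, w (R.coroot i) = R.coroot j := by
  rw [weylGroup] at hw
  induction hw using Subgroup.closure_induction'' with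
  | one => exact fun i => ⟨i, rfl⟩
  | mem x hx =>
    obtain ⟨k, rfl⟩ := hx
    exact fun i => ⟨R.reflectionPerm k i, (R.coroot_reflectionPerm k i).symm⟩
  | inv_mem x hx =>
    obtain ⟨k, rfl⟩ := hx
    rw [R.coreflection_inv]
    exact fun i => ⟨R.reflectionPerm k i, (R.coroot_reflectionPerm k i).symm⟩
  | mul x y _ _ hx hy =>
    intro i
    obtain ⟨j, hj⟩ := hy i
    obtain ⟨k, hk⟩ := hx j
    exact ⟨k, by rw [LinearEquiv.mul_apply, hj, hk]⟩

instance [Finite ι] [R.IsRootSystem] : Finite (weylGroup R) := by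
  classical
  let f : weylGroup R → ι → ι := fun w i => (mapsTo_coroot w.2 i).choose
  refine Finite.of_injective f fun w w' h => ?_
  have key : ∀ i, w.1 (R.coroot i) = w'.1 (R.coroot i) := fun i => by
    rw [(mapsTo_coroot w.2 i).choose_spec, (mapsTo_coroot w'.2 i).choose_spec]
    exact congrArg R.coroot (congrFun h i)
  apply Subtype.ext
  apply LinearEquiv.toLinearMap_injective
  apply LinearMap.ext_on_range (v := R.coroot) _ key
  exact RootPairing.IsRootSystem.span_coroot_eq_top

instance [Finite ι] [R.IsRootSystem] : Fintype (weylGroup R) := Fintype.ofFinite _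

variable [R.IsCrystallographic]

lemma coroot_mem (j : ι) : R.coroot j ∈ coweightLattice R := fun i => by
  obtain ⟨k, hk⟩ := RootPairing.IsValuedIn.exists_value (P := R) (S := ℤ) i j
  exact ⟨k, hk.symm⟩

variable {R} in
lemma coreflection_mem (j : ι) {x : E} (hx : x ∈ coweightLattice R) :
    R.coreflection j x ∈ coweightLattice R := by
  rw [R.coreflection_apply]
  obtain ⟨k, hk⟩ := hx j
  rw [hk, Int.cast_smul_eq_zsmul]
  exact sub_mem hx (zsmul_mem (coroot_mem R j) k)

variable {R} in
lemma weyl_mem {w : E ≃ₗ[ℝ] E} (hw : w ∈ weylGroup R) {x : E} (hx : x ∈ coweightLattice R) :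
    w x ∈ coweightLattice R := by
  rw [weylGroup] at hw
  induction hw using Subgroup.closure_induction'' generalizing x with
  | one => exact hx
  | mem y hy =>
    obtain ⟨k, rfl⟩ := hy
    exact coreflection_mem k hx
  | inv_mem y hy =>
    obtain ⟨k, rfl⟩ := hy
    rw [R.coreflection_inv]
    exact coreflection_mem k hx
  | mul y z _ _ hy hz => exact hy (hz hx)

/-- The action of an element `w` of the Weyl group on the coweight lattice, `λ ↦ wλ`. -/
def weylAct (w : weylGroup R) : coweightLattice R ≃+ coweightLattice R where
  toFun x := ⟨w.1 x.1, weyl_mem w.2 x.2⟩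
  invFun x := ⟨w.1⁻¹ x.1, weyl_mem (inv_mem w.2) x.2⟩
  left_inv x := Subtype.ext (w.1.symm_apply_apply x.1)
  right_inv x := Subtype.ext (w.1.apply_symm_apply x.1)
  map_add' x y := Subtype.ext (map_add w.1 x.1 y.1)

/-- The action `weylAct`, on the lattice written multiplicatively. -/
def weylActMul : weylGroup R →* MulAut (Multiplicative (coweightLattice R)) where
  toFun w := AddEquiv.toMultiplicative (weylAct R w)
  map_one' := rfl
  map_mul' _ _ := rfl

/-- The extended affine Weyl group `P ⋊ W₀`. -/
abbrev ExtWeyl := Multiplicative (coweightLattice R) ⋊[weylActMul R] weylGroup R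

/-- The translation `t_μ`. -/
def transl (μ : coweightLattice R) : ExtWeyl R := SemidirectProduct.inl (Multiplicative.ofAdd μ)

/-- The inclusion of `W₀`. -/
def ofWeyl (w : weylGroup R) : ExtWeyl R := SemidirectProduct.inr w

variable {R} in
/-- The action of `t_μ w` on `E`: `λ ↦ w λ + μ`. -/
def act (v : ExtWeyl R) (x : E) : E := v.right.1 x + ((Multiplicative.toAdd v.left : coweightLattice R) : E)

/-- The linear reflection `s_α ∈ W₀`. -/
def rootRefl (i : ι) : weylGroup R := ⟨R.coreflection i, Subgroup.subset_closure ⟨i, rfl⟩⟩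

end Weyl

section Affine

variable [Fintype ι] {R : RootPairing ι ℝ V E} (b : R.Base)

/-- The highest root `φ`: the root of maximal height. -/
def highestRoot [Nonempty ι] : ι := (Finite.exists_max b.height).choose

/-- The fundamental alcove `{λ | ⟨λ, α_i⟩ > 0 for the simple roots α_i, and ⟨λ, φ⟩ < 1}`. -/
def fundAlcove [Nonempty ι] : Set E :=
  {x | (∀ i ∈ b.support, 0 < R.root' i x) ∧ R.root' (highestRoot b) x < 1}

variable [R.IsCrystallographic] [Nonempty ι]

/-- The distinguished generators of the affine Weyl group: `some i` is the simple reflection `s_i`,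
and `none` is `s_0 = t_{φ^∨} s_φ`, the reflection in `{λ | ⟨λ, φ⟩ = 1}`. -/
def simpleRefl : Option b.support → ExtWeyl R
  | none => transl R ⟨R.coroot (highestRoot b), coroot_mem R _⟩ * ofWeyl R (rootRefl R (highestRoot b))
  | some i => ofWeyl R (rootRefl R i)

/-- The length of `v`: the number of hyperplanes `{λ | ⟨λ, α⟩ + k = 0}` (each counted once, through
its positive root `α`) separating the fundamental alcove from its image under `v`. -/
def length (v : ExtWeyl R) : ℕ :=
  Set.ncard {h : ι × ℤ | b.IsPos h.1 ∧ ∀ x ∈ fundAlcove b, ∀ y ∈ fundAlcove b,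
    (R.root' h.1 x + h.2) * (R.root' h.1 (act v y) + h.2) < 0}

/-- `v = s_{i_1} ⋯ s_{i_ℓ} γ` with `γ` of length zero. -/
def IsExpression (L : List (Option b.support)) (γ v : ExtWeyl R) : Prop :=
  length b γ = 0 ∧ v = (L.map (simpleRefl b)).prod * γ

/-- The step from the alcove `x` to `x s_i` goes from the negative to the positive side of the
hyperplane `{λ | ⟨λ, α⟩ + k = 0}`, `α` positive, between them. -/
def IsPositiveCrossing (x : ExtWeyl R) (i : Option b.support) : Prop :=
  ∃ (α : ι) (k : ℤ), b.IsPos α ∧ (∀ y ∈ fundAlcove b, R.root' α (act x y) + k < 0) ∧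
    ∀ y ∈ fundAlcove b, 0 < R.root' α (act (x * simpleRefl b i) y) + k

/-- The longest element `w₀` of `W₀`. -/
def longest [R.IsRootSystem] : weylGroup R :=
  (Finite.exists_max fun w : weylGroup R => length b (ofWeyl R w)).choose

/-- A reduced parameter system: real numbers `q_0, …, q_n > 1` with `q_i = q_j` whenever `s_i` and
`s_j` are conjugate in the extended affine Weyl group `P ⋊ W₀`. -/
structure IsReducedParameterSystem (q : Option b.support → ℝ) : Prop where
  one_lt : ∀ i, 1 < q i
  eq_of_isConj : ∀ i j, IsConj (simpleRefl b i) (simpleRefl b j) → q i = q j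

variable (q : Option b.support → ℝ)

/-- `q_v = q_{i_1} ⋯ q_{i_ℓ}` for any reduced expression `v = s_{i_1} ⋯ s_{i_ℓ} γ`. -/
def qElt (v : ExtWeyl R) : ℝ :=
  Classical.epsilon fun r => ∃ L γ, IsExpression b L γ v ∧ L.length = length b v ∧
    r = (L.map q).prod

/-- `q_α = q_i` for any simple root `α_i` with `α ∈ W₀ α_i` (equivalently `α^∨ ∈ W₀ α_i^∨`). -/
def qRoot (α : ι) : ℝ :=
  Classical.epsilon fun r => ∃ i : b.support, (∃ w : weylGroup R, w.1 (R.coroot i) = R.coroot α) ∧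
    r = q (some i)

/-! ### The extended affine Hecke algebra -/

/-- The defining relations of the extended affine Hecke algebra. -/
inductive HeckeRel : FreeAlgebra ℂ (ExtWeyl R) → FreeAlgebra ℂ (ExtWeyl R) → Prop
  | one : HeckeRel (FreeAlgebra.ι ℂ 1) 1
  | mul (u v : ExtWeyl R) : length b (u * v) = length b u + length b v →
      HeckeRel (FreeAlgebra.ι ℂ u * FreeAlgebra.ι ℂ v) (FreeAlgebra.ι ℂ (u * v))
  | quad (w : ExtWeyl R) (i : Option b.support) :
      length b w = length b (w * simpleRefl b i) + 1 →
      HeckeRel (FreeAlgebra.ι ℂ w * FreeAlgebra.ι ℂ (simpleRefl b i))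
        (FreeAlgebra.ι ℂ (w * simpleRefl b i) +
          ((√(q i) - (√(q i))⁻¹ : ℝ) : ℂ) • FreeAlgebra.ι ℂ w)

/-- The extended affine Hecke algebra, by generators `T_w`, `w ∈ P ⋊ W₀`, and relations. -/
abbrev Hecke := RingQuot (HeckeRel b q)

/-- The generator `T_w`. -/
def T (w : ExtWeyl R) : Hecke b q := RingQuot.mkAlgHom ℂ (HeckeRel b q) (FreeAlgebra.ι ℂ w)

/-- `f(∑ c_w T_w) = c_1`, i.e. `f(T_w) = δ_{w,1}`. -/
def IsHeckeTrace (f : Hecke b q →ₗ[ℂ] ℂ) : Prop :=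
  f (T b q 1) = 1 ∧ ∀ w, w ≠ 1 → f (T b q w) = 0

/-- The trace `Tr`, the linear functional with `Tr(∑ c_w T_w) = c_1`. -/
def trace : Hecke b q →ₗ[ℂ] ℂ := Classical.epsilon (IsHeckeTrace b q)

open Classical in
/-- `T_{i_1}^{ε_1} ⋯ T_{i_ℓ}^{ε_ℓ}` for the unfolded alcove walk of type `i_1, …, i_ℓ` starting at
the alcove `x`; `ε_k = 1` at the positive crossings and `ε_k = -1` at the negative ones. -/
def walkProd : ExtWeyl R → List (Option b.support) → Hecke b q
  | _, [] => 1
  | x, i :: L =>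
    (if IsPositiveCrossing b x i then T b q (simpleRefl b i)
      else Ring.inverse (T b q (simpleRefl b i))) * walkProd (x * simpleRefl b i) L

/-- `h = T_{i_1}^{ε_1} ⋯ T_{i_ℓ}^{ε_ℓ} T_γ` for some, not necessarily reduced, expression
`v = s_{i_1} ⋯ s_{i_ℓ} γ`. -/
def IsAlcoveElement (v : ExtWeyl R) (h : Hecke b q) : Prop :=
  ∃ L γ, IsExpression b L γ v ∧ h = walkProd b q 1 L * T b q γ

/-- The element `x_v`, computed from any expression of `v`. -/
def alcoveElt (v : ExtWeyl R) : Hecke b q := Classical.epsilon (IsAlcoveElement b q v)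

/-- `x^μ = x_{t_μ}`. -/
def xPow (μ : coweightLattice R) : Hecke b q := alcoveElt b q (transl R μ)

/-- `p(x) = ∑ p_μ x^μ` for `p` in the group algebra `ℂ[P]`. -/
def evalX (p : AddMonoidAlgebra ℂ (coweightLattice R)) : Hecke b q :=
  p.coeff.sum fun μ a => a • xPow b q μ

section Idempotent

variable [R.IsRootSystem]

/-- `W₀(q) = ∑_{w ∈ W₀} q_w`. -/
def poincare : ℝ := ∑ w : weylGroup R, qElt b q (ofWeyl R w)

/-- `1_0 = W₀(q)⁻¹ ∑_{w ∈ W₀} q_w^{1/2} T_w`. -/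
def oneZero : Hecke b q :=
  ((poincare b q : ℝ) : ℂ)⁻¹ • ∑ w : weylGroup R, ((√(qElt b q (ofWeyl R w)) : ℝ) : ℂ) •
    T b q (ofWeyl R w)

end Idempotent

/-! ### The torus

`Hom(P, 𝕋) ≅ 𝕋^n` via `t ↦ (t^{ω_1}, …, t^{ω_n})`; the `n`-torus is modelled by `(ℝ/ℤ)^n` with
`t^{ω_j} = exp(2πi θ_j)`. As `μ = ∑ ⟨μ, α_j⟩ ω_j`, `t^μ = ∏ exp(2πi ⟨μ, α_j⟩ θ_j)`, and `t⁻¹`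
corresponds to `-θ`. -/

/-- `t^μ`. -/
def tPow (t : UnitAddTorus b.support) (μ : coweightLattice R) : ℂ :=
  UnitAddTorus.mFourier (fun j : b.support => coweightPairing R μ j) t

/-- `p(t) = ∑ p_μ t^μ`. -/
def evalT (p : AddMonoidAlgebra ℂ (coweightLattice R)) (t : UnitAddTorus b.support) : ℂ :=
  p.coeff.sum fun μ a => a * tPow b t μ

open Classical in
/-- `c(t) = ∏_{α > 0} (1 - q_α⁻¹ t^{-α^∨}) / (1 - t^{-α^∨})`. -/
def cFun (t : UnitAddTorus b.support) : ℂ :=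
  ∏ α : ι with b.IsPos α,
    (1 - ((qRoot b q α : ℝ) : ℂ)⁻¹ * tPow b t (-⟨R.coroot α, coroot_mem R α⟩)) /
      (1 - tPow b t (-⟨R.coroot α, coroot_mem R α⟩))

/-- Normalised Haar measure on the `n`-torus. -/
def torusHaar : Measure (UnitAddTorus b.support) :=
  Measure.pi fun _ => AddCircle.haarAddCircle

/-- `p ∈ ℂ[P]^{W₀}`, i.e. `p` is fixed by `x^λ ↦ x^{wλ}` for every `w ∈ W₀`. -/
def IsWeylInvariant (p : AddMonoidAlgebra ℂ (coweightLattice R)) : Prop :=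
  ∀ w : weylGroup R, AddMonoidAlgebra.mapDomain (weylAct R w) p = p

end Affine

end

end AffineHecke

namespace AffineHecke

noncomputable section

open MeasureTheory

set_option linter.unusedSectionVars false

/-! ### Roots, coroots and coweights under the Weyl group -/

section RootSystem

variable {ι V E : Type*} [AddCommGroup V] [Module ℝ V] [AddCommGroup E] [Module ℝ E]
variable {R : RootPairing ι ℝ V E}

/-! ### The permutation action of the Weyl group on the roots -/

/-! Everything reduces to the function g(μ) = Tr(x^μ 1_0) on the coweight lattice. The trace exists
because the algebra acts on the free module on P ⋊ W₀: left and right multiplications by generators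
commute (`leftOp_comm_rightOp`, where conjugate reflections must share a parameter), an operator
commuting with the right ones is determined by the image of the basis vector at 1
(`centralizer_ext`), and Tr reads off a coefficient of that image. It satisfies Tr(T_u T_v) =
δ_{uv,1}, hence is symmetric (`IsHeckeTrace.mul_comm`).

The element x_v is well defined since, after left multiplication by T of a far dominant translation,
the sign of each crossing is the sign of the length change, and the walk telescopes to a single T
(`T_mul_walkProd`, `isAlcoveElement_iff`). Hence x^μ is multiplicative in μ, equals T_{t_μ} for
dominant μ, and satisfies the Bernstein relation (`T_simpleRefl_mul_xPow`).

For (2), T_{s_i} acts on 1_0 from either side by q_i^{1/2}; with the symmetry of Tr, the Bernstein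
relation becomes a linear recursion for g (`isBernstein_trace`). A solution is determined by its
values at dominant coweights (`IsBernstein.eq`), where g is δ_{μ,0}/W₀(q). The moments of 1/c(t⁻¹)
solve the same recursion, because 1/c(t⁻¹) is its α_i-factor times an s_i-invariant function
(`isBernstein_cMoment`). They vanish off -Q⁺ and equal 1 at 0, as geometric expansion predicts
(`moments_prod_rootFactor`), and 0 is the only dominant element of -Q⁺. So both functions agree up
to the factor 1/W₀(q) (`trace_xPow_mul_oneZero`).

For (1), linearity gives W₀(q)⁻¹ ∫ p(t)/c(t⁻¹) dt, and it remains to symmetrise over W₀. With Δ = ∏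
(1 - t^{α^∨}) and G invariant, expanding ∏ (1 - r_α t^{-α^∨}) over subsets S of R⁺ yields the
integrals of G t^{-Σ_S α^∨} Δ. These are the values at ρ - Σ_S α^∨ of a function odd under W₀, so
only inversion sets S survive, and their signs cancel (`eq_zero_or_eq_weylInv`,
`integral_mul_prod_mul_weylDenom`). The choices r_α = q_α⁻¹ and r_α = 1, with the same G, compare
the two integrals: their ratio is Σ_w q_w⁻¹ to |W₀| (`integral_div_cFun_neg`). Finally W₀(q) =
q_{w₀} Σ_w q_w⁻¹ (`poincare_eq`). -/

lemma root'_reflectionPerm_coreflection (k i : ι) (x : E) :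
    R.root' (R.reflectionPerm k i) (R.coreflection k x) = R.root' i x := by
  simp only [RootPairing.root', R.root_reflectionPerm, R.reflection_apply, R.coreflection_apply,
    map_sub, map_smul, LinearMap.sub_apply, LinearMap.smul_apply, smul_eq_mul,
    R.root_coroot_two, LinearMap.flip_apply, RootPairing.coroot']
  ring

lemma root'_reflectionPerm_self (i : ι) (x : E) :
    R.root' (R.reflectionPerm i i) x = -R.root' i x := by
  simp [RootPairing.root', R.root_reflectionPerm]

/-- `weylGroup` acts on `E` only, so the action on roots has to be read off from that on coroots;
induction over the generating reflections shows that the two match. -/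
lemma root'_of_map_coroot {w : E ≃ₗ[ℝ] E} (hw : w ∈ weylGroup R) {i j : ι}
    (h : w (R.coroot i) = R.coroot j) (x : E) : R.root' j (w x) = R.root' i x := by
  rw [weylGroup] at hw
  induction hw using Subgroup.closure_induction'' generalizing i j x with
  | one =>
    have : i = j := R.coroot.injective h
    subst this; rfl
  | mem y hy =>
    obtain ⟨k, rfl⟩ := hy
    rw [← R.coroot_reflectionPerm] at h
    rw [← R.coroot.injective h]
    exact root'_reflectionPerm_coreflection k i x
  | inv_mem y hy =>
    obtain ⟨k, rfl⟩ := hy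
    rw [R.coreflection_inv] at h ⊢
    rw [← R.coroot_reflectionPerm] at h
    rw [← R.coroot.injective h]
    exact root'_reflectionPerm_coreflection k i x
  | mul y z hy hz ihy ihz =>
    obtain ⟨k, hk⟩ := mapsTo_coroot (R := R) hz i
    rw [LinearEquiv.mul_apply, hk] at h
    rw [LinearEquiv.mul_apply, ihy h, ihz hk]

variable (R) in
/-- The permutation of the (indices of the) roots given by an element of the Weyl group. -/
def weylPerm : weylGroup R →* Equiv.Perm ι :=
  MonoidHom.toHomPerm
    { toFun := fun w i => (mapsTo_coroot w.2 i).choose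
      map_one' := funext fun i => R.coroot.injective (mapsTo_coroot (1 : weylGroup R).2 i).choose_spec.symm
      map_mul' := fun u v => funext fun i => R.coroot.injective <|
        (mapsTo_coroot (u * v).2 i).choose_spec.symm.trans
          ((congrArg u.1 (mapsTo_coroot v.2 i).choose_spec).trans
            (mapsTo_coroot u.2 _).choose_spec) }

lemma coroot_weylPerm (w : weylGroup R) (i : ι) : R.coroot (weylPerm R w i) = w.1 (R.coroot i) :=
  (mapsTo_coroot w.2 i).choose_spec.symm

@[simp] lemma root'_weylPerm (w : weylGroup R) (i : ι) (x : E) :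
    R.root' (weylPerm R w i) (w.1 x) = R.root' i x :=
  root'_of_map_coroot w.2 (coroot_weylPerm w i).symm x

lemma root'_weylPerm' (w : weylGroup R) (i : ι) (x : E) :
    R.root' (weylPerm R w i) x = R.root' i (w⁻¹.1 x) := by
  rw [← root'_weylPerm w i]
  congr 1
  exact (w.1.apply_symm_apply x).symm

lemma weylPerm_rootRefl (k i : ι) : weylPerm R (rootRefl R k) i = R.reflectionPerm k i :=
  R.coroot.injective <| by rw [coroot_weylPerm, R.coroot_reflectionPerm]; rfl

lemma weylPerm_reflectionPerm_self (w : weylGroup R) (i : ι) :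
    weylPerm R w (R.reflectionPerm i i) = R.reflectionPerm (weylPerm R w i) (weylPerm R w i) :=
  R.coroot.injective <| by
    rw [coroot_weylPerm, R.coroot_reflectionPerm, R.coroot_reflectionPerm,
      R.coreflection_apply_self, R.coreflection_apply_self, map_neg, coroot_weylPerm]

lemma root'_injective {i j : ι} (h : ∀ x, R.root' i x = R.root' j x) : i = j := by
  apply R.root.injective
  apply R.toPerfPair.injective
  ext x
  exact h x

lemma rootRefl_mul_self (i : ι) : rootRefl R i * rootRefl R i = 1 :=
  Subtype.ext ((pow_two (R.coreflection i)).symm.trans (R.coreflection_sq i))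

lemma rootRefl_weylPerm (w : weylGroup R) (i : ι) :
    rootRefl R (weylPerm R w i) = w * rootRefl R i * w⁻¹ := by
  apply Subtype.ext
  apply LinearEquiv.ext
  intro x
  change R.coreflection _ x = w.1 (R.coreflection i (w⁻¹.1 x))
  rw [R.coreflection_apply, R.coreflection_apply, map_sub, map_smul, coroot_weylPerm,
    root'_weylPerm']
  congr 1
  exact (w.1.apply_symm_apply x).symm

/-! ### Positive roots and coroots -/

variable (b : R.Base)

lemma isPos_reflectionPerm_self {i : ι} : b.IsPos (R.reflectionPerm i i) ↔ ¬ b.IsPos i :=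
  RootPairing.Base.IsPos.neg_iff_not b i

lemma height_reflectionPerm_self' (i : ι) : b.height (R.reflectionPerm i i) = -b.height i :=
  b.height_reflectionPerm_self i

variable {b}

lemma IsPos.exists_root_eq {i : ι} (h : b.IsPos i) :
    ∃ f : ι → ℕ, R.root i = ∑ j ∈ b.support, f j • R.root j := by
  obtain ⟨f, -, hf | hf⟩ := b.exists_root_eq_sum_nat_or_neg i
  · exact ⟨f, hf⟩
  · exfalso
    have : R.root i = ∑ j ∈ b.support, (-(f j : ℤ)) • R.root j := by
      rw [hf, ← Finset.sum_neg_distrib]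
      simp
    rw [RootPairing.Base.isPos_iff, RootPairing.Base.height_eq_sum this] at h
    have := Finset.sum_nonpos (s := b.support) (f := fun j => -(f j : ℤ)) (fun j _ => by simp)
    lia

/-- Supplies explicit test points: where all simple roots take one value ε, every root is governed
by its height. Used for a point of the alcove and for a point on the wall of `s_0`. -/
lemma height_coe_eq (i : ι) {x : E} {ε : ℝ} (hx : ∀ j ∈ b.support, R.root' j x = ε) :
    R.root' i x = ε * b.height i := by
  obtain ⟨f, -, -, hf⟩ := b.exists_root_eq_sum_int i
  rw [RootPairing.Base.height_eq_sum hf, RootPairing.root', hf]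
  simp only [map_sum, LinearMap.sum_apply, Int.cast_sum, Finset.mul_sum]
  refine Finset.sum_congr rfl fun j hj => ?_
  rw [map_zsmul, LinearMap.smul_apply, ← hx j hj, zsmul_eq_mul, mul_comm]

lemma IsPos.root'_nonneg {i : ι} (h : b.IsPos i) {x : E} (hx : ∀ j ∈ b.support, 0 ≤ R.root' j x) :
    0 ≤ R.root' i x := by
  obtain ⟨f, hf⟩ := IsPos.exists_root_eq h
  rw [RootPairing.root', hf]
  simp only [map_sum, LinearMap.sum_apply]
  refine Finset.sum_nonneg fun j hj => ?_
  rw [map_nsmul, LinearMap.smul_apply]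
  exact nsmul_nonneg (hx j hj) _

lemma IsPos.root'_pos {i : ι} (h : b.IsPos i) {x : E} (hx : ∀ j ∈ b.support, 0 < R.root' j x) :
    0 < R.root' i x := by
  obtain ⟨f, hf⟩ := IsPos.exists_root_eq h
  have hne : ∃ j ∈ b.support, f j ≠ 0 := by
    by_contra! hc
    exact R.ne_zero i (by rw [hf]; exact Finset.sum_eq_zero fun j hj => by rw [hc j hj, zero_smul])
  obtain ⟨j, hj, hj0⟩ := hne
  rw [RootPairing.root', hf]
  simp only [map_sum, LinearMap.sum_apply]
  refine Finset.sum_pos' (fun j hj => ?_) ⟨j, hj, ?_⟩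
  · rw [map_nsmul, LinearMap.smul_apply]
    exact nsmul_nonneg (hx j hj).le _
  · rw [map_nsmul, LinearMap.smul_apply]
    exact nsmul_pos (hx j hj) hj0

variable [Finite ι] [R.IsCrystallographic] [R.IsReduced]

/-- Both notions of positivity agree on simple roots, and both survive a simple reflection s_j away
from ±α_j, so the agreement propagates. It lets statements about positive roots be used for their
coroots. -/
lemma isPos_flip_iff (i : ι) : b.flip.IsPos i ↔ b.IsPos i := by
  have hneg : ∀ i, b.flip.IsPos (R.reflectionPerm i i) ↔ ¬ b.flip.IsPos i := fun i =>
    isPos_reflectionPerm_self (R := R.flip) b.flip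
  refine b.induction_reflect i (p := fun i => b.flip.IsPos i ↔ b.IsPos i) ?_ ?_ ?_
  · intro i hi
    rw [isPos_reflectionPerm_self, hneg, hi]
  · intro i hi
    exact iff_of_true (RootPairing.Base.isPos_of_mem_support (b := b.flip) hi)
      (RootPairing.Base.isPos_of_mem_support hi)
  · intro i j hi hj
    by_cases h1 : i = j
    · subst h1
      rw [isPos_reflectionPerm_self, hneg, hi]
    by_cases h2 : i = R.reflectionPerm j j
    · subst h2
      rw [R.reflectionPerm_self]
      exact iff_of_true (RootPairing.Base.isPos_of_mem_support (b := b.flip) hj)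
        (RootPairing.Base.isPos_of_mem_support hj)
    -- For a negative root the argument is applied to its opposite, using s_j(-α) = -s_j(α).
    by_cases hp : b.IsPos i
    · exact iff_of_true ((hi.2 hp).reflectionPerm (b := b.flip) hj h1) (hp.reflectionPerm hj h1)
    · have hne : R.reflectionPerm i i ≠ j := by
        intro h; apply h2; rw [← R.root_eq_neg_iff, ← h]; simp
      have key : R.reflectionPerm j (R.reflectionPerm i i) =
          R.reflectionPerm (R.reflectionPerm j i) (R.reflectionPerm j i) :=
        R.root.injective (by
          rw [R.root_reflectionPerm, R.root_reflectionPerm i, R.reflection_apply_self, map_neg,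
            R.root_reflectionPerm (R.reflectionPerm j i), R.reflection_apply_self,
            R.root_reflectionPerm])
      have hp' := (isPos_reflectionPerm_self b).2 hp
      have hq' := (hneg i).2 (fun h => hp (hi.1 h))
      have h3 := hp'.reflectionPerm hj hne
      have h4 := hq'.reflectionPerm (b := b.flip) hj hne
      rw [key, isPos_reflectionPerm_self] at h3
      change b.flip.IsPos (R.reflectionPerm j (R.reflectionPerm i i)) at h4
      rw [key, hneg] at h4
      exact iff_of_false h4 h3

lemma IsPos.exists_coroot_eq {i : ι} (h : b.IsPos i) :
    ∃ f : ι → ℕ, R.coroot i = ∑ j ∈ b.support, f j • R.coroot j :=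
  IsPos.exists_root_eq (R := R.flip) (b := b.flip) ((isPos_flip_iff i).2 h)

lemma IsPos.coroot_mem {i : ι} (h : b.IsPos i) :
    R.coroot i ∈ AddSubmonoid.closure (R.coroot '' b.support) := by
  obtain ⟨f, hf⟩ := IsPos.exists_coroot_eq h
  rw [hf]
  exact sum_mem fun j hj => nsmul_mem (AddSubmonoid.subset_closure (Set.mem_image_of_mem _ hj)) _

/-! ### Coweights with prescribed pairings -/

variable [R.IsRootSystem]

variable (b) in
lemma exists_root'_eq (f : ι → ℝ) : ∃ x : E, ∀ j ∈ b.support, R.root' j x = f j := by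
  refine ⟨R.flip.toPerfPair.symm (b.toWeightBasis.constr ℝ fun j : b.support => f j), fun j hj => ?_⟩
  have h : R.flip.toPerfPair (R.flip.toPerfPair.symm
      (b.toWeightBasis.constr ℝ fun j : b.support => f j)) (b.toWeightBasis ⟨j, hj⟩) = f j := by
    rw [LinearEquiv.apply_symm_apply, Module.Basis.constr_basis]
  rw [RootPairing.Base.toWeightBasis_apply] at h
  exact h

lemma mem_coweightLattice_of_support {x : E} (hx : ∀ j ∈ b.support, ∃ k : ℤ, R.root' j x = k) :
    x ∈ coweightLattice R := by
  intro i
  obtain ⟨f, -, -, hf⟩ := b.exists_root_eq_sum_int i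
  choose! k hk using hx
  refine ⟨∑ j ∈ b.support, f j * k j, ?_⟩
  rw [RootPairing.root', hf]
  simp only [map_sum, LinearMap.sum_apply, Int.cast_sum]
  refine Finset.sum_congr rfl fun j hj => ?_
  rw [map_zsmul, LinearMap.smul_apply, zsmul_eq_mul, Int.cast_mul, ← hk j hj]

lemma ext_root'_support {x y : E} (h : ∀ j ∈ b.support, R.root' j x = R.root' j y) : x = y := by
  apply R.flip.toPerfPair.injective
  refine b.toWeightBasis.ext fun j => ?_
  rw [RootPairing.Base.toWeightBasis_apply]
  exact h j j.2

lemma coweightPairing_add (μ ν : coweightLattice R) (i : ι) :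
    coweightPairing R (μ + ν) i = coweightPairing R μ i + coweightPairing R ν i := by
  have h : ((coweightPairing R (μ + ν) i : ℤ) : ℝ) =
      (coweightPairing R μ i + coweightPairing R ν i : ℤ) := by
    rw [← coweightPairing_spec, Int.cast_add, ← coweightPairing_spec, ← coweightPairing_spec,
      AddSubgroup.coe_add, map_add]
  exact_mod_cast h

lemma coweightPairing_eq {μ : coweightLattice R} {i : ι} {k : ℤ} (h : R.root' i (μ : E) = k) :
    coweightPairing R μ i = k := by
  rw [coweightPairing_spec] at h
  exact_mod_cast h

variable (b) in
lemma exists_coweightPairing_eq (f : ι → ℤ) :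
    ∃ μ : coweightLattice R, ∀ j ∈ b.support, coweightPairing R μ j = f j := by
  obtain ⟨x, hx⟩ := exists_root'_eq b fun j => (f j : ℝ)
  exact ⟨⟨x, mem_coweightLattice_of_support fun j hj => ⟨f j, hx j hj⟩⟩,
    fun j hj => coweightPairing_eq (hx j hj)⟩

lemma ext_coweightPairing_support {μ ν : coweightLattice R}
    (h : ∀ j ∈ b.support, coweightPairing R μ j = coweightPairing R ν j) : μ = ν :=
  Subtype.ext <| ext_root'_support fun j hj => by
    rw [coweightPairing_spec, coweightPairing_spec, h j hj]

end RootSystem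

/-! ### The highest root -/

section HighestRoot

variable {ι V E : Type*} [AddCommGroup V] [Module ℝ V] [AddCommGroup E] [Module ℝ E]
variable {R : RootPairing ι ℝ V E} {b : R.Base} [Fintype ι] [Nonempty ι]

lemma height_le_highestRoot (i : ι) : b.height i ≤ b.height (highestRoot b) :=
  (Finite.exists_max b.height).choose_spec i

lemma isPos_highestRoot : b.IsPos (highestRoot b) := by
  obtain ⟨i⟩ := ‹Nonempty ι›
  have h1 := height_le_highestRoot (b := b) i
  have h2 := height_le_highestRoot (b := b) (R.reflectionPerm i i)
  have h3 := b.height_ne_zero i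
  rw [height_reflectionPerm_self'] at h2
  rw [RootPairing.Base.isPos_iff]
  lia

variable [R.IsCrystallographic]

lemma pairingIn_nonneg_of_forall_add {i : ι} (hi : b.IsPos i)
    (h : ∀ j ∈ b.support, R.root i + R.root j ∉ Set.range R.root) {j : ι} (hj : j ∈ b.support) :
    0 ≤ R.pairingIn ℤ i j := by
  by_contra! hc
  refine h j hj (R.root_add_root_mem_of_pairingIn_neg hc fun he => ?_)
  rw [R.root_eq_neg_iff] at he
  rw [he, isPos_reflectionPerm_self] at hi
  exact hi (RootPairing.Base.isPos_of_mem_support hj)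

lemma pairingIn_highestRoot_nonneg {j : ι} (hj : j ∈ b.support) :
    0 ≤ R.pairingIn ℤ (highestRoot b) j := by
  refine pairingIn_nonneg_of_forall_add isPos_highestRoot (fun j hj ⟨k, hk⟩ => ?_) hj
  have h1 := height_le_highestRoot (b := b) k
  rw [b.height_add hk, RootPairing.Base.height_one_of_mem_support hj] at h1
  lia

variable [R.IsReduced] [R.IsIrreducible]

/-- A positive root to which no simple root can be added involves all simple roots. -/
lemma coeff_ne_zero_of_forall_add {i : ι} (hi : b.IsPos i)
    (h : ∀ j ∈ b.support, R.root i + R.root j ∉ Set.range R.root) {f : ι → ℕ}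
    (hf : R.root i = ∑ j ∈ b.support, f j • R.root j) {k : ι} (hk : k ∈ b.support) : f k ≠ 0 := by
  classical
  set J : Set ι := {j | j ∈ b.support ∧ f j ≠ 0} with hJ
  set q : Submodule ℝ V := Submodule.span ℝ (R.root '' J) with hq
  have hiq : R.root i ∈ q := by
    rw [hf]
    refine sum_mem fun j hj => ?_
    by_cases h0 : f j = 0
    · rw [h0, zero_smul]; exact zero_mem _
    · exact q.smul_of_tower_mem (f j) (Submodule.subset_span ⟨j, ⟨hj, h0⟩, rfl⟩)
  -- A simple root l outside the support J of α pairs non-positively with every member of J, while α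
  -- itself pairs non-negatively with l; so all these pairings vanish. The span of J is then stable
  -- under all simple reflections, and irreducibility makes it everything.
  have horth : ∀ l ∈ b.support, l ∉ J → ∀ j ∈ J, R.pairingIn ℤ j l = 0 := by
    intro l hl hlJ
    have hsum : R.pairingIn ℤ i l = ∑ j ∈ b.support, f j * R.pairingIn ℤ j l := by
      have : ((R.pairingIn ℤ i l : ℤ) : ℝ) =
          ((∑ j ∈ b.support, f j * R.pairingIn ℤ j l : ℤ) : ℝ) := by
        have e : ∀ a c, ((R.pairingIn ℤ a c : ℤ) : ℝ) = R.pairing a c := fun a c =>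
          R.algebraMap_pairingIn ℤ a c
        push_cast
        simp_rw [e, ← RootPairing.root_coroot_eq_pairing, hf, map_sum, LinearMap.sum_apply,
          map_nsmul, LinearMap.smul_apply, nsmul_eq_mul]
      exact_mod_cast this
    have hle : ∀ j ∈ b.support, (f j : ℤ) * R.pairingIn ℤ j l ≤ 0 := by
      intro j hj
      by_cases hjl : j = l
      · subst hjl
        have : f j = 0 := by by_contra h0; exact hlJ ⟨hj, h0⟩
        simp [this]
      · exact mul_nonpos_of_nonneg_of_nonpos (by positivity) (b.pairingIn_le_zero_of_ne hjl hj hl)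
    have h0 : ∑ j ∈ b.support, f j * R.pairingIn ℤ j l = 0 :=
      le_antisymm (Finset.sum_nonpos hle) (hsum ▸ pairingIn_nonneg_of_forall_add hi h hl)
    intro j hj
    have := (Finset.sum_eq_zero_iff_of_nonpos hle).1 h0 j hj.1
    rcases mul_eq_zero.1 this with h1 | h1
    · exact absurd (by exact_mod_cast h1) hj.2
    · exact h1
  have htop : q = ⊤ := by
    refine RootPairing.IsIrreducible.eq_top_of_invtSubmodule_reflection (P := R) q
      ((b.forall_mem_support_invtSubmodule_iff q).1 fun l hl => ?_) ?_
    · rw [Module.End.mem_invtSubmodule, hq, Submodule.span_le]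
      rintro - ⟨j, hj, rfl⟩
      change R.reflection l (R.root j) ∈ q
      rw [R.reflection_apply_root]
      refine sub_mem (Submodule.subset_span ⟨j, hj, rfl⟩) ?_
      by_cases hlJ : l ∈ J
      · exact Submodule.smul_mem _ _ (Submodule.subset_span ⟨l, hlJ, rfl⟩)
      · have := horth l hl hlJ j hj
        rw [← R.algebraMap_pairingIn ℤ, this]
        simp
    · intro h0
      rw [h0] at hiq
      exact R.ne_zero i ((Submodule.mem_bot ℝ).1 hiq)
  by_contra h0
  have hkJ : k ∉ J := fun hkJ => hkJ.2 h0
  have : R.root k ∈ q := htop ▸ Submodule.mem_top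
  refine (linearIndepOn_iff_notMem_span.1 b.linearIndepOn_root) k hk
    (Submodule.span_mono (Set.image_mono ?_) this)
  exact fun j hj => ⟨hj.1, fun hjk => hkJ (by rw [← Set.mem_singleton_iff.1 hjk]; exact hj)⟩

/-- The highest root dominates every root. -/
lemma highestRoot_sub_mem (i : ι) :
    R.root (highestRoot b) - R.root i ∈ AddSubmonoid.closure (R.root '' b.support) := by
  classical
  have hmem : ∀ k, b.IsPos k → R.root k ∈ AddSubmonoid.closure (R.root '' b.support) := by
    intro k hk
    obtain ⟨f, hf⟩ := IsPos.exists_root_eq hk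
    rw [hf]
    exact sum_mem fun j hj => nsmul_mem (AddSubmonoid.subset_closure (Set.mem_image_of_mem _ hj)) _
  by_cases hi : b.IsPos i
  -- Climb to a positive root k above i of maximal height; no simple root can be added to it. The
  -- rest shows k = φ, or that k can be compared with φ directly.
  · set S : Finset ι := Finset.univ.filter fun k => b.IsPos k ∧
      R.root k - R.root i ∈ AddSubmonoid.closure (R.root '' b.support) with hS
    obtain ⟨k, hkS, hk⟩ := S.exists_max_image b.height ⟨i, by simp [hS, hi]⟩
    obtain ⟨-, hkpos, hki⟩ := Finset.mem_filter.1 hkS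
    have hkmax : ∀ j ∈ b.support, R.root k + R.root j ∉ Set.range R.root := by
      rintro j hj ⟨l, hl⟩
      have hlS : l ∈ S := by
        rw [hS, Finset.mem_filter]
        refine ⟨Finset.mem_univ _, hkpos.add (RootPairing.Base.isPos_of_mem_support hj) hl, ?_⟩
        rw [hl, add_sub_right_comm]
        exact add_mem hki (AddSubmonoid.subset_closure ⟨j, hj, rfl⟩)
      have := hk l hlS
      rw [b.height_add hl, RootPairing.Base.height_one_of_mem_support hj] at this
      lia
    obtain ⟨f, hf⟩ := IsPos.exists_root_eq hkpos
    -- All coefficients of k are positive, and φ pairs non-negatively with every simple root and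
    -- positively with one of them.
    have hpos : 0 < R.pairingIn ℤ k (highestRoot b) := by
      have hsum : R.pairingIn ℤ k (highestRoot b) =
          ∑ j ∈ b.support, f j * R.pairingIn ℤ j (highestRoot b) := by
        have : ((R.pairingIn ℤ k (highestRoot b) : ℤ) : ℝ) =
            ((∑ j ∈ b.support, f j * R.pairingIn ℤ j (highestRoot b) : ℤ) : ℝ) := by
          have e : ∀ a c, ((R.pairingIn ℤ a c : ℤ) : ℝ) = R.pairing a c := fun a c =>
            R.algebraMap_pairingIn ℤ a c
          push_cast
          simp_rw [e, ← RootPairing.root_coroot_eq_pairing, hf, map_sum, LinearMap.sum_apply,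
            map_nsmul, LinearMap.smul_apply, nsmul_eq_mul]
        exact_mod_cast this
      have hnn : ∀ j ∈ b.support, 0 ≤ R.pairingIn ℤ j (highestRoot b) := fun j hj => by
        have h1 := pairingIn_highestRoot_nonneg (b := b) hj
        by_contra! hc
        rw [R.pairingIn_lt_zero_iff] at hc
        lia
      rw [hsum]
      obtain ⟨j, hj, hj0⟩ := (isPos_highestRoot (b := b)).exists_mem_support_pos_pairingIn
      refine Finset.sum_pos' (fun j hj => mul_nonneg (by positivity) (hnn j hj)) ⟨j, hj, ?_⟩
      have := coeff_ne_zero_of_forall_add hkpos hkmax hf hj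
      positivity
    by_cases hkφ : k = highestRoot b
    · rw [← hkφ]; exact hki
    -- The difference k - φ is a root of height at most 0, hence negative, so φ - i = (φ - k) + (k -
    -- i) is a sum of two elements of the cone.
    obtain ⟨l, hl⟩ := R.root_sub_root_mem_of_pairingIn_pos hpos hkφ
    have hlh := b.height_sub hl
    have hkle := height_le_highestRoot (b := b) k
    have hlneg : b.IsPos (R.reflectionPerm l l) := by
      rw [isPos_reflectionPerm_self, RootPairing.Base.isPos_iff]
      lia
    have := add_mem (hmem _ hlneg) hki
    rw [R.root_reflectionPerm, R.reflection_apply_self, hl] at this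
    convert! this using 1
    abel
  · have h1 := (isPos_reflectionPerm_self b).2 hi
    have := add_mem (hmem _ isPos_highestRoot) (hmem _ h1)
    rwa [R.root_reflectionPerm, R.reflection_apply_self, ← sub_eq_add_neg] at this

/-- The difference from φ is a non-negative combination of simple roots; evaluated where all simple
roots are 1 it gives 0, so it vanishes. -/
lemma eq_highestRoot_of_height_eq {i : ι} (h : b.height i = b.height (highestRoot b)) :
    i = highestRoot b := by
  obtain ⟨x, hx⟩ := exists_root'_eq b fun _ => 1
  have key : ∀ m ∈ AddSubmonoid.closure (R.root '' b.support),
      m = 0 ∨ 0 < R.toLinearMap m x := by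
    intro m hm
    induction hm using AddSubmonoid.closure_induction with
    | mem m hm =>
      obtain ⟨j, hj, rfl⟩ := hm
      exact Or.inr (by rw [hx j hj]; exact one_pos)
    | zero => exact Or.inl rfl
    | add m n _ _ hm hn =>
      rcases hm with rfl | hm
      · simpa using hn
      · rcases hn with rfl | hn
        · simpa using Or.inr hm
        · exact Or.inr (by rw [map_add, LinearMap.add_apply]; exact add_pos hm hn)
  rcases key _ (highestRoot_sub_mem (b := b) i) with h0 | h0
  · exact (R.root.injective (sub_eq_zero.1 h0)).symm
  · rw [map_sub, LinearMap.sub_apply] at h0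
    have h1 := height_coe_eq (highestRoot b) hx
    have h2 := height_coe_eq i hx
    rw [RootPairing.root'] at h1 h2
    rw [h1, h2, h] at h0
    exact absurd h0 (by simp)

lemma root'_le_highestRoot {x : E} (hx : ∀ j ∈ b.support, 0 ≤ R.root' j x) (i : ι) :
    R.root' i x ≤ R.root' (highestRoot b) x := by
  have key : ∀ m ∈ AddSubmonoid.closure (R.root '' b.support), 0 ≤ R.toLinearMap m x := by
    intro m hm
    induction hm using AddSubmonoid.closure_induction with
    | mem m hm =>
      obtain ⟨j, hj, rfl⟩ := hm
      exact hx j hj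
    | zero => simp
    | add m n _ _ hm hn => rw [map_add, LinearMap.add_apply]; exact add_nonneg hm hn
  have := key _ (highestRoot_sub_mem (b := b) i)
  rw [map_sub, LinearMap.sub_apply] at this
  linarith

end HighestRoot

end

end AffineHecke

namespace AffineHecke

noncomputable section

open MeasureTheory

set_option linter.unusedSectionVars false

/-! ### The extended affine Weyl group and its action on affine roots -/

section AffineRoots

variable {ι V E : Type*} [AddCommGroup V] [Module ℝ V] [AddCommGroup E] [Module ℝ E]
variable {R : RootPairing ι ℝ V E}

/-! ### Affine roots -/

variable (R) in
/-- The affine root `(α, k)`, as the function `λ ↦ ⟨λ, α⟩ + k`. -/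
def affEval (a : ι × ℤ) (x : E) : ℝ := R.root' a.1 x + a.2

lemma affEval_ext {a c : ι × ℤ} (h : ∀ x, affEval R a x = affEval R c x) : a = c := by
  have h2 : a.2 = c.2 := by
    have := h 0
    simpa [affEval] using this
  refine Prod.ext (root'_injective (R := R) fun x => ?_) h2
  have := h x
  rw [affEval, affEval, h2] at this
  exact add_right_cancel this

variable (R) in
/-- The affine root `-a`. -/
def affNeg (a : ι × ℤ) : ι × ℤ := (R.reflectionPerm a.1 a.1, -a.2)

lemma affEval_affNeg (a : ι × ℤ) (x : E) : affEval R (affNeg R a) x = -affEval R a x := by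
  rw [affEval, affNeg, root'_reflectionPerm_self, affEval]
  push_cast
  ring

@[simp] lemma affNeg_affNeg (a : ι × ℤ) : affNeg R (affNeg R a) = a :=
  affEval_ext (R := R) fun x => by rw [affEval_affNeg, affEval_affNeg, neg_neg]

lemma affNeg_injective : Function.Injective (affNeg R) :=
  Function.LeftInverse.injective affNeg_affNeg

variable [R.IsCrystallographic]

lemma act_mul (u v : ExtWeyl R) (x : E) : act (u * v) x = act u (act v x) := by
  simp only [act, map_add]
  rw [add_assoc, add_comm ((u.right.1 : E ≃ₗ[ℝ] E) _) ((Multiplicative.toAdd u.left : coweightLattice R) : E)]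
  rfl

@[simp] lemma act_one (x : E) : act (1 : ExtWeyl R) x = x := by
  change x + (0 : E) = x
  rw [add_zero]

@[simp] lemma act_act_inv (v : ExtWeyl R) (x : E) : act v (act v⁻¹ x) = x := by
  rw [← act_mul, mul_inv_cancel, act_one]

lemma act_sub (v : ExtWeyl R) (x y : E) : act v (x - y) = act v x - v.right.1 y := by
  rw [act, act, map_sub]
  abel

@[simp] lemma act_transl (μ : coweightLattice R) (x : E) : act (transl R μ) x = x + μ := rfl

@[simp] lemma act_ofWeyl (w : weylGroup R) (x : E) : act (ofWeyl R w) x = w.1 x := add_zero _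

lemma act_injective {u v : ExtWeyl R} (h : ∀ x, act u x = act v x) : u = v := by
  have h0 : u.left = v.left := by
    have := h 0
    simp only [act, map_zero, zero_add] at this
    exact congrArg Multiplicative.ofAdd (Subtype.ext this)
  refine SemidirectProduct.ext h0 (Subtype.ext (LinearEquiv.ext fun x => ?_))
  have := h x
  rw [act, act, h0] at this
  exact add_right_cancel this

lemma transl_add (μ ν : coweightLattice R) : transl R (μ + ν) = transl R μ * transl R ν :=
  act_injective fun x => by rw [act_mul]; simp [add_comm, add_left_comm]

lemma transl_zero : transl R 0 = 1 := act_injective fun x => by simp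

lemma transl_neg (μ : coweightLattice R) : transl R (-μ) = (transl R μ)⁻¹ :=
  eq_inv_of_mul_eq_one_left (by rw [← transl_add, neg_add_cancel, transl_zero])

lemma transl_injective : Function.Injective (transl R) := fun μ ν h => by
  have := congrArg (fun v => act v 0) h
  exact Subtype.ext (by simpa using this)

lemma ofWeyl_mul (u v : weylGroup R) : ofWeyl R (u * v) = ofWeyl R u * ofWeyl R v :=
  map_mul SemidirectProduct.inr u v

lemma ofWeyl_one : ofWeyl R 1 = 1 := map_one SemidirectProduct.inr

lemma ofWeyl_inv (w : weylGroup R) : ofWeyl R w⁻¹ = (ofWeyl R w)⁻¹ :=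
  map_inv SemidirectProduct.inr w

lemma ofWeyl_mul_transl (w : weylGroup R) (μ : coweightLattice R) :
    ofWeyl R w * transl R μ = transl R (weylAct R w μ) * ofWeyl R w :=
  act_injective fun x => by
    simp only [act_mul, act_transl, act_ofWeyl, map_add]
    rfl

/-- The action of the extended affine Weyl group on affine roots as a function. -/
def affActFun (v : ExtWeyl R) (a : ι × ℤ) : ι × ℤ :=
  (weylPerm R v.right a.1,
    a.2 - coweightPairing R (Multiplicative.toAdd v.left) (weylPerm R v.right a.1))

lemma affEval_affActFun (v : ExtWeyl R) (a : ι × ℤ) (x : E) :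
    affEval R (affActFun v a) (act v x) = affEval R a x := by
  rw [affEval, affActFun, act, map_add, root'_weylPerm, coweightPairing_spec, affEval]
  push_cast
  ring

variable (R) in
/-- The action of the extended affine Weyl group on affine roots, `(v a)(x) = a(v⁻¹ x)`. -/
def affAct : ExtWeyl R →* Equiv.Perm (ι × ℤ) :=
  MonoidHom.toHomPerm
    { toFun := affActFun
      map_one' := funext fun a => affEval_ext (R := R) fun x => by
        have := affEval_affActFun (1 : ExtWeyl R) a x
        rwa [act_one] at this
      map_mul' := fun u v => funext fun a => affEval_ext (R := R) fun x => by
        change _ = affEval R (affActFun u (affActFun v a)) x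
        obtain ⟨y, rfl⟩ : ∃ y, x = act (u * v) y := ⟨act (u * v)⁻¹ x, (act_act_inv _ x).symm⟩
        rw [affEval_affActFun, act_mul, affEval_affActFun, affEval_affActFun] }

lemma affAct_apply (v : ExtWeyl R) (a : ι × ℤ) : affAct R v a = affActFun v a := rfl

@[simp] lemma affEval_affAct (v : ExtWeyl R) (a : ι × ℤ) (x : E) :
    affEval R (affAct R v a) (act v x) = affEval R a x := affEval_affActFun v a x

lemma affEval_affAct' (v : ExtWeyl R) (a : ι × ℤ) (x : E) :
    affEval R (affAct R v a) x = affEval R a (act v⁻¹ x) := by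
  rw [← affEval_affAct v a, act_act_inv]

lemma affAct_mul (u v : ExtWeyl R) (a : ι × ℤ) : affAct R (u * v) a = affAct R u (affAct R v a) := by
  rw [map_mul, Equiv.Perm.mul_apply]

@[simp] lemma affAct_inv_affAct (v : ExtWeyl R) (a : ι × ℤ) : affAct R v⁻¹ (affAct R v a) = a := by
  rw [← affAct_mul, inv_mul_cancel, map_one, Equiv.Perm.one_apply]

@[simp] lemma affAct_affAct_inv (v : ExtWeyl R) (a : ι × ℤ) : affAct R v (affAct R v⁻¹ a) = a := by
  rw [← affAct_mul, mul_inv_cancel, map_one, Equiv.Perm.one_apply]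

lemma affAct_affNeg (v : ExtWeyl R) (a : ι × ℤ) :
    affAct R v (affNeg R a) = affNeg R (affAct R v a) :=
  affEval_ext (R := R) fun x => by
    rw [affEval_affNeg, affEval_affAct', affEval_affAct', affEval_affNeg]

lemma affAct_transl (μ : coweightLattice R) (a : ι × ℤ) :
    affAct R (transl R μ) a = (a.1, a.2 - coweightPairing R μ a.1) := by
  apply affEval_ext (R := R)
  intro x
  rw [affEval_affAct', ← transl_neg, act_transl, affEval, affEval, map_add, AddSubgroup.coe_neg,
    map_neg, coweightPairing_spec]
  push_cast
  ring

lemma affAct_ofWeyl (w : weylGroup R) (a : ι × ℤ) :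
    affAct R (ofWeyl R w) a = (weylPerm R w a.1, a.2) := by
  apply affEval_ext (R := R)
  intro x
  rw [affEval_affAct', ← ofWeyl_inv, act_ofWeyl, affEval, affEval, root'_weylPerm']

lemma affAct_fst (v : ExtWeyl R) (a : ι × ℤ) : (affAct R v a).1 = weylPerm R v.right a.1 := rfl

end AffineRoots

/-! ### Positivity of affine roots and the fundamental alcove -/

section Positivity

variable {ι V E : Type*} [AddCommGroup V] [Module ℝ V] [AddCommGroup E] [Module ℝ E]
variable {R : RootPairing ι ℝ V E} (b : R.Base)

/-- An affine root is positive if it is positive on the fundamental alcove. -/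
def IsPosAff (a : ι × ℤ) : Prop := 0 < a.2 ∨ a.2 = 0 ∧ b.IsPos a.1

variable {b} in
lemma isPosAff_affNeg {a : ι × ℤ} : IsPosAff b (affNeg R a) ↔ ¬ IsPosAff b a := by
  simp only [IsPosAff, affNeg, isPos_reflectionPerm_self]
  have h := lt_trichotomy a.2 0
  by_cases hp : b.IsPos a.1
  · simp only [hp]; lia
  · simp only [hp]; lia

variable [Fintype ι] [Nonempty ι]

/-- The simple affine roots, the walls of the fundamental alcove. -/
def simpleAff : Option b.support → ι × ℤ
  | none => (R.reflectionPerm (highestRoot b) (highestRoot b), 1)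
  | some i => (i, 0)

variable {b}

lemma mem_fundAlcove_iff {x : E} :
    x ∈ fundAlcove b ↔ ∀ i, 0 < affEval R (simpleAff b i) x := by
  constructor
  · rintro ⟨h1, h2⟩ (_ | i)
    · simp only [simpleAff, affEval, root'_reflectionPerm_self]
      push_cast
      linarith
    · simpa [simpleAff, affEval] using h1 i i.2
  · intro h
    refine ⟨fun i hi => by simpa [simpleAff, affEval] using h (some ⟨i, hi⟩), ?_⟩
    have := h none
    simp only [simpleAff, affEval, root'_reflectionPerm_self] at this
    push_cast at this
    linarith

lemma isPosAff_simpleAff (i : Option b.support) : IsPosAff b (simpleAff b i) := by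
  rcases i with _ | i
  · exact Or.inl one_pos
  · exact Or.inr ⟨rfl, RootPairing.Base.isPos_of_mem_support i.2⟩

variable [R.IsCrystallographic] [R.IsReduced] [R.IsIrreducible]

lemma fundAlcove_nonempty : (fundAlcove b).Nonempty := by
  have hφ : 0 < b.height (highestRoot b) := isPos_highestRoot
  have hφ' : (0 : ℝ) < b.height (highestRoot b) := by exact_mod_cast hφ
  -- With h the height of φ, the value 1/(h+1) on simple roots gives φ the value h/(h+1) < 1.
  obtain ⟨x, hx⟩ := exists_root'_eq b fun _ => ((b.height (highestRoot b) : ℝ) + 1)⁻¹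
  refine ⟨x, fun i hi => by rw [hx i hi]; positivity, ?_⟩
  rw [height_coe_eq _ hx, inv_mul_lt_iff₀ (by positivity)]
  linarith

/-- At level at least 1 the bound -α ≤ φ < 1 on the alcove suffices; at level 0 this is positivity
of positive roots in the dominant chamber. -/
lemma affEval_pos_of_isPosAff {a : ι × ℤ} (ha : IsPosAff b a) {x : E} (hx : x ∈ fundAlcove b) :
    0 < affEval R a x := by
  rcases ha with h | ⟨h, h'⟩
  · have h1 := root'_le_highestRoot (b := b) (fun j hj => (hx.1 j hj).le)
      (R.reflectionPerm a.1 a.1)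
    rw [root'_reflectionPerm_self] at h1
    have h2 : (1 : ℝ) ≤ a.2 := by exact_mod_cast h
    rw [affEval]
    linarith [hx.2]
  · rw [affEval, h]
    simpa using IsPos.root'_pos h' hx.1

lemma affEval_neg_of_not_isPosAff {a : ι × ℤ} (ha : ¬ IsPosAff b a) {x : E}
    (hx : x ∈ fundAlcove b) : affEval R a x < 0 := by
  have := affEval_pos_of_isPosAff (isPosAff_affNeg.2 ha) hx
  rw [affEval_affNeg] at this
  linarith

lemma isPosAff_of_affEval_pos {a : ι × ℤ} {x : E} (hx : x ∈ fundAlcove b)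
    (h : 0 < affEval R a x) : IsPosAff b a := by
  by_contra hc
  exact absurd (affEval_neg_of_not_isPosAff hc hx) (not_lt.2 h.le)

lemma act_simpleRefl (i : Option b.support) (x : E) :
    act (simpleRefl b i) x =
      x - affEval R (simpleAff b i) x • R.coroot (simpleAff b i).1 := by
  rcases i with _ | i
  · simp only [simpleRefl, act_mul, act_transl, act_ofWeyl, simpleAff, affEval,
      root'_reflectionPerm_self, R.coroot_reflectionPerm, R.coreflection_apply_self]
    change R.coreflection _ x + R.coroot (highestRoot b) = _
    rw [R.coreflection_apply]
    push_cast
    module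
  · simp only [simpleRefl, act_ofWeyl, simpleAff, affEval]
    change R.coreflection _ x = _
    rw [R.coreflection_apply]
    simp

/-- A reflection depends only on its wall, and an affine root determines its wall up to sign.
Through this lemma the conjugacy hypothesis on the parameters becomes a condition on affine roots.
-/
lemma simpleRefl_conj {v : ExtWeyl R} {i j : Option b.support}
    (h : affAct R v (simpleAff b i) = simpleAff b j ∨
      affAct R v (simpleAff b i) = affNeg R (simpleAff b j)) :
    v * simpleRefl b i * v⁻¹ = simpleRefl b j := by
  apply act_injective
  intro x
  rw [act_mul, act_mul, act_simpleRefl, act_simpleRefl, act_sub, act_act_inv, map_smul,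
    ← affEval_affAct', ← coroot_weylPerm, ← affAct_fst]
  rcases h with h | h
  · rw [h]
  · rw [h, affEval_affNeg, affNeg, R.coroot_reflectionPerm, R.coreflection_apply_self]
    module

lemma affAct_simpleRefl_self (i : Option b.support) :
    affAct R (simpleRefl b i) (simpleAff b i) = affNeg R (simpleAff b i) := by
  rcases i with _ | i
  · simp only [simpleRefl, simpleAff, affAct_mul, affAct_ofWeyl, weylPerm_rootRefl,
      R.reflectionPerm_self, affAct_transl, affNeg]
    rw [coweightPairing_eq (k := 2) (by simp)]
    exact (affNeg_affNeg (R := R) (highestRoot b, -1)).symm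
  · simp only [simpleRefl, simpleAff, affAct_ofWeyl, weylPerm_rootRefl, affNeg, neg_zero]

lemma simpleRefl_mul_self (i : Option b.support) : simpleRefl b i * simpleRefl b i = 1 := by
  refine act_injective fun x => ?_
  have h : affEval R (simpleAff b i) (act (simpleRefl b i) x) = -affEval R (simpleAff b i) x := by
    rw [act_simpleRefl, affEval, map_sub, map_smul, smul_eq_mul, R.root'_coroot_eq_pairing,
      R.pairing_same, affEval]
    ring
  rw [act_mul, act_simpleRefl i (act _ x), h, act_simpleRefl, act_one]
  module

lemma affAct_simpleRefl_simpleRefl (i : Option b.support) (a : ι × ℤ) :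
    affAct R (simpleRefl b i) (affAct R (simpleRefl b i) a) = a := by
  rw [← affAct_mul, simpleRefl_mul_self, map_one, Equiv.Perm.one_apply]


/-- The affine form of the fact that a simple reflection permutes the positive roots other than its
own; lengths and inversion sets all rest on it. The case of `s_0` is the new one: it is decided by
values at a point fixed by `s_0`. -/
lemma isPosAff_simpleRefl {i : Option b.support} {a : ι × ℤ} (ha : IsPosAff b a)
    (hne : a ≠ simpleAff b i) : IsPosAff b (affAct R (simpleRefl b i) a) := by
  rcases i with _ | i
  · have hφ : 0 < b.height (highestRoot b) := isPos_highestRoot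
    have hφ' : (0 : ℝ) < b.height (highestRoot b) := by exact_mod_cast hφ
    -- All simple roots are 1/h at z, so φ(z) = 1 and z is fixed by `s_0`. An affine root (α, k) has
    -- value (ht α + k h)/h there, and |ht α| ≤ h with the bound -h attained only by -φ.
    obtain ⟨z, hz⟩ := exists_root'_eq b fun _ => ((b.height (highestRoot b) : ℝ))⁻¹
    have hbd : ∀ j, -b.height (highestRoot b) ≤ b.height j := fun j => by
      have := height_le_highestRoot (b := b) (R.reflectionPerm j j)
      rw [height_reflectionPerm_self'] at this
      lia
    have hev : ∀ c : ι × ℤ, b.height (highestRoot b) * affEval R c z =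
        ((b.height c.1 + c.2 * b.height (highestRoot b) : ℤ) : ℝ) := fun c => by
      rw [affEval, height_coe_eq _ hz]
      push_cast
      field_simp
    have hz0 : affEval R (simpleAff b none) z = 0 := by
      refine (mul_eq_zero.1 ((hev _).trans ?_)).resolve_left hφ'.ne'
      simp [simpleAff, height_reflectionPerm_self']
    have hfix : act (simpleRefl b none) z = z := by rw [act_simpleRefl, hz0]; simp
    have h1 : (0 : ℤ) < b.height a.1 + a.2 * b.height (highestRoot b) := by
      rcases ha with h | ⟨h, h'⟩
      · have h2 := hbd a.1
        rcases h2.lt_or_eq with h2 | h2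
        · nlinarith
        · have h3 : a.2 ≠ 1 := fun h3 => hne <| by
            refine Prod.ext ?_ h3
            change a.1 = R.reflectionPerm _ _
            rw [← R.root_eq_neg_iff, ← eq_highestRoot_of_height_eq (b := b)
              (i := R.reflectionPerm a.1 a.1) (by rw [height_reflectionPerm_self']; lia)]
            simp
          have h4 : 2 ≤ a.2 := by lia
          nlinarith
      · rw [h, zero_mul, add_zero]
        exact h'
    have h2 : affEval R (affAct R (simpleRefl b none) a) z = affEval R a z := by
      conv_lhs => rw [← hfix]
      rw [affEval_affAct]
    have h3 : (0 : ℝ) < b.height (highestRoot b) * affEval R (affAct R (simpleRefl b none) a) z := by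
      rw [h2, hev]
      exact_mod_cast h1
    rw [hev] at h3
    have h4 : (0 : ℤ) < b.height (affAct R (simpleRefl b none) a).1 +
      (affAct R (simpleRefl b none) a).2 * b.height (highestRoot b) := by exact_mod_cast h3
    -- The image has the same positive value at z; since its gradient has height at most h, its
    -- level cannot be negative, and at level 0 the gradient must be positive.
    have h5 := height_le_highestRoot (b := b) (affAct R (simpleRefl b none) a).1
    rcases lt_trichotomy (affAct R (simpleRefl b none) a).2 0 with h | h | h
    · nlinarith
    · refine Or.inr ⟨h, ?_⟩
      rw [h, zero_mul, add_zero] at h4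
      exact h4
    · exact Or.inl h
  · rw [simpleRefl, affAct_ofWeyl, weylPerm_rootRefl]
    rcases ha with h | ⟨h, h'⟩
    · exact Or.inl h
    · exact Or.inr ⟨h, h'.reflectionPerm i.2 fun he => hne (Prod.ext he h)⟩

lemma isPosAff_simpleRefl_iff {i : Option b.support} {a : ι × ℤ} :
    IsPosAff b (affAct R (simpleRefl b i) a) ↔
      a = affNeg R (simpleAff b i) ∨ IsPosAff b a ∧ a ≠ simpleAff b i := by
  constructor
  · intro h
    by_cases ha : a = affNeg R (simpleAff b i)
    · exact Or.inl ha
    refine Or.inr ⟨?_, ?_⟩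
    · have := isPosAff_simpleRefl (i := i) h fun h' => ha <| by
        rw [← affAct_simpleRefl_simpleRefl i a, h', affAct_simpleRefl_self]
      rwa [affAct_simpleRefl_simpleRefl] at this
    · rintro rfl
      rw [affAct_simpleRefl_self, isPosAff_affNeg] at h
      exact h (isPosAff_simpleAff i)
  · rintro (rfl | ⟨h1, h2⟩)
    · rw [affAct_affNeg, affAct_simpleRefl_self, affNeg_affNeg]
      exact isPosAff_simpleAff i
    · exact isPosAff_simpleRefl h1 h2

/-! ### Inversion sets and the length function -/

variable (b) in
/-- The positive affine roots made negative by `v⁻¹`. -/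
def invSet (v : ExtWeyl R) : Set (ι × ℤ) := {a | IsPosAff b a ∧ ¬ IsPosAff b (affAct R v⁻¹ a)}

/-- The level changes by an amount depending only on the gradient, so each of the finitely many
gradients contributes boundedly many levels. -/
lemma invSet_finite (v : ExtWeyl R) : (invSet b v).Finite := by
  have : invSet b v ⊆ ⋃ i : ι, Prod.mk i '' Set.Icc 0 ((affAct R v⁻¹ (i, 0)).2.natAbs : ℤ) := by
    rintro ⟨i, k⟩ ⟨h1, h2⟩
    refine Set.mem_iUnion.2 ⟨i, k, ⟨?_, ?_⟩, rfl⟩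
    · rcases h1 with h | ⟨h, -⟩
      · exact le_of_lt h
      · exact h.ge
    · have h3 : (affAct R v⁻¹ (i, k)).2 = k + (affAct R v⁻¹ (i, 0)).2 := by
        simp only [affAct_apply, affActFun]
        ring
      have h4 : ¬ 0 < (affAct R v⁻¹ (i, k)).2 := fun h => h2 (Or.inl h)
      lia
  exact (Set.finite_iUnion fun i => (Set.finite_Icc _ _).image _).subset this

/-- Affine roots have constant sign on the alcove, so separation can be tested at one point. A
hyperplane carries two opposite affine roots: `length` picks the one with positive gradient,
`invSet` the one positive on the alcove, and the bijection switches between them. -/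
lemma length_eq_ncard (v : ExtWeyl R) : length b v = (invSet b v).ncard := by
  classical
  have hset : {h : ι × ℤ | b.IsPos h.1 ∧ ∀ x ∈ fundAlcove b, ∀ y ∈ fundAlcove b,
      (R.root' h.1 x + h.2) * (R.root' h.1 (act v y) + h.2) < 0} =
      {a | b.IsPos a.1 ∧ (IsPosAff b a ↔ ¬ IsPosAff b (affAct R v⁻¹ a))} := by
    ext a
    refine and_congr_right fun _ => ?_
    have e : ∀ y, R.root' a.1 (act v y) + a.2 = affEval R (affAct R v⁻¹ a) y := fun y => by
      rw [affEval_affAct', inv_inv]; rfl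
    simp only [e]
    change (∀ x ∈ fundAlcove b, ∀ y ∈ fundAlcove b, affEval R a x * _ < 0) ↔ _
    constructor
    · intro h
      obtain ⟨x, hx⟩ := fundAlcove_nonempty (b := b)
      have h1 := h x hx x hx
      by_cases hp : IsPosAff b a
      · refine iff_of_true hp fun hq => ?_
        exact absurd h1 (not_lt.2 (mul_pos (affEval_pos_of_isPosAff hp hx)
          (affEval_pos_of_isPosAff hq hx)).le)
      · refine iff_of_false hp fun hq => ?_
        exact absurd h1 (not_lt.2 (mul_pos_of_neg_of_neg (affEval_neg_of_not_isPosAff hp hx)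
          (affEval_neg_of_not_isPosAff hq hx)).le)
    · intro h x hx y hy
      by_cases hp : IsPosAff b a
      · exact mul_neg_of_pos_of_neg (affEval_pos_of_isPosAff hp hx)
          (affEval_neg_of_not_isPosAff (h.1 hp) hy)
      · exact mul_neg_of_neg_of_pos (affEval_neg_of_not_isPosAff hp hx)
          (affEval_pos_of_isPosAff (not_not.1 (mt h.2 hp)) hy)
  rw [length, hset]
  refine Set.ncard_congr (fun a _ => if IsPosAff b a then a else affNeg R a) ?_ ?_ ?_
  · rintro a ⟨-, h⟩
    by_cases hp : IsPosAff b a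
    · simp only [hp, if_true]
      exact ⟨hp, h.1 hp⟩
    · simp only [hp, if_false]
      refine ⟨isPosAff_affNeg.2 hp, ?_⟩
      rw [affAct_affNeg, isPosAff_affNeg, not_not]
      exact not_not.1 (mt h.2 hp)
  · rintro a c ⟨ha, -⟩ ⟨hc, -⟩ h
    have key : ∀ a c : ι × ℤ, b.IsPos a.1 → b.IsPos c.1 → a ≠ affNeg R c := by
      rintro a c ha hc rfl
      exact (isPos_reflectionPerm_self b).1 ha hc
    by_cases h1 : IsPosAff b a <;> by_cases h2 : IsPosAff b c <;> simp only [h1, h2, if_true, if_false] at h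
    · exact h
    · exact absurd h (key a c ha hc)
    · exact absurd h.symm (key c a hc ha)
    · exact affNeg_injective h
  · rintro a ⟨h1, h2⟩
    by_cases hp : b.IsPos a.1
    · exact ⟨a, ⟨hp, iff_of_true h1 h2⟩, by simp [h1]⟩
    · refine ⟨affNeg R a, ⟨(isPos_reflectionPerm_self b).2 hp, ?_⟩, ?_⟩
      · rw [affAct_affNeg, isPosAff_affNeg, isPosAff_affNeg]
        exact iff_of_false (not_not.2 h1) (not_not.2 h2)
      · rw [if_neg (by rw [isPosAff_affNeg]; exact not_not.2 h1), affNeg_affNeg]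

lemma mem_invSet {v : ExtWeyl R} {a : ι × ℤ} :
    a ∈ invSet b v ↔ IsPosAff b a ∧ ¬ IsPosAff b (affAct R v⁻¹ a) := Iff.rfl

lemma simpleRefl_inv (i : Option b.support) : (simpleRefl b i)⁻¹ = simpleRefl b i :=
  inv_eq_of_mul_eq_one_left (simpleRefl_mul_self i)

lemma mul_simpleRefl_mul_simpleRefl (v : ExtWeyl R) (i : Option b.support) :
    v * simpleRefl b i * simpleRefl b i = v := by
  rw [mul_assoc, simpleRefl_mul_self, mul_one]

lemma simpleRefl_mul_simpleRefl_mul (v : ExtWeyl R) (i : Option b.support) :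
    simpleRefl b i * (simpleRefl b i * v) = v := by
  rw [← mul_assoc, simpleRefl_mul_self, one_mul]

/-- As s_i permutes the positive affine roots other than a_i, the sign of v⁻¹ and of (v s_i)⁻¹ can
differ only at ±v a_i. -/
lemma invSet_mul_simpleRefl {v : ExtWeyl R} {i : Option b.support}
    (h : IsPosAff b (affAct R v (simpleAff b i))) :
    invSet b (v * simpleRefl b i) = insert (affAct R v (simpleAff b i)) (invSet b v) := by
  ext a
  obtain ⟨c, rfl⟩ : ∃ c, a = affAct R v c := ⟨affAct R v⁻¹ a, by simp⟩
  rw [mem_invSet, Set.mem_insert_iff, mem_invSet, mul_inv_rev, simpleRefl_inv, affAct_mul,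
    affAct_inv_affAct, isPosAff_simpleRefl_iff, (affAct R v).injective.eq_iff]
  constructor
  · rintro ⟨h1, h2⟩
    rw [not_or, not_and, not_not] at h2
    by_cases hc : IsPosAff b c
    · exact Or.inl (h2.2 hc)
    · exact Or.inr ⟨h1, hc⟩
  · rintro (rfl | ⟨h1, h2⟩)
    · refine ⟨h, ?_⟩
      rintro (h3 | ⟨-, h3⟩)
      · have := isPosAff_simpleAff (b := b) i
        rw [h3, isPosAff_affNeg] at this
        exact this (isPosAff_simpleAff i)
      · exact h3 rfl
    · refine ⟨h1, ?_⟩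
      rintro (rfl | ⟨h3, -⟩)
      · rw [affAct_affNeg, isPosAff_affNeg] at h1
        exact h1 h
      · exact h2 h3

lemma notMem_invSet_of_isPosAff {v : ExtWeyl R} {i : Option b.support} :
    affAct R v (simpleAff b i) ∉ invSet b v := by
  rw [mem_invSet, affAct_inv_affAct]
  exact fun h => h.2 (isPosAff_simpleAff i)

lemma length_mul_simpleRefl {v : ExtWeyl R} {i : Option b.support}
    (h : IsPosAff b (affAct R v (simpleAff b i))) :
    length b (v * simpleRefl b i) = length b v + 1 := by
  rw [length_eq_ncard, length_eq_ncard, invSet_mul_simpleRefl h,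
    Set.ncard_insert_of_notMem notMem_invSet_of_isPosAff (invSet_finite v)]

lemma isPosAff_mul_simpleRefl {v : ExtWeyl R} {i : Option b.support} :
    IsPosAff b (affAct R (v * simpleRefl b i) (simpleAff b i)) ↔
      ¬ IsPosAff b (affAct R v (simpleAff b i)) := by
  rw [affAct_mul, affAct_simpleRefl_self, affAct_affNeg, isPosAff_affNeg]

lemma length_mul_simpleRefl_of_not {v : ExtWeyl R} {i : Option b.support}
    (h : ¬ IsPosAff b (affAct R v (simpleAff b i))) :
    length b v = length b (v * simpleRefl b i) + 1 := by
  have := length_mul_simpleRefl (v := v * simpleRefl b i) (isPosAff_mul_simpleRefl.2 h)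
  rwa [mul_simpleRefl_mul_simpleRefl] at this

lemma length_mul_simpleRefl_iff {v : ExtWeyl R} {i : Option b.support} :
    length b (v * simpleRefl b i) = length b v + 1 ↔ IsPosAff b (affAct R v (simpleAff b i)) := by
  refine ⟨fun h => ?_, length_mul_simpleRefl⟩
  by_contra hc
  have := length_mul_simpleRefl_of_not hc
  lia

lemma length_mul_simpleRefl_iff_not {v : ExtWeyl R} {i : Option b.support} :
    length b v = length b (v * simpleRefl b i) + 1 ↔
      ¬ IsPosAff b (affAct R v (simpleAff b i)) := by
  refine ⟨fun h hc => ?_, length_mul_simpleRefl_of_not⟩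
  have := length_mul_simpleRefl hc
  lia

lemma length_inv (v : ExtWeyl R) : length b v⁻¹ = length b v := by
  rw [length_eq_ncard, length_eq_ncard]
  refine Set.ncard_congr (fun a _ => affNeg R (affAct R v a)) ?_ ?_ ?_
  · rintro a ⟨h1, h2⟩
    rw [inv_inv] at h2
    refine ⟨isPosAff_affNeg.2 h2, ?_⟩
    rw [affAct_affNeg, affAct_inv_affAct, isPosAff_affNeg, not_not]
    exact h1
  · intro a c _ _ h
    exact (affAct R v).injective (affNeg_injective h)
  · rintro a ⟨h1, h2⟩
    refine ⟨affNeg R (affAct R v⁻¹ a), ⟨isPosAff_affNeg.2 h2, ?_⟩, ?_⟩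
    · rw [inv_inv, affAct_affNeg, affAct_affAct_inv, isPosAff_affNeg, not_not]
      exact h1
    · simp only [affAct_affNeg, affAct_affAct_inv, affNeg_affNeg]

lemma length_one : length b (1 : ExtWeyl R) = 0 := by
  rw [length_eq_ncard, Set.ncard_eq_zero (invSet_finite _)]
  ext a
  simp [mem_invSet]

lemma isPosAff_affAct_of_length_eq_zero {v : ExtWeyl R} (h : length b v = 0) {a : ι × ℤ} :
    IsPosAff b (affAct R v a) ↔ IsPosAff b a := by
  rw [← length_inv, length_eq_ncard, Set.ncard_eq_zero (invSet_finite _)] at h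
  have key : ∀ a, IsPosAff b a → IsPosAff b (affAct R v a) := fun a ha => by
    by_contra hc
    have : a ∈ invSet b v⁻¹ := ⟨ha, by rwa [inv_inv]⟩
    rw [h] at this
    exact this
  refine ⟨fun ha => ?_, key a⟩
  by_contra hc
  have := key _ (isPosAff_affNeg.2 hc)
  rw [affAct_affNeg, isPosAff_affNeg] at this
  exact this ha

/-- Positivity on the walls alone forces v⁻¹ to map the alcove into itself, and the sign of any
affine root can then be read off at a point of it. -/
lemma length_eq_zero_of_forall {v : ExtWeyl R}
    (h : ∀ i, IsPosAff b (affAct R v (simpleAff b i))) : length b v = 0 := by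
  have hv : ∀ y ∈ fundAlcove b, act v⁻¹ y ∈ fundAlcove b := fun y hy =>
    mem_fundAlcove_iff.2 fun i => by
      rw [← affEval_affAct']
      exact affEval_pos_of_isPosAff (h i) hy
  obtain ⟨y, hy⟩ := fundAlcove_nonempty (b := b)
  rw [← length_inv, length_eq_ncard, Set.ncard_eq_zero (invSet_finite _)]
  ext a
  simp only [Set.mem_empty_iff_false, iff_false]
  rintro ⟨h1, h2⟩
  rw [inv_inv] at h2
  refine h2 (isPosAff_of_affEval_pos hy ?_)
  rw [affEval_affAct']
  exact affEval_pos_of_isPosAff h1 (hv y hy)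

lemma exists_length_mul_simpleRefl {v : ExtWeyl R} (h : length b v ≠ 0) :
    ∃ i, length b v = length b (v * simpleRefl b i) + 1 := by
  by_contra! hc
  refine h (length_eq_zero_of_forall fun i => ?_)
  by_contra hi
  exact hc i (length_mul_simpleRefl_of_not hi)

lemma length_mul_of_length_eq_zero {u γ : ExtWeyl R} (h : length b γ = 0) :
    length b (u * γ) = length b u := by
  rw [length_eq_ncard, length_eq_ncard]
  have h' : length b γ⁻¹ = 0 := by rw [length_inv, h]
  congr 1
  ext a
  rw [mem_invSet, mem_invSet, mul_inv_rev, affAct_mul, isPosAff_affAct_of_length_eq_zero h']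

lemma length_mul_le (u v : ExtWeyl R) : length b (u * v) ≤ length b u + length b v := by
  induction hn : length b v generalizing v with
  | zero => rw [length_mul_of_length_eq_zero hn, add_zero]
  | succ n ih =>
    obtain ⟨i, hi⟩ := exists_length_mul_simpleRefl (b := b) (v := v) (by lia)
    have h1 := ih (v * simpleRefl b i) (by lia)
    rw [← mul_assoc] at h1
    by_cases hp : IsPosAff b (affAct R (u * v) (simpleAff b i))
    · have := length_mul_simpleRefl hp
      lia
    · have := length_mul_simpleRefl_of_not hp
      lia

/-- Lengths add if no inversion of `v` is cancelled by `u`. -/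
lemma length_mul_of_forall {u v : ExtWeyl R}
    (h : ∀ a ∈ invSet b v, IsPosAff b (affAct R u a)) :
    length b (u * v) = length b u + length b v := by
  induction hn : length b v generalizing v with
  | zero => rw [length_mul_of_length_eq_zero hn, add_zero]
  | succ n ih =>
    obtain ⟨i, hi⟩ := exists_length_mul_simpleRefl (b := b) (v := v) (by lia)
    set v' := v * simpleRefl b i with hv'
    have hv : v = v' * simpleRefl b i := by rw [hv', mul_simpleRefl_mul_simpleRefl]
    have hp : IsPosAff b (affAct R v' (simpleAff b i)) :=
      length_mul_simpleRefl_iff.1 (by rw [← hv]; lia)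
    have hs := invSet_mul_simpleRefl hp
    rw [← hv] at hs
    have h1 := ih (v := v') (fun a ha => h a (by rw [hs]; exact Set.mem_insert_of_mem _ ha)) (by lia)
    have h2 := h _ (by rw [hs]; exact Set.mem_insert _ _)
    rw [← affAct_mul] at h2
    have h3 := length_mul_simpleRefl h2
    rw [mul_assoc, ← hv] at h3
    lia

lemma length_simpleRefl (i : Option b.support) : length b (simpleRefl b i) = 1 := by
  have := length_mul_simpleRefl (v := (1 : ExtWeyl R)) (i := i)
    (by rw [map_one]; exact isPosAff_simpleAff i)
  rwa [one_mul, length_one] at this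

lemma exists_reduced_expression (v : ExtWeyl R) :
    ∃ L γ, IsExpression b L γ v ∧ L.length = length b v := by
  induction hn : length b v generalizing v with
  | zero => exact ⟨[], v, ⟨hn, by simp⟩, rfl⟩
  | succ n ih =>
    obtain ⟨i, hi⟩ := exists_length_mul_simpleRefl (b := b) (v := v⁻¹) (by rw [length_inv]; lia)
    have hsv : v⁻¹ * simpleRefl b i = (simpleRefl b i * v)⁻¹ := by
      rw [mul_inv_rev, simpleRefl_inv]
    rw [hsv, length_inv, length_inv] at hi
    obtain ⟨L, γ, ⟨h1, h2⟩, h3⟩ := ih (simpleRefl b i * v) (by lia)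
    refine ⟨i :: L, γ, ⟨h1, ?_⟩, by simp [h3]⟩
    rw [List.map_cons, List.prod_cons, mul_assoc, ← h2, simpleRefl_mul_simpleRefl_mul]

lemma length_le_of_isExpression {v γ : ExtWeyl R} {L : List (Option b.support)}
    (h : IsExpression b L γ v) : length b v ≤ L.length := by
  obtain ⟨h1, rfl⟩ := h
  induction L with
  | nil => simp [h1]
  | cons i L ih =>
    rw [List.map_cons, List.prod_cons, mul_assoc, List.length_cons]
    have := length_mul_le (b := b) (simpleRefl b i) ((L.map (simpleRefl b)).prod * γ)
    rw [length_simpleRefl] at this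
    lia

lemma length_simpleRefl_mul_iff {v : ExtWeyl R} {i : Option b.support} :
    length b (simpleRefl b i * v) = length b v + 1 ↔
      IsPosAff b (affAct R v⁻¹ (simpleAff b i)) := by
  rw [← length_inv, mul_inv_rev, simpleRefl_inv, ← length_inv v]
  exact length_mul_simpleRefl_iff

end Positivity
end

end AffineHecke

namespace AffineHecke

noncomputable section

open MeasureTheory

set_option linter.unusedSectionVars false

/-! ### The Hecke algebra: regular representation, spanning set and trace -/

section HeckeAlgebra

variable {ι V E : Type*} [AddCommGroup V] [Module ℝ V] [AddCommGroup E] [Module ℝ E]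
variable {R : RootPairing ι ℝ V E} {b : R.Base} [Fintype ι] [Nonempty ι]
variable [R.IsCrystallographic] [R.IsReduced] [R.IsIrreducible]
variable {q : Option b.support → ℝ}

/-! ### The regular representation -/

variable (q) in
/-- The coefficient `q_i^{1/2} - q_i^{-1/2}` of the quadratic relation. -/
def quadCoeff (i : Option b.support) : ℂ := ((√(q i) - (√(q i))⁻¹ : ℝ) : ℂ)

open Classical in
variable (q) in
/-- Right multiplication by `T_{s_i}` on the free module with basis `P ⋊ W₀`. -/
def rightOp (i : Option b.support) : Module.End ℂ (ExtWeyl R →₀ ℂ) :=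
  Finsupp.linearCombination ℂ fun w => Finsupp.single (w * simpleRefl b i) 1 +
    (if IsPosAff b (affAct R w (simpleAff b i)) then 0 else quadCoeff q i) • Finsupp.single w 1

open Classical in
variable (q) in
/-- Left multiplication by `T_{s_i}` on the free module with basis `P ⋊ W₀`. -/
def leftOp (i : Option b.support) : Module.End ℂ (ExtWeyl R →₀ ℂ) :=
  Finsupp.linearCombination ℂ fun w => Finsupp.single (simpleRefl b i * w) 1 +
    (if IsPosAff b (affAct R w⁻¹ (simpleAff b i)) then 0 else quadCoeff q i) • Finsupp.single w 1

open Classical in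
lemma rightOp_single (i : Option b.support) (w : ExtWeyl R) :
    rightOp q i (Finsupp.single w 1) = Finsupp.single (w * simpleRefl b i) 1 +
    (if IsPosAff b (affAct R w (simpleAff b i)) then 0 else quadCoeff q i) •
      Finsupp.single w 1 := by
  rw [rightOp, Finsupp.linearCombination_single, one_smul]

open Classical in
lemma leftOp_single (i : Option b.support) (w : ExtWeyl R) :
    leftOp q i (Finsupp.single w 1) = Finsupp.single (simpleRefl b i * w) 1 +
    (if IsPosAff b (affAct R w⁻¹ (simpleAff b i)) then 0 else quadCoeff q i) •
      Finsupp.single w 1 := by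
  rw [leftOp, Finsupp.linearCombination_single, one_smul]

variable (R) in
/-- Right translation on the free module with basis `P ⋊ W₀`. -/
def rightTransl (γ : ExtWeyl R) : Module.End ℂ (ExtWeyl R →₀ ℂ) :=
  Finsupp.linearCombination ℂ fun w => Finsupp.single (w * γ) 1

variable (R) in
/-- Left translation on the free module with basis `P ⋊ W₀`. -/
def leftTransl (γ : ExtWeyl R) : Module.End ℂ (ExtWeyl R →₀ ℂ) :=
  Finsupp.linearCombination ℂ fun w => Finsupp.single (γ * w) 1

lemma rightTransl_single (γ w : ExtWeyl R) :
    rightTransl R γ (Finsupp.single w 1) = Finsupp.single (w * γ) 1 := by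
  rw [rightTransl, Finsupp.linearCombination_single, one_smul]

lemma leftTransl_single (γ w : ExtWeyl R) :
    leftTransl R γ (Finsupp.single w 1) = Finsupp.single (γ * w) 1 := by
  rw [leftTransl, Finsupp.linearCombination_single, one_smul]

lemma end_ext {A B : Module.End ℂ (ExtWeyl R →₀ ℂ)}
    (h : ∀ w, A (Finsupp.single w 1) = B (Finsupp.single w 1)) : A = B :=
  Finsupp.lhom_ext fun w c => by
    rw [← mul_one c, ← smul_eq_mul, ← Finsupp.smul_single, map_smul, map_smul, h]

lemma IsReducedParameterSystem.eq_of_affAct (hq : IsReducedParameterSystem b q)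
    {v : ExtWeyl R} {i j : Option b.support}
    (h : affAct R v (simpleAff b i) = simpleAff b j ∨
      affAct R v (simpleAff b i) = affNeg R (simpleAff b j)) : q i = q j :=
  hq.eq_of_isConj i j (isConj_iff.2 ⟨v, simpleRefl_conj h⟩)

/-- Multiplying by s_i on the left alters the sign deciding right multiplication by s_j only if w
a_j = ±a_i, that is s_i w = w s_j. In that case q_i = q_j and the correction terms coincide;
otherwise the two operations do not interact. -/
lemma leftOp_comm_rightOp (hq : IsReducedParameterSystem b q) (i j : Option b.support) :
    leftOp q i * rightOp q j = rightOp q j * leftOp q i := by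
  classical
  refine end_ext fun w => ?_
  simp only [Module.End.mul_apply, rightOp_single, leftOp_single, map_add, map_smul, mul_inv_rev,
    affAct_mul, simpleRefl_inv, mul_assoc]
  by_cases h : affAct R w (simpleAff b j) = simpleAff b i ∨
      affAct R w (simpleAff b j) = affNeg R (simpleAff b i)
  · have hc := simpleRefl_conj h
    have hc' : w * simpleRefl b j = simpleRefl b i * w := by rw [← hc]; group
    have hqc : quadCoeff q i = quadCoeff q j := by
      rw [quadCoeff, quadCoeff, hq.eq_of_affAct h]
    rw [← hc', ← hqc]
    rcases h with h | h
    · have h' : affAct R w⁻¹ (simpleAff b i) = simpleAff b j := by rw [← h, affAct_inv_affAct]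
      simp only [h, h', affAct_simpleRefl_self, isPosAff_affNeg, isPosAff_simpleAff]
    · have h' : affAct R w⁻¹ (simpleAff b i) = affNeg R (simpleAff b j) := by
        rw [← affNeg_affNeg (R := R) (simpleAff b i), affAct_affNeg, ← h, affAct_inv_affAct]
      simp only [h, h', affAct_simpleRefl_self, affAct_affNeg, affNeg_affNeg,
        isPosAff_affNeg, isPosAff_simpleAff]
  · rw [not_or] at h
    have h1 : IsPosAff b (affAct R (simpleRefl b i) (affAct R w (simpleAff b j))) ↔
        IsPosAff b (affAct R w (simpleAff b j)) := by
      rw [isPosAff_simpleRefl_iff]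
      simp [h.1, h.2]
    have h2 : IsPosAff b (affAct R (simpleRefl b j) (affAct R w⁻¹ (simpleAff b i))) ↔
        IsPosAff b (affAct R w⁻¹ (simpleAff b i)) := by
      have e1 : affAct R w⁻¹ (simpleAff b i) ≠ affNeg R (simpleAff b j) := fun e => h.2 <| by
        rw [← affAct_affAct_inv w (simpleAff b i), e, affAct_affNeg, affNeg_affNeg]
      have e2 : affAct R w⁻¹ (simpleAff b i) ≠ simpleAff b j := fun e => h.1 <| by
        rw [← affAct_affAct_inv w (simpleAff b i), e]
      rw [isPosAff_simpleRefl_iff]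
      simp only [e1, e2, false_or, ne_eq, not_false_eq_true, and_true]
    simp only [h1, h2]
    module

variable (q) in
/-- The right multiplications by `T_{s_i}` and by `T_γ`, `γ` of length zero. -/
def rightOps : Set (Module.End ℂ (ExtWeyl R →₀ ℂ)) :=
  {A | (∃ i, A = rightOp q i) ∨ ∃ γ, length b γ = 0 ∧ A = rightTransl R γ}

lemma leftOp_mem (hq : IsReducedParameterSystem b q) (i : Option b.support) :
    leftOp q i ∈ Subalgebra.centralizer ℂ (rightOps q) := by
  classical
  rw [Subalgebra.mem_centralizer_iff]
  rintro A (⟨j, rfl⟩ | ⟨γ, hγ, rfl⟩)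
  · exact (leftOp_comm_rightOp hq i j).symm
  · refine end_ext fun w => ?_
    simp only [Module.End.mul_apply, rightTransl_single, leftOp_single, map_add, map_smul,
      mul_inv_rev, affAct_mul, mul_assoc,
      isPosAff_affAct_of_length_eq_zero (b := b) (v := γ⁻¹) (by rw [length_inv, hγ])]

lemma leftTransl_mem {γ : ExtWeyl R} (hγ : length b γ = 0) :
    leftTransl R γ ∈ Subalgebra.centralizer ℂ (rightOps q) := by
  classical
  rw [Subalgebra.mem_centralizer_iff]
  rintro A (⟨j, rfl⟩ | ⟨δ, hδ, rfl⟩)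
  · refine end_ext fun w => ?_
    simp only [Module.End.mul_apply, leftTransl_single, rightOp_single, map_add, map_smul,
      affAct_mul, mul_assoc, isPosAff_affAct_of_length_eq_zero hγ]
  · refine end_ext fun w => ?_
    simp only [Module.End.mul_apply, rightTransl_single, leftTransl_single, mul_assoc]

/-- The vector at v arises from the vector at 1 by right operators along a reduced expression,
without correction terms. When lengths add, the same operators lead from the vector at u to that at
uv without corrections. -/
lemma centralizer_apply_single {A : Module.End ℂ (ExtWeyl R →₀ ℂ)}
    (hA : A ∈ Subalgebra.centralizer ℂ (rightOps q)) {u : ExtWeyl R}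
    (hu : A (Finsupp.single 1 1) = Finsupp.single u 1) {v : ExtWeyl R}
    (huv : length b (u * v) = length b u + length b v) :
    A (Finsupp.single v 1) = Finsupp.single (u * v) 1 := by
  classical
  rw [Subalgebra.mem_centralizer_iff] at hA
  induction hn : length b v generalizing v with
  | zero =>
    have h := LinearMap.congr_fun (hA _ (Or.inr ⟨v, hn, rfl⟩)) (Finsupp.single 1 1)
    rw [Module.End.mul_apply, Module.End.mul_apply, hu, rightTransl_single, rightTransl_single,
      one_mul] at h
    exact h.symm
  | succ n ih =>
    obtain ⟨i, hi⟩ := exists_length_mul_simpleRefl (b := b) (v := v) (by lia)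
    set v' := v * simpleRefl b i with hv'
    have hv : v = v' * simpleRefl b i := by rw [hv', mul_simpleRefl_mul_simpleRefl]
    have h1 : length b (u * v') = length b u + length b v' := by
      have e1 := length_mul_le (b := b) u v'
      have e2 := length_mul_le (b := b) (u * v') (simpleRefl b i)
      rw [length_simpleRefl, mul_assoc, ← hv] at e2
      lia
    have hp : IsPosAff b (affAct R v' (simpleAff b i)) :=
      length_mul_simpleRefl_iff.1 (by rw [← hv]; lia)
    have hp2 : IsPosAff b (affAct R (u * v') (simpleAff b i)) :=
      length_mul_simpleRefl_iff.1 (by rw [mul_assoc, ← hv]; lia)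
    have h := LinearMap.congr_fun (hA _ (Or.inl ⟨i, rfl⟩)) (Finsupp.single v' 1)
    rw [Module.End.mul_apply, Module.End.mul_apply, ih h1 (by lia), rightOp_single, rightOp_single,
      if_pos hp, if_pos hp2, zero_smul, zero_smul, add_zero, add_zero, mul_assoc, ← hv] at h
    exact h.symm

/-- The vector at 1 generates the whole module under `rightOps`, since length-increasing right
multiplications carry no correction. -/
lemma centralizer_ext {A B : Module.End ℂ (ExtWeyl R →₀ ℂ)}
    (hA : A ∈ Subalgebra.centralizer ℂ (rightOps q))
    (hB : B ∈ Subalgebra.centralizer ℂ (rightOps q))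
    (h : A (Finsupp.single 1 1) = B (Finsupp.single 1 1)) : A = B := by
  classical
  refine end_ext fun v => ?_
  rw [Subalgebra.mem_centralizer_iff] at hA hB
  induction hn : length b v generalizing v with
  | zero =>
    have h1 := LinearMap.congr_fun (hA _ (Or.inr ⟨v, hn, rfl⟩)) (Finsupp.single 1 1)
    have h2 := LinearMap.congr_fun (hB _ (Or.inr ⟨v, hn, rfl⟩)) (Finsupp.single 1 1)
    rw [Module.End.mul_apply, Module.End.mul_apply, rightTransl_single, one_mul] at h1 h2
    rw [← h1, ← h2, h]
  | succ n ih =>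
    obtain ⟨i, hi⟩ := exists_length_mul_simpleRefl (b := b) (v := v) (by lia)
    set v' := v * simpleRefl b i with hv'
    have hv : v = v' * simpleRefl b i := by rw [hv', mul_simpleRefl_mul_simpleRefl]
    have hp : IsPosAff b (affAct R v' (simpleAff b i)) :=
      length_mul_simpleRefl_iff.1 (by rw [← hv]; lia)
    have h1 := LinearMap.congr_fun (hA _ (Or.inl ⟨i, rfl⟩)) (Finsupp.single v' 1)
    have h2 := LinearMap.congr_fun (hB _ (Or.inl ⟨i, rfl⟩)) (Finsupp.single v' 1)
    rw [Module.End.mul_apply, Module.End.mul_apply, rightOp_single, if_pos hp, zero_smul, add_zero,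
      ← hv] at h1 h2
    rw [← h1, ← h2, ih v' (by lia)]

lemma exists_centralizer (hq : IsReducedParameterSystem b q) (u : ExtWeyl R) :
    ∃ A ∈ Subalgebra.centralizer ℂ (rightOps q),
      A (Finsupp.single 1 1) = Finsupp.single u (1 : ℂ) := by
  classical
  induction hn : length b u generalizing u with
  | zero => exact ⟨_, leftTransl_mem hn, by rw [leftTransl_single, mul_one]⟩
  | succ n ih =>
    obtain ⟨i, hi⟩ := exists_length_mul_simpleRefl (b := b) (v := u⁻¹) (by rw [length_inv]; lia)
    have hsu : u⁻¹ * simpleRefl b i = (simpleRefl b i * u)⁻¹ := by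
      rw [mul_inv_rev, simpleRefl_inv]
    rw [hsu, length_inv, length_inv] at hi
    obtain ⟨A, hA, hA'⟩ := ih (simpleRefl b i * u) (by lia)
    refine ⟨leftOp q i * A, mul_mem (leftOp_mem hq i) hA, ?_⟩
    have hp : IsPosAff b (affAct R (simpleRefl b i * u)⁻¹ (simpleAff b i)) :=
      length_simpleRefl_mul_iff.1 (by rw [simpleRefl_mul_simpleRefl_mul]; lia)
    rw [Module.End.mul_apply, hA', leftOp_single, if_pos hp, zero_smul, add_zero,
      simpleRefl_mul_simpleRefl_mul]

/-- Left multiplication by `T_u` on the free module with basis `P ⋊ W₀`. -/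
def regOp (hq : IsReducedParameterSystem b q) (u : ExtWeyl R) : Module.End ℂ (ExtWeyl R →₀ ℂ) :=
  (exists_centralizer hq u).choose

lemma regOp_mem (hq : IsReducedParameterSystem b q) (u : ExtWeyl R) :
    regOp hq u ∈ Subalgebra.centralizer ℂ (rightOps q) := (exists_centralizer hq u).choose_spec.1

lemma regOp_single_one (hq : IsReducedParameterSystem b q) (u : ExtWeyl R) :
    regOp hq u (Finsupp.single 1 1) = Finsupp.single u (1 : ℂ) :=
  (exists_centralizer hq u).choose_spec.2

/-- Both sides of each relation lie in the centralizer of `rightOps`, so it suffices to compare them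
on the vector at 1. -/
lemma regOp_rel (hq : IsReducedParameterSystem b q) {x y : FreeAlgebra ℂ (ExtWeyl R)}
    (h : HeckeRel b q x y) :
    FreeAlgebra.lift ℂ (regOp hq) x = FreeAlgebra.lift ℂ (regOp hq) y := by
  classical
  rcases h with _ | ⟨u, v, huv⟩ | ⟨w, i, hwi⟩
  · rw [FreeAlgebra.lift_ι_apply, map_one]
    exact centralizer_ext (regOp_mem hq 1) (one_mem _) (regOp_single_one hq 1)
  · simp only [map_mul, FreeAlgebra.lift_ι_apply]
    refine centralizer_ext (mul_mem (regOp_mem hq u) (regOp_mem hq v)) (regOp_mem hq _) ?_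
    rw [Module.End.mul_apply, regOp_single_one, regOp_single_one,
      centralizer_apply_single (regOp_mem hq u) (regOp_single_one hq u) huv]
  · simp only [map_mul, map_add, map_smul, FreeAlgebra.lift_ι_apply]
    refine centralizer_ext (mul_mem (regOp_mem hq w) (regOp_mem hq _))
      (add_mem (regOp_mem hq _) (Subalgebra.smul_mem _ (regOp_mem hq _) _)) ?_
    -- T_w T_{s_i} applied to the vector at 1 is, by commutation, right multiplication by T_{s_i}
    -- applied to the vector at w, which is the quadratic rule by construction.
    have hA := (Subalgebra.mem_centralizer_iff ℂ).1 (regOp_mem hq w) _ (Or.inl ⟨i, rfl⟩)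
    have h := LinearMap.congr_fun hA (Finsupp.single 1 1)
    have hp := length_mul_simpleRefl_iff_not.1 hwi
    rw [Module.End.mul_apply, Module.End.mul_apply, regOp_single_one, rightOp_single,
      rightOp_single, if_neg hp, map_one, Equiv.Perm.one_apply, if_pos (isPosAff_simpleAff i),
      zero_smul, add_zero, one_mul] at h
    rw [Module.End.mul_apply, regOp_single_one, ← h, LinearMap.add_apply, LinearMap.smul_apply,
      regOp_single_one, regOp_single_one]
    rfl

/-- The left regular representation of the Hecke algebra. -/
def regRep (hq : IsReducedParameterSystem b q) :
    Hecke b q →ₐ[ℂ] Module.End ℂ (ExtWeyl R →₀ ℂ) :=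
  RingQuot.liftAlgHom ℂ ⟨FreeAlgebra.lift ℂ (regOp hq), fun _ _ h => regOp_rel hq h⟩

lemma regRep_T (hq : IsReducedParameterSystem b q) (w : ExtWeyl R) :
    regRep hq (T b q w) = regOp hq w := by
  rw [regRep, T, RingQuot.liftAlgHom_mkAlgHom_apply, FreeAlgebra.lift_ι_apply]

/-- In the regular representation T_w sends the vector at 1 to the vector at w; the coefficient at 1
of the image of the vector at 1 is the required functional. -/
theorem isHeckeTrace_trace (hq : IsReducedParameterSystem b q) :
    IsHeckeTrace b q (trace b q) := by
  classical
  refine Classical.epsilon_spec (p := IsHeckeTrace b q)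
    ⟨(Finsupp.lapply 1).comp ((LinearMap.applyₗ (Finsupp.single 1 1)).comp
      (regRep hq).toLinearMap), ?_, fun w hw => ?_⟩
  · simp [regRep_T, regOp_single_one]
  · simp [regRep_T, regOp_single_one, hw]

/-! ### Relations in the Hecke algebra -/

lemma T_one : T b q 1 = 1 := by
  rw [T, RingQuot.mkAlgHom_rel ℂ HeckeRel.one, map_one]

lemma T_mul {u v : ExtWeyl R} (h : length b (u * v) = length b u + length b v) :
    T b q u * T b q v = T b q (u * v) := by
  rw [T, T, ← map_mul, RingQuot.mkAlgHom_rel ℂ (HeckeRel.mul u v h), T]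

lemma T_mul_simpleRefl {w : ExtWeyl R} {i : Option b.support}
    (h : IsPosAff b (affAct R w (simpleAff b i))) :
    T b q w * T b q (simpleRefl b i) = T b q (w * simpleRefl b i) :=
  T_mul (by rw [length_mul_simpleRefl h, length_simpleRefl])

lemma T_mul_simpleRefl_of_not {w : ExtWeyl R} {i : Option b.support}
    (h : ¬ IsPosAff b (affAct R w (simpleAff b i))) :
    T b q w * T b q (simpleRefl b i) = T b q (w * simpleRefl b i) + quadCoeff q i • T b q w := by
  rw [T, T, ← map_mul, RingQuot.mkAlgHom_rel ℂ (HeckeRel.quad w i (length_mul_simpleRefl_of_not h)),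
    map_add, map_smul]
  rfl

lemma T_mul_of_length_eq_zero (u : ExtWeyl R) {γ : ExtWeyl R} (h : length b γ = 0) :
    T b q u * T b q γ = T b q (u * γ) :=
  T_mul (by rw [length_mul_of_length_eq_zero h, h, add_zero])

lemma T_simpleRefl_sq (i : Option b.support) :
    T b q (simpleRefl b i) * T b q (simpleRefl b i) = 1 + quadCoeff q i • T b q (simpleRefl b i) := by
  rw [T_mul_simpleRefl_of_not (by
    rw [affAct_simpleRefl_self, isPosAff_affNeg, not_not]; exact isPosAff_simpleAff i),
    simpleRefl_mul_self, T_one]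

/-- `T_{s_i}` as a unit, with inverse `T_{s_i} - (q_i^{1/2} - q_i^{-1/2})`. -/
def simpleUnit (q : Option b.support → ℝ) (i : Option b.support) : (Hecke b q)ˣ where
  val := T b q (simpleRefl b i)
  inv := T b q (simpleRefl b i) - algebraMap ℂ _ (quadCoeff q i)
  val_inv := by
    rw [mul_sub, T_simpleRefl_sq, ← Algebra.commutes, Algebra.smul_def, add_sub_cancel_right]
  inv_val := by
    rw [sub_mul, T_simpleRefl_sq, Algebra.smul_def, add_sub_cancel_right]

lemma val_simpleUnit (i : Option b.support) :
    (simpleUnit q i : Hecke b q) = T b q (simpleRefl b i) := rfl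

lemma val_inv_simpleUnit (i : Option b.support) :
    ((simpleUnit q i)⁻¹ : (Hecke b q)ˣ) =
      T b q (simpleRefl b i) - algebraMap ℂ (Hecke b q) (quadCoeff q i) := rfl

lemma ringInverse_T_simpleRefl (i : Option b.support) :
    Ring.inverse (T b q (simpleRefl b i)) = ((simpleUnit q i)⁻¹ : (Hecke b q)ˣ) :=
  Ring.inverse_unit (simpleUnit q i)

lemma T_mul_inv_simpleUnit {w : ExtWeyl R} {i : Option b.support}
    (h : ¬ IsPosAff b (affAct R w (simpleAff b i))) :
    T b q w * ((simpleUnit q i)⁻¹ : (Hecke b q)ˣ) = T b q (w * simpleRefl b i) := by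
  rw [Units.mul_inv_eq_iff_eq_mul, val_simpleUnit, T_mul_simpleRefl (isPosAff_mul_simpleRefl.2 h),
    mul_simpleRefl_mul_simpleRefl]

lemma isUnit_T (w : ExtWeyl R) : IsUnit (T b q w) := by
  induction hn : length b w generalizing w with
  | zero =>
    refine ⟨⟨T b q w, T b q w⁻¹, ?_, ?_⟩, rfl⟩
    · rw [T_mul_of_length_eq_zero _ (by rw [length_inv, hn]), mul_inv_cancel, T_one]
    · rw [T_mul_of_length_eq_zero _ hn, inv_mul_cancel, T_one]
  | succ n ih =>
    obtain ⟨i, hi⟩ := exists_length_mul_simpleRefl (b := b) (v := w) (by lia)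
    have hp := isPosAff_mul_simpleRefl.2 (length_mul_simpleRefl_iff_not.1 hi)
    have h := T_mul_simpleRefl (q := q) hp
    rw [mul_simpleRefl_mul_simpleRefl] at h
    rw [← h]
    exact (ih _ (by lia)).mul (simpleUnit q i).isUnit

lemma mul_mem_span_T {x y : Hecke b q} (hx : x ∈ Submodule.span ℂ (Set.range (T b q)))
    (hy : y ∈ Submodule.span ℂ (Set.range (T b q))) :
    x * y ∈ Submodule.span ℂ (Set.range (T b q)) := by
  have h1 : ∀ i, ∀ x ∈ Submodule.span ℂ (Set.range (T b q)),
      x * T b q (simpleRefl b i) ∈ Submodule.span ℂ (Set.range (T b q)) := by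
    intro i x hx
    induction hx using Submodule.span_induction with
    | mem x hx =>
      obtain ⟨w, rfl⟩ := hx
      by_cases hp : IsPosAff b (affAct R w (simpleAff b i))
      · rw [T_mul_simpleRefl hp]
        exact Submodule.subset_span ⟨_, rfl⟩
      · rw [T_mul_simpleRefl_of_not hp]
        exact add_mem (Submodule.subset_span ⟨_, rfl⟩)
          (Submodule.smul_mem _ _ (Submodule.subset_span ⟨_, rfl⟩))
    | zero => rw [zero_mul]; exact zero_mem _
    | add x y _ _ hx hy => rw [add_mul]; exact add_mem hx hy
    | smul c x _ hx => rw [smul_mul_assoc]; exact Submodule.smul_mem _ _ hx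
  have h2 : ∀ v, ∀ x ∈ Submodule.span ℂ (Set.range (T b q)),
      x * T b q v ∈ Submodule.span ℂ (Set.range (T b q)) := by
    intro v
    induction hn : length b v generalizing v with
    | zero =>
      intro x hx
      induction hx using Submodule.span_induction with
      | mem x hx =>
        obtain ⟨w, rfl⟩ := hx
        rw [T_mul_of_length_eq_zero _ hn]
        exact Submodule.subset_span ⟨_, rfl⟩
      | zero => rw [zero_mul]; exact zero_mem _
      | add x y _ _ hx hy => rw [add_mul]; exact add_mem hx hy
      | smul c x _ hx => rw [smul_mul_assoc]; exact Submodule.smul_mem _ _ hx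
    | succ n ih =>
      intro x hx
      obtain ⟨i, hi⟩ := exists_length_mul_simpleRefl (b := b) (v := v) (by lia)
      have hp := isPosAff_mul_simpleRefl.2 (length_mul_simpleRefl_iff_not.1 hi)
      have h := T_mul_simpleRefl (q := q) hp
      rw [mul_simpleRefl_mul_simpleRefl] at h
      rw [← h, ← mul_assoc]
      exact h1 i _ (ih _ (by lia) x hx)
  induction hy using Submodule.span_induction with
  | mem y hy =>
    obtain ⟨w, rfl⟩ := hy
    exact h2 w x hx
  | zero => rw [mul_zero]; exact zero_mem _
  | add y z _ _ hy hz => rw [mul_add]; exact add_mem hy hz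
  | smul c y _ hy => rw [mul_smul_comm]; exact Submodule.smul_mem _ _ hy

lemma span_T : Submodule.span ℂ (Set.range (T b q)) = ⊤ := by
  refine Submodule.eq_top_iff'.2 fun x => ?_
  obtain ⟨y, rfl⟩ := RingQuot.mkAlgHom_surjective ℂ (HeckeRel b q) x
  have h1 : (1 : Hecke b q) ∈ Submodule.span ℂ (Set.range (T b q)) :=
    Submodule.subset_span ⟨1, T_one⟩
  induction y using FreeAlgebra.induction with
  | grade0 r => rw [AlgHom.commutes, Algebra.algebraMap_eq_smul_one]; exact Submodule.smul_mem _ _ h1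
  | grade1 w => exact Submodule.subset_span ⟨w, rfl⟩
  | mul x y hx hy => rw [map_mul]; exact mul_mem_span_T hx hy
  | add x y hx hy => rw [map_add]; exact add_mem hx hy

open Classical in
-- The first letter of v is moved across to u, which shortens v; the only danger is the correction
-- term in T_u T_{s_i}.
lemma IsHeckeTrace.T_mul_T {f : Hecke b q →ₗ[ℂ] ℂ} (hf : IsHeckeTrace b q f) (u v : ExtWeyl R) :
    f (T b q u * T b q v) = if u * v = 1 then 1 else 0 := by
  have hT : ∀ w, f (T b q w) = if w = 1 then 1 else 0 := fun w => by
    split_ifs with h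
    · rw [h, hf.1]
    · exact hf.2 w h
  induction hn : length b v generalizing u v with
  | zero => rw [T_mul_of_length_eq_zero _ hn, hT]
  | succ n ih =>
    obtain ⟨i, hi⟩ := exists_length_mul_simpleRefl (b := b) (v := v⁻¹) (by rw [length_inv]; lia)
    have hsv : v⁻¹ * simpleRefl b i = (simpleRefl b i * v)⁻¹ := by
      rw [mul_inv_rev, simpleRefl_inv]
    rw [hsv, length_inv, length_inv] at hi
    set v' := simpleRefl b i * v with hv'
    have hv : v = simpleRefl b i * v' := by rw [hv', simpleRefl_mul_simpleRefl_mul]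
    have hT' : T b q v = T b q (simpleRefl b i) * T b q v' := by
      rw [T_mul, ← hv]
      rw [← hv, length_simpleRefl, hi, add_comm]
    rw [hT', ← mul_assoc]
    by_cases hp : IsPosAff b (affAct R u (simpleAff b i))
    · rw [T_mul_simpleRefl hp, ih _ _ (by lia), mul_assoc, ← hv]
    · rw [T_mul_simpleRefl_of_not hp, add_mul, map_add, ih _ _ (by lia), smul_mul_assoc, map_smul,
        ih _ _ (by lia), mul_assoc, ← hv, if_neg (c := u * v' = 1), smul_zero, add_zero]
      -- If the correction term contributed, u would be v'⁻¹; but s_i v' is longer than v', so u s_i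
      -- is longer than u, contrary to the case at hand.
      intro h
      have h1 : u = v'⁻¹ := eq_inv_of_mul_eq_one_left h
      have h2 := length_mul_simpleRefl_of_not hp
      rw [h1, length_inv, ← length_inv (v'⁻¹ * simpleRefl b i), mul_inv_rev, inv_inv,
        simpleRefl_inv, ← hv] at h2
      lia

lemma IsHeckeTrace.mul_comm {f : Hecke b q →ₗ[ℂ] ℂ} (hf : IsHeckeTrace b q f) (x y : Hecke b q) :
    f (x * y) = f (y * x) := by
  classical
  have hx : x ∈ Submodule.span ℂ (Set.range (T b q)) := by
    rw [span_T]; exact Submodule.mem_top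
  have hy : y ∈ Submodule.span ℂ (Set.range (T b q)) := by
    rw [span_T]; exact Submodule.mem_top
  induction hx using Submodule.span_induction with
  | mem x hx =>
    obtain ⟨u, rfl⟩ := hx
    induction hy using Submodule.span_induction with
    | mem y hy =>
      obtain ⟨v, rfl⟩ := hy
      rw [hf.T_mul_T, hf.T_mul_T]
      exact if_congr mul_eq_one_comm rfl rfl
    | zero => simp
    | add y z _ _ hy hz => rw [mul_add, add_mul, map_add, map_add, hy, hz]
    | smul c y _ hy => rw [mul_smul_comm, smul_mul_assoc, map_smul, map_smul, hy]
  | zero => simp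
  | add y z _ _ hy hz => rw [mul_add, add_mul, map_add, map_add, hy, hz]
  | smul c y _ hy => rw [mul_smul_comm, smul_mul_assoc, map_smul, map_smul, hy]

end HeckeAlgebra

end

end AffineHecke

namespace AffineHecke

noncomputable section

open MeasureTheory

set_option linter.unusedSectionVars false

/-! ### Weights of inversions and the idempotent 1_0 -/

section Parameters

variable {ι V E : Type*} [AddCommGroup V] [Module ℝ V] [AddCommGroup E] [Module ℝ E]
variable {R : RootPairing ι ℝ V E} {b : R.Base} [Fintype ι] [Nonempty ι]
variable [R.IsCrystallographic] [R.IsReduced] [R.IsIrreducible]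
variable {q : Option b.support → ℝ}

/-! ### The parameters `q_v` -/

open Classical in
variable (q) in
/-- The parameter `q_i` of an affine root `v a_i`. -/
def qAff (a : ι × ℤ) : ℝ :=
  -- The default 1 keeps `qAff` positive and invariant on all affine roots, so conjugacy of every
  -- affine root to a simple one need not be known.
  if h : ∃ i, ∃ v : ExtWeyl R, affAct R v (simpleAff b i) = a then q h.choose else 1

lemma qAff_affAct (hq : IsReducedParameterSystem b q) (v : ExtWeyl R) (i : Option b.support) :
    qAff q (affAct R v (simpleAff b i)) = q i := by
  have h : ∃ j, ∃ u : ExtWeyl R, affAct R u (simpleAff b j) = affAct R v (simpleAff b i) :=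
    ⟨i, v, rfl⟩
  rw [qAff, dif_pos h]
  obtain ⟨u, hu⟩ := h.choose_spec
  refine hq.eq_of_affAct (v := v⁻¹ * u) (Or.inl ?_)
  rw [affAct_mul, hu, affAct_inv_affAct]

lemma qAff_affNeg (hq : IsReducedParameterSystem b q) (a : ι × ℤ) :
    qAff q (affNeg R a) = qAff q a := by
  have key : ∀ i (v : ExtWeyl R), affNeg R (affAct R v (simpleAff b i)) =
      affAct R (v * simpleRefl b i) (simpleAff b i) := fun i v => by
    rw [affAct_mul, affAct_simpleRefl_self, affAct_affNeg]
  by_cases h : ∃ i, ∃ v : ExtWeyl R, affAct R v (simpleAff b i) = a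
  · obtain ⟨i, v, rfl⟩ := h
    rw [key, qAff_affAct hq, qAff_affAct hq]
  · have h' : ¬ ∃ i, ∃ v : ExtWeyl R, affAct R v (simpleAff b i) = affNeg R a := by
      rintro ⟨i, v, hv⟩
      exact h ⟨i, v * simpleRefl b i, by rw [← key, hv, affNeg_affNeg]⟩
    rw [qAff, qAff, dif_neg h, dif_neg h']

lemma qAff_affAct' (hq : IsReducedParameterSystem b q) (u : ExtWeyl R) (a : ι × ℤ) :
    qAff q (affAct R u a) = qAff q a := by
  by_cases h : ∃ i, ∃ v : ExtWeyl R, affAct R v (simpleAff b i) = a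
  · obtain ⟨i, v, rfl⟩ := h
    rw [← affAct_mul, qAff_affAct hq, qAff_affAct hq]
  · have h' : ¬ ∃ i, ∃ v : ExtWeyl R, affAct R v (simpleAff b i) = affAct R u a := by
      rintro ⟨i, v, hv⟩
      exact h ⟨i, u⁻¹ * v, by rw [affAct_mul, hv, affAct_inv_affAct]⟩
    rw [qAff, qAff, dif_neg h, dif_neg h']

lemma finprod_invSet_mul_simpleRefl (hq : IsReducedParameterSystem b q) {v : ExtWeyl R}
    {i : Option b.support} (h : IsPosAff b (affAct R v (simpleAff b i))) :
    ∏ᶠ a ∈ invSet b (v * simpleRefl b i), qAff q a = q i * ∏ᶠ a ∈ invSet b v, qAff q a := by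
  rw [invSet_mul_simpleRefl h, finprod_mem_insert _ notMem_invSet_of_isPosAff (invSet_finite v),
    qAff_affAct hq]

lemma finprod_invSet_inv (hq : IsReducedParameterSystem b q) (v : ExtWeyl R) :
    ∏ᶠ a ∈ invSet b v⁻¹, qAff q a = ∏ᶠ a ∈ invSet b v, qAff q a := by
  refine finprod_mem_eq_of_bijOn (fun a => affNeg R (affAct R v a)) ⟨?_, ?_, ?_⟩ fun a _ => ?_
  · rintro a ⟨h1, h2⟩
    rw [inv_inv] at h2
    refine ⟨isPosAff_affNeg.2 h2, ?_⟩
    rw [affAct_affNeg, affAct_inv_affAct, isPosAff_affNeg, not_not]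
    exact h1
  · intro a _ c _ h
    exact (affAct R v).injective (affNeg_injective h)
  · rintro a ⟨h1, h2⟩
    refine ⟨affNeg R (affAct R v⁻¹ a), ⟨isPosAff_affNeg.2 h2, ?_⟩, ?_⟩
    · rw [inv_inv, affAct_affNeg, affAct_affAct_inv, isPosAff_affNeg, not_not]
      exact h1
    · simp only [affAct_affNeg, affAct_affAct_inv, affNeg_affNeg]
  · rw [qAff_affNeg hq, qAff_affAct' hq]

/-- Each letter of a reduced expression adds one inversion, weighted by its own parameter. The
product over inversions makes no reference to the expression, which is why `qElt` does not depend on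
its choice. -/
lemma prod_of_reduced (hq : IsReducedParameterSystem b q) {L : List (Option b.support)}
    {γ v : ExtWeyl R} (h : IsExpression b L γ v) (hL : L.length = length b v) :
    (L.map q).prod = ∏ᶠ a ∈ invSet b v, qAff q a := by
  induction L generalizing v with
  | nil =>
    have h0 : invSet b v = ∅ := by
      rw [← Set.ncard_eq_zero (invSet_finite v), ← length_eq_ncard, ← hL, List.length_nil]
    rw [h0, finprod_mem_empty, List.map_nil, List.prod_nil]
  | cons i L ih =>
    obtain ⟨hγ, rfl⟩ := h
    set v' := (L.map (simpleRefl b)).prod * γ with hv'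
    have hexp : IsExpression b L γ v' := ⟨hγ, rfl⟩
    have he : ((i :: L).map (simpleRefl b)).prod * γ = simpleRefl b i * v' := by
      rw [List.map_cons, List.prod_cons, mul_assoc]
    rw [he] at hL ⊢
    rw [List.length_cons] at hL
    have h1 := length_le_of_isExpression hexp
    have h2 := length_mul_le (b := b) (simpleRefl b i) v'
    rw [length_simpleRefl] at h2
    have hp : IsPosAff b (affAct R v'⁻¹ (simpleAff b i)) :=
      length_simpleRefl_mul_iff.1 (by lia)
    rw [List.map_cons, List.prod_cons, ih hexp (by lia), ← finprod_invSet_inv hq v',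
      ← finprod_invSet_mul_simpleRefl hq hp, ← finprod_invSet_inv hq, mul_inv_rev, simpleRefl_inv,
      inv_inv]

lemma qElt_eq_finprod (hq : IsReducedParameterSystem b q) (v : ExtWeyl R) :
    qElt b q v = ∏ᶠ a ∈ invSet b v, qAff q a := by
  obtain ⟨L, γ, h1, h2⟩ := exists_reduced_expression (b := b) v
  obtain ⟨L', γ', h1', h2', h3⟩ := Classical.epsilon_spec
    (p := fun r => ∃ L γ, IsExpression b L γ v ∧ L.length = length b v ∧ r = (L.map q).prod)
    ⟨_, L, γ, h1, h2, rfl⟩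
  rw [qElt, h3, prod_of_reduced hq h1' h2']

lemma qElt_one (hq : IsReducedParameterSystem b q) : qElt b q 1 = 1 := by
  have h0 : invSet b (1 : ExtWeyl R) = ∅ := by
    rw [← Set.ncard_eq_zero (invSet_finite _), ← length_eq_ncard, length_one]
  rw [qElt_eq_finprod hq, h0, finprod_mem_empty]

lemma qElt_inv (hq : IsReducedParameterSystem b q) (v : ExtWeyl R) :
    qElt b q v⁻¹ = qElt b q v := by
  rw [qElt_eq_finprod hq, qElt_eq_finprod hq, finprod_invSet_inv hq]

lemma qElt_mul_simpleRefl (hq : IsReducedParameterSystem b q) {v : ExtWeyl R}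
    {i : Option b.support} (h : IsPosAff b (affAct R v (simpleAff b i))) :
    qElt b q (v * simpleRefl b i) = q i * qElt b q v := by
  rw [qElt_eq_finprod hq, qElt_eq_finprod hq, finprod_invSet_mul_simpleRefl hq h]

lemma qAff_pos (hq : IsReducedParameterSystem b q) (a : ι × ℤ) : 0 < qAff q a := by
  rw [qAff]
  split_ifs
  · exact zero_lt_one.trans (hq.one_lt _)
  · exact one_pos

lemma qElt_pos (hq : IsReducedParameterSystem b q) (v : ExtWeyl R) : 0 < qElt b q v := by
  rw [qElt_eq_finprod hq, ← (invSet_finite (b := b) v).coe_toFinset, finprod_mem_coe_finset]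
  exact Finset.prod_pos fun a _ => qAff_pos hq a

lemma poincare_pos (hq : IsReducedParameterSystem b q) : 0 < poincare b q :=
  Finset.sum_pos (fun _ _ => qElt_pos hq _) ⟨1, Finset.mem_univ _⟩

/-! ### The idempotent `1_0` -/

lemma simpleRefl_some (i : b.support) : simpleRefl b (some i) = ofWeyl R (rootRefl R i) := rfl

/-- The identity 1 + q^{1/2}(q^{1/2} - q^{-1/2}) = q, scaled for the coefficients q_w^{1/2} in the
descending case. -/
lemma sqrt_mul_quad (hq : IsReducedParameterSystem b q) (i : Option b.support) (r : ℝ) :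
    √r + √r * √(q i) * (√(q i) - (√(q i))⁻¹) = √(q i) * (√(q i) * √r) := by
  have : √(q i) ≠ 0 := (Real.sqrt_pos.2 (zero_lt_one.trans (hq.one_lt i))).ne'
  field_simp
  ring

/-- After reindexing by w ↦ ws, the coefficient of T_w is q_{ws}^{1/2}, plus the quadratic
correction when ws is shorter than w. In either case it is q_i^{1/2} q_w^{1/2}. -/
lemma oneZero_mul_T (hq : IsReducedParameterSystem b q) (i : b.support) :
    oneZero b q * T b q (simpleRefl b (some i)) = ((√(q (some i)) : ℝ) : ℂ) • oneZero b q := by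
  classical
  set s := rootRefl R (i : ι) with hs
  have hs2 : ∀ w : weylGroup R, w * s * s = w := fun w => by rw [mul_assoc, rootRefl_mul_self, mul_one]
  have hmul : ∀ w : weylGroup R, ofWeyl R (w * s) = ofWeyl R w * simpleRefl b (some i) := fun w =>
    ofWeyl_mul w s
  let P : weylGroup R → Prop := fun w => IsPosAff b (affAct R (ofWeyl R w) (simpleAff b (some i)))
  have hT : ∀ w : weylGroup R, T b q (ofWeyl R w) * T b q (simpleRefl b (some i)) =
      T b q (ofWeyl R (w * s)) +
        (if P w then 0 else quadCoeff q (some i)) • T b q (ofWeyl R w) := fun w => by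
    by_cases h : P w
    · rw [if_pos h, zero_smul, add_zero, T_mul_simpleRefl h, hmul]
    · rw [if_neg h, T_mul_simpleRefl_of_not h, hmul]
  rw [oneZero, smul_mul_assoc, smul_comm]
  congr 1
  rw [Finset.sum_mul, Finset.smul_sum]
  simp only [smul_mul_assoc, hT, smul_add, Finset.sum_add_distrib]
  have hre : ∑ w : weylGroup R, ((√(qElt b q (ofWeyl R w)) : ℝ) : ℂ) • T b q (ofWeyl R (w * s)) =
      ∑ w : weylGroup R, ((√(qElt b q (ofWeyl R (w * s))) : ℝ) : ℂ) • T b q (ofWeyl R w) :=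
    Fintype.sum_equiv (Equiv.mulRight s) _ _ fun w => by rw [Equiv.coe_mulRight, hs2]
  rw [hre, ← Finset.sum_add_distrib]
  refine Finset.sum_congr rfl fun w _ => ?_
  rw [smul_smul, smul_smul, ← add_smul]
  congr 1
  by_cases h : P w
  · rw [if_pos h, mul_zero, add_zero, hmul, qElt_mul_simpleRefl hq h,
      Real.sqrt_mul (zero_lt_one.trans (hq.one_lt _)).le]
    push_cast
    rfl
  · have h' := qElt_mul_simpleRefl hq (isPosAff_mul_simpleRefl.2 h)
    rw [mul_simpleRefl_mul_simpleRefl, ← hmul] at h'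
    have h2 := sqrt_mul_quad hq (some i) (qElt b q (ofWeyl R (w * s)))
    rw [if_neg h, h', Real.sqrt_mul (zero_lt_one.trans (hq.one_lt _)).le, quadCoeff]
    norm_cast
    rw [← h2]
    ring

lemma T_simpleRefl_mul {w : ExtWeyl R} {i : Option b.support}
    (h : IsPosAff b (affAct R w⁻¹ (simpleAff b i))) :
    T b q (simpleRefl b i) * T b q w = T b q (simpleRefl b i * w) :=
  T_mul (by rw [length_simpleRefl_mul_iff.2 h, length_simpleRefl, add_comm])

lemma T_simpleRefl_mul_of_not {w : ExtWeyl R} {i : Option b.support}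
    (h : ¬ IsPosAff b (affAct R w⁻¹ (simpleAff b i))) :
    T b q (simpleRefl b i) * T b q w = T b q (simpleRefl b i * w) + quadCoeff q i • T b q w := by
  have h1 := T_simpleRefl_mul (q := q) (w := simpleRefl b i * w) (i := i) (by
    rw [mul_inv_rev, simpleRefl_inv, isPosAff_mul_simpleRefl]; exact h)
  rw [simpleRefl_mul_simpleRefl_mul] at h1
  rw [← h1, ← mul_assoc, T_simpleRefl_sq, add_mul, one_mul, smul_mul_assoc]

lemma T_mul_oneZero (hq : IsReducedParameterSystem b q) (i : b.support) :
    T b q (simpleRefl b (some i)) * oneZero b q = ((√(q (some i)) : ℝ) : ℂ) • oneZero b q := by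
  classical
  set s := rootRefl R (i : ι) with hs
  have hs2 : ∀ w : weylGroup R, s * (s * w) = w := fun w => by
    rw [← mul_assoc, rootRefl_mul_self, one_mul]
  have hmul : ∀ w : weylGroup R, ofWeyl R (s * w) = simpleRefl b (some i) * ofWeyl R w := fun w =>
    ofWeyl_mul s w
  let P : weylGroup R → Prop := fun w => IsPosAff b (affAct R (ofWeyl R w)⁻¹ (simpleAff b (some i)))
  have hT : ∀ w : weylGroup R, T b q (simpleRefl b (some i)) * T b q (ofWeyl R w) =
      T b q (ofWeyl R (s * w)) +
        (if P w then 0 else quadCoeff q (some i)) • T b q (ofWeyl R w) := fun w => by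
    by_cases h : P w
    · rw [if_pos h, zero_smul, add_zero, T_simpleRefl_mul h, hmul]
    · rw [if_neg h, T_simpleRefl_mul_of_not h, hmul]
  rw [oneZero, mul_smul_comm, smul_comm]
  congr 1
  rw [Finset.mul_sum, Finset.smul_sum]
  simp only [mul_smul_comm, hT, smul_add, Finset.sum_add_distrib]
  have hre : ∑ w : weylGroup R, ((√(qElt b q (ofWeyl R w)) : ℝ) : ℂ) • T b q (ofWeyl R (s * w)) =
      ∑ w : weylGroup R, ((√(qElt b q (ofWeyl R (s * w))) : ℝ) : ℂ) • T b q (ofWeyl R w) :=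
    Fintype.sum_equiv (Equiv.mulLeft s) _ _ fun w => by rw [Equiv.coe_mulLeft, hs2]
  rw [hre, ← Finset.sum_add_distrib]
  refine Finset.sum_congr rfl fun w _ => ?_
  rw [smul_smul, smul_smul, ← add_smul]
  congr 1
  have hinv : ∀ u : ExtWeyl R, (u⁻¹ * simpleRefl b (some i))⁻¹ = simpleRefl b (some i) * u :=
    fun u => by rw [mul_inv_rev, simpleRefl_inv, inv_inv]
  by_cases h : P w
  · rw [if_pos h, mul_zero, add_zero, hmul, ← hinv, qElt_inv hq, qElt_mul_simpleRefl hq h,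
      qElt_inv hq, Real.sqrt_mul (zero_lt_one.trans (hq.one_lt _)).le]
    push_cast
    rfl
  · have h' := qElt_mul_simpleRefl hq (isPosAff_mul_simpleRefl.2 h)
    rw [mul_simpleRefl_mul_simpleRefl, ← qElt_inv hq (_ * _), hinv, qElt_inv hq, ← hmul] at h'
    have h2 := sqrt_mul_quad hq (some i) (qElt b q (ofWeyl R (s * w)))
    rw [if_neg h, h', Real.sqrt_mul (zero_lt_one.trans (hq.one_lt _)).le, quadCoeff]
    norm_cast
    rw [← h2]
    ring

end Parameters

end

end AffineHecke

namespace AffineHecke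

noncomputable section

open MeasureTheory

set_option linter.unusedSectionVars false

/-! ### Alcove walks, the elements x^μ and the Bernstein relation -/

section AlcoveWalks

variable {ι V E : Type*} [AddCommGroup V] [Module ℝ V] [AddCommGroup E] [Module ℝ E]
variable {R : RootPairing ι ℝ V E} {b : R.Base} [Fintype ι] [Nonempty ι]
variable [R.IsCrystallographic] [R.IsReduced] [R.IsIrreducible]
variable {q : Option b.support → ℝ}

/-! ### Dominant coweights -/

lemma coweightPairing_zero (i : ι) : coweightPairing R 0 i = 0 :=
  coweightPairing_eq (by simp)

lemma coweightPairing_neg (μ : coweightLattice R) (i : ι) :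
    coweightPairing R (-μ) i = -coweightPairing R μ i :=
  coweightPairing_eq (by rw [AddSubgroup.coe_neg, map_neg, coweightPairing_spec]; push_cast; rfl)

lemma coweightPairing_sub (μ ν : coweightLattice R) (i : ι) :
    coweightPairing R (μ - ν) i = coweightPairing R μ i - coweightPairing R ν i := by
  rw [sub_eq_add_neg, coweightPairing_add, coweightPairing_neg, sub_eq_add_neg]

lemma coweightPairing_zsmul (n : ℤ) (μ : coweightLattice R) (i : ι) :
    coweightPairing R (n • μ) i = n * coweightPairing R μ i :=
  coweightPairing_eq (by
    rw [AddSubgroup.coe_zsmul, map_zsmul, coweightPairing_spec, zsmul_eq_mul]; push_cast; rfl)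

lemma coweightPairing_nsmul (n : ℕ) (μ : coweightLattice R) (i : ι) :
    coweightPairing R (n • μ) i = n * coweightPairing R μ i := by
  rw [← natCast_zsmul, coweightPairing_zsmul]

lemma coweightPairing_reflectionPerm_self (μ : coweightLattice R) (i : ι) :
    coweightPairing R μ (R.reflectionPerm i i) = -coweightPairing R μ i :=
  coweightPairing_eq (by rw [root'_reflectionPerm_self, coweightPairing_spec]; push_cast; rfl)

variable (b) in
/-- A coweight is dominant if it pairs non-negatively with the simple roots. -/
def IsDominant (μ : coweightLattice R) : Prop := ∀ j ∈ b.support, 0 ≤ coweightPairing R μ j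

lemma IsDominant.nonneg {μ : coweightLattice R} (h : IsDominant b μ) {i : ι} (hi : b.IsPos i) :
    0 ≤ coweightPairing R μ i := by
  have := IsPos.root'_nonneg hi (x := (μ : E)) fun j hj => by
    rw [coweightPairing_spec]; exact_mod_cast h j hj
  rw [coweightPairing_spec] at this
  exact_mod_cast this

lemma IsDominant.nonpos {μ : coweightLattice R} (h : IsDominant b μ) {i : ι} (hi : ¬ b.IsPos i) :
    coweightPairing R μ i ≤ 0 := by
  have := h.nonneg ((isPos_reflectionPerm_self b).2 hi)
  rw [coweightPairing_reflectionPerm_self] at this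
  lia

lemma IsDominant.add {μ ν : coweightLattice R} (hμ : IsDominant b μ) (hν : IsDominant b ν) :
    IsDominant b (μ + ν) := fun j hj => by
  rw [coweightPairing_add]
  exact add_nonneg (hμ j hj) (hν j hj)

lemma isDominant_zero : IsDominant b (0 : coweightLattice R) := fun j _ =>
  (coweightPairing_zero j).ge

variable (b) in
/-- The sum of the fundamental coweights. -/
def sumFund : coweightLattice R := (exists_coweightPairing_eq b fun _ => 1).choose

lemma coweightPairing_sumFund {j : ι} (hj : j ∈ b.support) :
    coweightPairing R (sumFund b) j = 1 :=
  (exists_coweightPairing_eq b fun _ => 1).choose_spec j hj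

lemma coweightPairing_sumFund_pos {i : ι} (hi : b.IsPos i) :
    0 < coweightPairing R (sumFund b) i := by
  have := IsPos.root'_pos hi (x := (sumFund b : E)) fun j hj => by
    rw [coweightPairing_spec, coweightPairing_sumFund hj]; simp
  rw [coweightPairing_spec] at this
  exact_mod_cast this

lemma coweightPairing_sumFund_neg {i : ι} (hi : ¬ b.IsPos i) :
    coweightPairing R (sumFund b) i < 0 := by
  have := coweightPairing_sumFund_pos ((isPos_reflectionPerm_self b).2 hi)
  rw [coweightPairing_reflectionPerm_self] at this
  lia

lemma exists_isDominant_add (μ : coweightLattice R) :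
    ∃ ν, (∀ j ∈ b.support, coweightPairing R ν j = |coweightPairing R μ j|) ∧
      IsDominant b ν ∧ IsDominant b (ν + μ) := by
  obtain ⟨ν, hν⟩ := exists_coweightPairing_eq b fun j => |coweightPairing R μ j|
  refine ⟨ν, hν, fun j hj => ?_, fun j hj => ?_⟩
  · rw [hν j hj]; exact abs_nonneg _
  · rw [coweightPairing_add, hν j hj]
    linarith [neg_abs_le (coweightPairing R μ j)]

/-- Inversions of a dominant translation have negative gradient, and a further dominant translation
only raises their level; this is why lengths of dominant translations add. -/
lemma mem_invSet_transl {μ : coweightLattice R} (hμ : IsDominant b μ) {a : ι × ℤ}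
    (ha : a ∈ invSet b (transl R μ)) :
    ¬ b.IsPos a.1 ∧ 0 < a.2 ∧ a.2 ≤ -coweightPairing R μ a.1 := by
  obtain ⟨h1, h2⟩ := ha
  rw [← transl_neg, affAct_transl, coweightPairing_neg, IsPosAff] at h2
  push Not at h2
  have hp : ¬ b.IsPos a.1 := fun hp => by
    have h3 := hμ.nonneg hp
    have h4 : 0 ≤ a.2 := by
      rcases h1 with h | h
      · exact h.le
      · exact h.1.ge
    exact h2.2 (by have := h2.1; simp only at this ⊢; lia) hp
  refine ⟨hp, ?_, by have := h2.1; simp only at this; lia⟩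
  rcases h1 with h | h
  · exact h
  · exact absurd h.2 hp

lemma T_transl_mul {μ ν : coweightLattice R} (hμ : IsDominant b μ) (hν : IsDominant b ν) :
    T b q (transl R μ) * T b q (transl R ν) = T b q (transl R (μ + ν)) := by
  rw [transl_add]
  refine T_mul (length_mul_of_forall fun a ha => ?_)
  obtain ⟨h1, h2, -⟩ := mem_invSet_transl hν ha
  rw [affAct_transl]
  have := hμ.nonpos h1
  exact Or.inl (by simp only; lia)

lemma T_transl_comm {μ ν : coweightLattice R} (hμ : IsDominant b μ) (hν : IsDominant b ν) :
    T b q (transl R μ) * T b q (transl R ν) = T b q (transl R ν) * T b q (transl R μ) := by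
  rw [T_transl_mul hμ hν, T_transl_mul hν hμ, add_comm]

/-! ### The elements `x_v` -/

/-- The hyperplane between the alcoves x and x s_i is the zero set of x a_i, which is positive on
the first alcove. The step is thus positive exactly when the positive root belongs to -x a_i. -/
lemma isPositiveCrossing_iff (x : ExtWeyl R) (i : Option b.support) :
    IsPositiveCrossing b x i ↔ ¬ b.IsPos (affAct R x (simpleAff b i)).1 := by
  have e : ∀ (u : ExtWeyl R) (a : ι × ℤ) (y : E), R.root' a.1 (act u y) + a.2 =
      affEval R (affAct R u⁻¹ a) y := fun u a y => by rw [affEval_affAct', inv_inv]; rfl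
  constructor
  · rintro ⟨α, k, hα, h1, h2⟩
    obtain ⟨y, hy⟩ := fundAlcove_nonempty (b := b)
    have h1' := h1 y hy
    have h2' := h2 y hy
    rw [e x (α, k)] at h1'
    rw [e (x * simpleRefl b i) (α, k), mul_inv_rev, simpleRefl_inv, affAct_mul] at h2'
    rcases isPosAff_simpleRefl_iff.1 (isPosAff_of_affEval_pos hy h2') with h | h
    · have h3 : affAct R x (simpleAff b i) = affNeg R (α, k) := by
        rw [← affAct_affAct_inv x (α, k), h, affAct_affNeg, affNeg_affNeg]
      rw [h3]
      exact fun h4 => (isPos_reflectionPerm_self b).1 h4 hα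
    · exact absurd (affEval_pos_of_isPosAff h.1 hy) (not_lt.2 h1'.le)
  · intro h
    refine ⟨(affNeg R (affAct R x (simpleAff b i))).1, (affNeg R (affAct R x (simpleAff b i))).2,
      (isPos_reflectionPerm_self b).2 h, fun y hy => ?_, fun y hy => ?_⟩
    · rw [e, affAct_affNeg, affAct_inv_affAct, affEval_affNeg]
      exact neg_lt_zero.2 (affEval_pos_of_isPosAff (isPosAff_simpleAff i) hy)
    · rw [e, affAct_affNeg, mul_inv_rev, simpleRefl_inv, affAct_mul, affAct_inv_affAct,
        affAct_simpleRefl_self, affNeg_affNeg]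
      exact affEval_pos_of_isPosAff (isPosAff_simpleAff i) hy

lemma exists_forall_isPosAff_transl (a : ι × ℤ) :
    ∃ N₀ : ℕ, ∀ N ≥ N₀, (IsPosAff b (affAct R (transl R (N • sumFund b)) a) ↔ ¬ b.IsPos a.1) := by
  refine ⟨a.2.natAbs + 1, fun N hN => ?_⟩
  rw [affAct_transl, coweightPairing_nsmul]
  have hN' : (a.2.natAbs : ℤ) + 1 ≤ N := by exact_mod_cast hN
  by_cases h : b.IsPos a.1
  · have h1 := coweightPairing_sumFund_pos h
    have h2 : a.2 < N * coweightPairing R (sumFund b) a.1 := by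
      nlinarith [Int.le_natAbs (a := a.2)]
    refine iff_of_false ?_ (not_not.2 h)
    rintro (h3 | ⟨h3, -⟩) <;> simp only at h3 <;> lia
  · have h1 := coweightPairing_sumFund_neg h
    refine iff_of_true (Or.inl ?_) h
    have : -a.2 ≤ a.2.natAbs := by lia
    simp only
    nlinarith

open Classical in
-- Once the walk is pushed far into the dominant direction, positive crossings are exactly the
-- length-increasing steps. So T_{s_i} and its inverse are each applied where they give no
-- correction term.
lemma T_mul_walkProd (x : ExtWeyl R) (L : List (Option b.support)) :
    ∃ N₀ : ℕ, ∀ N ≥ N₀, T b q (transl R (N • sumFund b) * x) * walkProd b q x L =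
      T b q (transl R (N • sumFund b) * (x * (L.map (simpleRefl b)).prod)) := by
  induction L generalizing x with
  | nil => exact ⟨0, fun N _ => by simp [walkProd]⟩
  | cons i L ih =>
    obtain ⟨N₁, h1⟩ := ih (x * simpleRefl b i)
    obtain ⟨N₂, h2⟩ := exists_forall_isPosAff_transl (b := b) (affAct R x (simpleAff b i))
    refine ⟨max N₁ N₂, fun N hN => ?_⟩
    have h2' := h2 N (le_of_max_le_right hN)
    rw [← affAct_mul, ← isPositiveCrossing_iff] at h2'
    have key : T b q (transl R (N • sumFund b) * x) *
        (if IsPositiveCrossing b x i then T b q (simpleRefl b i)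
          else Ring.inverse (T b q (simpleRefl b i))) =
        T b q (transl R (N • sumFund b) * (x * simpleRefl b i)) := by
      by_cases hp : IsPositiveCrossing b x i
      · rw [if_pos hp, T_mul_simpleRefl (h2'.2 hp), mul_assoc]
      · rw [if_neg hp, ringInverse_T_simpleRefl, T_mul_inv_simpleUnit (fun h => hp (h2'.1 h)),
          mul_assoc]
    rw [walkProd, ← mul_assoc, key, h1 N (le_of_max_le_left hN), List.map_cons, List.prod_cons]
    simp only [mul_assoc]

lemma IsAlcoveElement.exists_T_mul {v : ExtWeyl R} {h : Hecke b q}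
    (hh : IsAlcoveElement b q v h) :
    ∃ N₀ : ℕ, ∀ N ≥ N₀, T b q (transl R (N • sumFund b)) * h =
      T b q (transl R (N • sumFund b) * v) := by
  obtain ⟨L, γ, ⟨hγ, rfl⟩, rfl⟩ := hh
  obtain ⟨N₀, h0⟩ := T_mul_walkProd (q := q) 1 L
  refine ⟨N₀, fun N hN => ?_⟩
  have := h0 N hN
  rw [mul_one, one_mul] at this
  rw [← mul_assoc, this, T_mul_of_length_eq_zero _ hγ, mul_assoc]

/-- Any two candidates become equal after multiplication by one and the same invertible T of a
sufficiently dominant translation. -/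
theorem isAlcoveElement_iff (v : ExtWeyl R) (h : Hecke b q) :
    IsAlcoveElement b q v h ↔ h = alcoveElt b q v := by
  have hex : IsAlcoveElement b q v (alcoveElt b q v) := by
    obtain ⟨L, γ, h1, -⟩ := exists_reduced_expression (b := b) v
    exact Classical.epsilon_spec (p := IsAlcoveElement b q v) ⟨_, L, γ, h1, rfl⟩
  refine ⟨fun hh => ?_, fun hh => hh ▸ hex⟩
  obtain ⟨N₁, h1⟩ := hh.exists_T_mul
  obtain ⟨N₂, h2⟩ := hex.exists_T_mul
  refine (isUnit_T (transl R (max N₁ N₂ • sumFund b))).mul_left_cancel ?_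
  rw [h1 _ (le_max_left _ _), h2 _ (le_max_right _ _)]

/-! ### The elements `x^μ` -/

/-- This is the description x^μ = T_{t_ν}⁻¹ T_{t_{ν+μ}}. Walks give it for large multiples of
`sumFund`, and commutation of dominant translations carries it over to every admissible ν. -/
lemma T_transl_mul_xPow {μ ν : coweightLattice R} (hν : IsDominant b ν)
    (hμν : IsDominant b (ν + μ)) :
    T b q (transl R ν) * xPow b q μ = T b q (transl R (ν + μ)) := by
  obtain ⟨N₀, h0⟩ := ((isAlcoveElement_iff (q := q) (transl R μ) _).2 rfl).exists_T_mul
  obtain ⟨N₁, hN₁⟩ : ∃ N₁ : ℕ, ∀ j ∈ b.support, (coweightPairing R μ j).natAbs ≤ N₁ :=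
    ⟨b.support.sup fun j => (coweightPairing R μ j).natAbs, fun j hj =>
      Finset.le_sup (f := fun j => (coweightPairing R μ j).natAbs) hj⟩
  set δ := max N₀ N₁ • sumFund b with hδ
  have h1 : T b q (transl R δ) * xPow b q μ = T b q (transl R (δ + μ)) := by
    rw [transl_add]
    exact h0 _ (le_max_left _ _)
  have hδdom : IsDominant b δ := fun j hj => by
    rw [hδ, coweightPairing_nsmul, coweightPairing_sumFund hj, mul_one]
    positivity
  have hδμ : IsDominant b (δ + μ) := fun j hj => by
    rw [coweightPairing_add, hδ, coweightPairing_nsmul, coweightPairing_sumFund hj, mul_one]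
    have h2 := hN₁ j hj
    have h3 := le_max_right N₀ N₁
    lia
  refine (isUnit_T (transl R δ)).mul_left_cancel ?_
  rw [← mul_assoc, T_transl_comm hδdom hν, mul_assoc, h1, T_transl_mul hν hδμ,
    T_transl_mul hδdom hμν]
  congr 2
  abel

lemma xPow_of_isDominant {μ : coweightLattice R} (hμ : IsDominant b μ) :
    xPow b q μ = T b q (transl R μ) := by
  have := T_transl_mul_xPow (q := q) isDominant_zero (ν := 0) (μ := μ) (by rwa [zero_add])
  rwa [transl_zero, T_one, one_mul, zero_add] at this

lemma xPow_mul_T_transl (μ : coweightLattice R) {ν : coweightLattice R} (hν : IsDominant b ν) :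
    xPow b q μ * T b q (transl R ν) = T b q (transl R ν) * xPow b q μ := by
  obtain ⟨ν', -, h1, h2⟩ := exists_isDominant_add (b := b) μ
  refine (isUnit_T (transl R ν')).mul_left_cancel ?_
  rw [← mul_assoc, ← mul_assoc, T_transl_mul_xPow h1 h2, T_transl_comm h1 hν, mul_assoc,
    T_transl_mul_xPow h1 h2, T_transl_comm hν h2]

lemma xPow_add (μ ν : coweightLattice R) :
    xPow b q (μ + ν) = xPow b q μ * xPow b q ν := by
  obtain ⟨μ', -, h1, h2⟩ := exists_isDominant_add (b := b) μ
  obtain ⟨ν', -, h3, h4⟩ := exists_isDominant_add (b := b) ν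
  refine ((isUnit_T (transl R μ')).mul (isUnit_T (transl R ν'))).mul_left_cancel ?_
  have he : μ' + ν' + (μ + ν) = (μ' + μ) + (ν' + ν) := by abel
  rw [T_transl_mul h1 h3, T_transl_mul_xPow (h1.add h3) (by rw [he]; exact h2.add h4), he,
    ← T_transl_mul h2 h4, ← T_transl_mul h1 h3, ← T_transl_mul_xPow h1 h2,
    ← T_transl_mul_xPow h3 h4]
  simp only [mul_assoc]
  rw [← mul_assoc (xPow b q μ), xPow_mul_T_transl μ h3]
  simp only [mul_assoc]

/-! ### The Bernstein relations -/

variable (R) in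
/-- The coroot `α^∨` as an element of the coweight lattice. -/
def corootP (i : ι) : coweightLattice R := ⟨R.coroot i, coroot_mem R i⟩

lemma coweightPairing_corootP_self (i : ι) : coweightPairing R (corootP R i) i = 2 :=
  coweightPairing_eq (by simp [corootP])

lemma weylAct_rootRefl (i : ι) (μ : coweightLattice R) :
    weylAct R (rootRefl R i) μ = μ - coweightPairing R μ i • corootP R i := by
  apply Subtype.ext
  change R.coreflection i μ = _
  rw [R.coreflection_apply, coweightPairing_spec, AddSubgroup.coe_sub, AddSubgroup.coe_zsmul,
    corootP, Int.cast_smul_eq_zsmul]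

lemma affAct_transl_simpleAff (μ : coweightLattice R) (i : b.support) :
    affAct R (transl R μ) (simpleAff b (some i)) = ((i : ι), -coweightPairing R μ i) := by
  rw [affAct_transl, simpleAff, zero_sub]

lemma simpleRefl_mul_transl (μ : coweightLattice R) (i : b.support) :
    simpleRefl b (some i) * transl R μ =
      transl R (μ - coweightPairing R μ i • corootP R i) * simpleRefl b (some i) := by
  rw [simpleRefl_some, ofWeyl_mul_transl, weylAct_rootRefl]

lemma T_simpleRefl_comm_T_transl {μ : coweightLattice R} {i : b.support}
    (h : coweightPairing R μ i = 0) :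
    T b q (simpleRefl b (some i)) * T b q (transl R μ) =
      T b q (transl R μ) * T b q (simpleRefl b (some i)) := by
  have hpos : IsPosAff b ((i : ι), (0 : ℤ)) := isPosAff_simpleAff (some i)
  rw [T_simpleRefl_mul, T_mul_simpleRefl, simpleRefl_mul_transl, h, zero_smul, sub_zero]
  · rw [affAct_transl_simpleAff, h]; exact hpos
  · rw [← transl_neg, affAct_transl_simpleAff, coweightPairing_neg, h]; exact hpos

lemma T_simpleRefl_comm_xPow {μ : coweightLattice R} {i : b.support}
    (h : coweightPairing R μ i = 0) :
    T b q (simpleRefl b (some i)) * xPow b q μ = xPow b q μ * T b q (simpleRefl b (some i)) := by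
  obtain ⟨ν, hν, h1, h2⟩ := exists_isDominant_add (b := b) μ
  have hν0 : coweightPairing R ν i = 0 := by rw [hν i i.2, h, abs_zero]
  refine (isUnit_T (transl R ν)).mul_left_cancel ?_
  rw [← mul_assoc, ← T_simpleRefl_comm_T_transl hν0, mul_assoc, T_transl_mul_xPow h1 h2,
    ← mul_assoc, T_transl_mul_xPow h1 h2, T_simpleRefl_comm_T_transl]
  rw [coweightPairing_add, hν0, h, add_zero]

/-- With s = s_i, one has t_{ν + sμ} = (t_ν s)(t_μ s) with lengths adding, and each factor is
T_{t_ν} T_s⁻¹ or T_{t_μ} T_s⁻¹. Cancelling T_{t_ν} gives x^{sμ} = T_s⁻¹ T_{t_μ} T_s⁻¹. -/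
lemma xPow_sub_corootP_of_isDominant {μ : coweightLattice R} (hμ : IsDominant b μ) {i : b.support}
    (h : coweightPairing R μ i = 1) :
    T b q (simpleRefl b (some i)) * xPow b q (μ - corootP R i) * T b q (simpleRefl b (some i)) =
      xPow b q μ := by
  obtain ⟨ν, hν, h1, h2⟩ := exists_isDominant_add (b := b) (μ - corootP R i)
  have hν1 : coweightPairing R ν i = 1 := by
    rw [hν i i.2, coweightPairing_sub, h, coweightPairing_corootP_self]; rfl
  have hneg : ¬ IsPosAff b ((i : ι), (-1 : ℤ)) := by
    rintro (h' | ⟨h', -⟩) <;> simp at h'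
  set s := simpleRefl b (some i) with hs
  set u := simpleUnit q (some i) with hu
  have hμs : T b q (transl R μ) * (u⁻¹ : (Hecke b q)ˣ) = T b q (transl R μ * s) :=
    T_mul_inv_simpleUnit (by rw [affAct_transl_simpleAff, h]; exact hneg)
  have hνs : T b q (transl R ν) * (u⁻¹ : (Hecke b q)ˣ) = T b q (transl R ν * s) :=
    T_mul_inv_simpleUnit (by rw [affAct_transl_simpleAff, hν1]; exact hneg)
  have hprod : T b q (transl R ν * s) * T b q (transl R μ * s) =
      T b q (transl R (ν + (μ - corootP R i))) := by
    rw [T_mul]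
    · congr 1
      rw [mul_assoc, ← mul_assoc s, hs, simpleRefl_mul_transl, mul_simpleRefl_mul_simpleRefl, h,
        one_smul, ← transl_add]
    · refine length_mul_of_forall fun a ha => ?_
      have hp : IsPosAff b (affAct R (transl R μ * s) (simpleAff b (some i))) :=
        isPosAff_mul_simpleRefl.2 (by rw [affAct_transl_simpleAff, h]; exact hneg)
      have hset := invSet_mul_simpleRefl hp
      rw [hs, mul_simpleRefl_mul_simpleRefl] at hset
      obtain ⟨e1, e2, e3⟩ := mem_invSet_transl hμ (by rw [hset]; exact Set.mem_insert_of_mem _ ha)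
      -- An inversion of t_μ with gradient -α_i has level exactly 1, as ⟨μ, α_i⟩ = 1; it is the one
      -- that right multiplication by s_i removes. The remaining gradients stay negative under s_i,
      -- so t_ν raises their levels.
      have hne : R.reflectionPerm a.1 a.1 ≠ i := by
        intro hai
        have ha1 : a.1 = R.reflectionPerm i i := by
          rw [← R.root_eq_neg_iff, ← hai, R.root_reflectionPerm, R.reflection_apply_self, neg_neg]
        rw [ha1, coweightPairing_reflectionPerm_self, h] at e3
        have ha2 : a = affNeg R ((i : ι), -1) := Prod.ext ha1 (by simp only [affNeg]; lia)
        refine ha.2 ?_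
        rw [mul_inv_rev, simpleRefl_inv, affAct_mul, ha2, ← h, ← affAct_transl_simpleAff,
          affAct_affNeg, affAct_inv_affAct, affAct_affNeg, affAct_simpleRefl_self, affNeg_affNeg]
        exact isPosAff_simpleAff _
      have e4 := ((isPos_reflectionPerm_self b).2 e1).reflectionPerm i.2 hne
      rw [← weylPerm_rootRefl, weylPerm_reflectionPerm_self, isPos_reflectionPerm_self] at e4
      rw [affAct_mul, hs, simpleRefl_some, affAct_ofWeyl, affAct_transl]
      have e5 := h1.nonpos e4
      exact Or.inl (by simp only; lia)
  have hx : xPow b q (μ - corootP R i) = (u⁻¹ : (Hecke b q)ˣ) * T b q (transl R μ) *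
      (u⁻¹ : (Hecke b q)ˣ) := by
    refine (isUnit_T (transl R ν)).mul_left_cancel ?_
    rw [T_transl_mul_xPow h1 h2, ← hprod, ← hμs, ← hνs]
    simp only [mul_assoc]
  rw [hx, xPow_of_isDominant hμ]
  change (u : Hecke b q) * _ * (u : Hecke b q) = _
  rw [mul_assoc (u⁻¹ : (Hecke b q)ˣ).val, Units.mul_inv_cancel_left, Units.inv_mul_cancel_right]

/-- Translating by some ν orthogonal to α_i makes the coweight dominant, and x^{-ν} commutes with
T_{s_i}. Inverting one factor T_{s_i} gives the relation. -/
lemma T_simpleRefl_mul_xPow_of_eq_one {μ : coweightLattice R} {i : b.support}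
    (h : coweightPairing R μ i = 1) :
    T b q (simpleRefl b (some i)) * xPow b q μ =
      xPow b q (μ - corootP R i) * T b q (simpleRefl b (some i)) +
        quadCoeff q (some i) • xPow b q μ := by
  classical
  obtain ⟨ν, hν⟩ := exists_coweightPairing_eq b fun j =>
    if j = i then 0 else |coweightPairing R μ j|
  have hν0 : coweightPairing R ν i = 0 := by rw [hν i i.2, if_pos rfl]
  have hdom : IsDominant b (ν + μ) := fun j hj => by
    rw [coweightPairing_add, hν j hj]
    split_ifs with hj'
    · rw [hj', h]; simp
    · linarith [neg_abs_le (coweightPairing R μ j)]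
  have h1 := xPow_sub_corootP_of_isDominant (q := q) hdom (i := i)
    (by rw [coweightPairing_add, hν0, h, zero_add])
  have hneg : coweightPairing R (-ν) i = 0 := by rw [coweightPairing_neg, hν0, neg_zero]
  have h2 : T b q (simpleRefl b (some i)) * xPow b q (μ - corootP R i) *
      T b q (simpleRefl b (some i)) = xPow b q μ := by
    have e1 : μ - corootP R i = (ν + μ - corootP R i) + -ν := by abel
    have e2 : xPow b q μ = xPow b q (ν + μ) * xPow b q (-ν) := by
      rw [← xPow_add]; congr 1; abel
    rw [e2, ← h1, e1, xPow_add]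
    simp only [mul_assoc]
    rw [T_simpleRefl_comm_xPow hneg]
  have h3 : xPow b q (μ - corootP R i) * T b q (simpleRefl b (some i)) =
      ((simpleUnit q (some i))⁻¹ : (Hecke b q)ˣ) * xPow b q μ := by
    rw [← h2, mul_assoc (T b q _)]
    exact ((simpleUnit q (some i)).inv_mul_cancel_left _).symm
  rw [h3, val_inv_simpleUnit, sub_mul, Algebra.smul_def, sub_add_cancel]

/-- The Bernstein relation. -/
theorem T_simpleRefl_mul_xPow {i : b.support} {m : ℕ} {μ : coweightLattice R}
    (h : coweightPairing R μ i = m) :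
    T b q (simpleRefl b (some i)) * xPow b q μ =
      xPow b q (μ - m • corootP R i) * T b q (simpleRefl b (some i)) +
        quadCoeff q (some i) • ∑ j ∈ Finset.range m, xPow b q (μ - j • corootP R i) := by
  induction m generalizing μ with
  | zero =>
    rw [Finset.sum_range_zero, smul_zero, add_zero, zero_smul, sub_zero]
    exact T_simpleRefl_comm_xPow (by simpa using h)
  | succ m ih =>
    -- The full coweight lattice contains an element pairing to 1 with α_i; peeling it off lowers m
    -- by one and leaves only the parameter q_i in the formula.
    obtain ⟨ν, hν⟩ := exists_coweightPairing_eq b fun _ => 1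
    have hν1 := hν i i.2
    have h1 := ih (μ := μ - ν) (by rw [coweightPairing_sub, h, hν1]; push_cast; ring)
    have h2 := T_simpleRefl_mul_xPow_of_eq_one (q := q) hν1
    have e1 : ∀ j : ℕ, xPow b q (μ - ν - j • corootP R i) * xPow b q ν =
        xPow b q (μ - j • corootP R i) := fun j => by
      rw [← xPow_add]; congr 1; abel
    have e2 : xPow b q (μ - ν - m • corootP R i) * xPow b q (ν - corootP R i) =
        xPow b q (μ - (m + 1) • corootP R i) := by
      rw [← xPow_add]; congr 1; rw [succ_nsmul]; abel
    have e3 : xPow b q μ = xPow b q (μ - ν) * xPow b q ν := by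
      rw [← xPow_add]; congr 1; abel
    rw [e3, ← mul_assoc, h1, add_mul, mul_assoc, h2, mul_add, ← mul_assoc, e2, smul_mul_assoc,
      Finset.sum_mul, Finset.sum_congr rfl fun j _ => e1 j, mul_smul_comm, e1,
      Finset.sum_range_succ, smul_add]
    abel

end AlcoveWalks

end

end AffineHecke

namespace AffineHecke

noncomputable section

open MeasureTheory

set_option linter.unusedSectionVars false

/-! ### A recursion on the coweight lattice and its uniqueness -/

section Recursion

variable {ι V E : Type*} [AddCommGroup V] [Module ℝ V] [AddCommGroup E] [Module ℝ E]
variable {R : RootPairing ι ℝ V E} {b : R.Base} [Fintype ι] [Nonempty ι]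
variable [R.IsCrystallographic] [R.IsReduced] [R.IsIrreducible]
variable {q : Option b.support → ℝ}

/-! ### Sums over the positive roots -/

open Classical in
variable (b) in
/-- The set of positive roots. -/
def posRoots : Finset ι := Finset.univ.filter fun α => b.IsPos α

lemma mem_posRoots {α : ι} : α ∈ posRoots b ↔ b.IsPos α := by simp [posRoots]

lemma reflectionPerm_mem_posRoots_erase [DecidableEq ι] {i : ι} (hi : i ∈ b.support) {α : ι}
    (hα : α ∈ (posRoots b).erase i) : R.reflectionPerm i α ∈ (posRoots b).erase i := by
  rw [Finset.mem_erase, mem_posRoots] at hα ⊢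
  refine ⟨fun h => ?_, hα.2.reflectionPerm hi hα.1⟩
  have h2 := hα.2
  rw [← R.reflectionPerm_self i α, h, isPos_reflectionPerm_self] at h2
  exact h2 (RootPairing.Base.isPos_of_mem_support hi)

lemma prod_posRoots_erase {M : Type*} [CommMonoid M] [DecidableEq ι] {i : ι} (hi : i ∈ b.support)
    (f : ι → M) : ∏ α ∈ (posRoots b).erase i, f (R.reflectionPerm i α) =
      ∏ α ∈ (posRoots b).erase i, f α :=
  Finset.prod_nbij' (R.reflectionPerm i) (R.reflectionPerm i)
    (fun _ => reflectionPerm_mem_posRoots_erase hi) (fun _ => reflectionPerm_mem_posRoots_erase hi)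
    (fun α _ => R.reflectionPerm_self i α) (fun α _ => R.reflectionPerm_self i α) fun _ _ => rfl

/-- A sum of a function odd under the simple reflection `s_i`. -/
lemma sum_posRoots_of_odd {i : ι} (hi : i ∈ b.support) {f : ι → ℝ}
    (hf : ∀ α, f (R.reflectionPerm i α) = -f α) : ∑ α ∈ posRoots b, f α = f i := by
  classical
  rw [← Finset.add_sum_erase _ _ (mem_posRoots.2 (RootPairing.Base.isPos_of_mem_support hi))]
  have h : ∑ α ∈ (posRoots b).erase i, f α = ∑ α ∈ (posRoots b).erase i, f (R.reflectionPerm i α) :=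
    Finset.sum_nbij' (R.reflectionPerm i) (R.reflectionPerm i)
      (fun _ => reflectionPerm_mem_posRoots_erase hi)
      (fun _ => reflectionPerm_mem_posRoots_erase hi)
      (fun α _ => R.reflectionPerm_self i α) (fun α _ => R.reflectionPerm_self i α)
      fun α _ => by rw [R.reflectionPerm_self]
  simp_rw [hf, Finset.sum_neg_distrib] at h
  linarith

lemma sum_posRoots_root'_coroot {i : ι} (hi : i ∈ b.support) :
    ∑ α ∈ posRoots b, R.root' α (R.coroot i) = 2 := by
  rw [sum_posRoots_of_odd (R := R) hi (f := fun α => R.root' α (R.coroot i)) fun α => ?_]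
  · simp
  · have := root'_reflectionPerm_coreflection (R := R) i α (R.coroot (R.reflectionPerm i i))
    rw [← R.coroot_reflectionPerm, R.reflectionPerm_self, R.coroot_reflectionPerm,
      R.coreflection_apply_self, map_neg] at this
    exact this

/-! ### Functions on the coweight lattice determined by the values at dominant coweights -/

/-- The invariant quadratic form on the coweight lattice. -/
def normP (μ : coweightLattice R) : ℤ := ∑ α, coweightPairing R μ α ^ 2

variable (b) in
/-- The pairing with the sum of the positive roots. -/
def heightP (μ : coweightLattice R) : ℤ := ∑ α ∈ posRoots b, coweightPairing R μ α

/-- Integrality gives k ≤ k², so the difference of the two is a non-negative integer and can serve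
as an induction measure. -/
lemma heightP_le_normP (μ : coweightLattice R) : heightP b μ ≤ normP μ := by
  calc heightP b μ ≤ ∑ α ∈ posRoots b, coweightPairing R μ α ^ 2 :=
        Finset.sum_le_sum fun α _ => Int.le_self_sq _
    _ ≤ normP μ := Finset.sum_le_sum_of_subset_of_nonneg (Finset.subset_univ _)
        fun α _ _ => sq_nonneg _

lemma heightP_corootP {i : ι} (hi : i ∈ b.support) : heightP b (corootP R i) = 2 := by
  have : ((heightP b (corootP R i) : ℤ) : ℝ) = 2 := by
    rw [heightP, ← sum_posRoots_root'_coroot hi]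
    push_cast
    refine Finset.sum_congr rfl fun α _ => ?_
    rw [← coweightPairing_spec]
    rfl
  exact_mod_cast this

lemma heightP_sub_nsmul (μ : coweightLattice R) {i : ι} (hi : i ∈ b.support) (j : ℕ) :
    heightP b (μ - j • corootP R i) = heightP b μ - 2 * j := by
  rw [← heightP_corootP hi, heightP, heightP, heightP, Finset.sum_mul, ← Finset.sum_sub_distrib]
  refine Finset.sum_congr rfl fun α _ => ?_
  rw [coweightPairing_sub, coweightPairing_nsmul]
  ring

lemma coweightPairing_weylAct (w : weylGroup R) (μ : coweightLattice R) (α : ι) :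
    coweightPairing R (weylAct R w μ) (weylPerm R w α) = coweightPairing R μ α :=
  coweightPairing_eq (by rw [← coweightPairing_spec]; exact root'_weylPerm w α _)

lemma normP_weylAct (w : weylGroup R) (μ : coweightLattice R) :
    normP (weylAct R w μ) = normP μ := by
  rw [normP, normP, ← Equiv.sum_comp (weylPerm R w)]
  exact Finset.sum_congr rfl fun α _ => by rw [coweightPairing_weylAct]

/-- As a quadratic polynomial in j the norm takes the same value at j = 0 and at j = m, by
reflection invariance; this fixes its linear coefficient. -/
lemma normP_sub_nsmul {μ : coweightLattice R} {i : ι} {m : ℕ} (h : coweightPairing R μ i = m)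
    (j : ℕ) : normP (μ - j • corootP R i) = normP μ - j * (m - j) * normP (corootP R i) := by
  have key : ∀ k : ℕ, normP (μ - k • corootP R i) = normP μ -
      k * (2 * ∑ α, coweightPairing R μ α * coweightPairing R (corootP R i) α) +
        k ^ 2 * normP (corootP R i) := fun k => by
    simp only [normP, Finset.mul_sum, ← Finset.sum_sub_distrib, ← Finset.sum_add_distrib]
    refine Finset.sum_congr rfl fun α _ => ?_
    rw [coweightPairing_sub, coweightPairing_nsmul]
    ring
  have hm := key m
  have hrefl := normP_weylAct (rootRefl R i) μ
  rw [weylAct_rootRefl, h, natCast_zsmul] at hrefl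
  rw [hrefl] at hm
  rw [key j]
  -- For m = 0 the two values coincide trivially; orthogonality comes instead from the reflection
  -- exchanging μ - α^∨ and μ + α^∨.
  rcases Nat.eq_zero_or_pos m with rfl | hm0
  · have h2 : 2 * ∑ α, coweightPairing R μ α * coweightPairing R (corootP R i) α = 0 := by
      have e1 := normP_weylAct (rootRefl R i) (μ - corootP R i)
      have e2 := key 1
      have e3 : normP (μ + corootP R i) = normP μ +
          (2 * ∑ α, coweightPairing R μ α * coweightPairing R (corootP R i) α) +
            normP (corootP R i) := by
        simp only [normP, Finset.mul_sum, ← Finset.sum_add_distrib]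
        refine Finset.sum_congr rfl fun α _ => ?_
        rw [coweightPairing_add]
        ring
      rw [weylAct_rootRefl, coweightPairing_sub, h, coweightPairing_corootP_self] at e1
      have e4 : μ - corootP R i - ((0 : ℕ) - 2 : ℤ) • corootP R i = μ + corootP R i := by
        push_cast
        module
      rw [e4, e3] at e1
      rw [one_smul] at e2
      push_cast at e2
      linarith
    rw [h2]
    push_cast
    ring
  · have h2 : 2 * ∑ α, coweightPairing R μ α * coweightPairing R (corootP R i) α =
        m * normP (corootP R i) := by
      have hm' : (m : ℤ) ≠ 0 := by positivity
      apply mul_left_cancel₀ hm'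
      linarith
    rw [h2]
    ring

lemma normP_corootP_pos (i : ι) : 0 < normP (corootP R i) :=
  Finset.sum_pos' (fun _ _ => sq_nonneg _) ⟨i, Finset.mem_univ _, by
    rw [coweightPairing_corootP_self]; norm_num⟩

lemma normP_nonneg (μ : coweightLattice R) : 0 ≤ normP μ := Finset.sum_nonneg fun _ _ => sq_nonneg _

variable (q) in
/-- The relations between values of a function on the coweight lattice that the Bernstein
relations impose on `μ ↦ Tr(x^μ 1_0)`. -/
def IsBernstein (g : coweightLattice R → ℂ) : Prop :=
  ∀ (i : b.support) (m : ℕ) (μ : coweightLattice R), coweightPairing R μ i = m →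
    ((√(q (some i)) : ℝ) : ℂ) * (g μ - g (μ - m • corootP R i)) =
      quadCoeff q (some i) * ∑ j ∈ Finset.range m, g (μ - j • corootP R i)

/-- For μ not dominant, reflect it to ν = s_i μ with positive pairing m. The relation at ν expresses
g(μ) through g(ν - jα_i^∨), 0 ≤ j < m: for j = 0 the norm is unchanged but the height grows, for j >
0 the norm drops. Hence the induction on norm and then on norm minus height. -/
lemma IsBernstein.eq_zero (hq : IsReducedParameterSystem b q) {g : coweightLattice R → ℂ}
    (hg : IsBernstein q g) (h0 : ∀ μ, IsDominant b μ → g μ = 0) (μ : coweightLattice R) :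
    g μ = 0 := by
  induction hN : (normP μ).toNat using Nat.strong_induction_on generalizing μ with
  | _ N ihN =>
    induction hH : (normP μ - heightP b μ).toNat using Nat.strong_induction_on generalizing μ with
    | _ H ihH =>
      by_cases hdom : IsDominant b μ
      · exact h0 μ hdom
      obtain ⟨i, hi, hneg⟩ : ∃ i ∈ b.support, coweightPairing R μ i < 0 := by
        simpa [IsDominant] using hdom
      obtain ⟨m, hm⟩ : ∃ m : ℕ, coweightPairing R μ i = -m :=
        ⟨(coweightPairing R μ i).natAbs, by lia⟩
      have hm0 : 0 < m := by lia
      set ν := μ + m • corootP R i with hν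
      have hνm : coweightPairing R ν i = m := by
        rw [hν, coweightPairing_add, coweightPairing_nsmul, coweightPairing_corootP_self, hm]
        ring
      have hμν : ν - m • corootP R i = μ := by rw [hν, add_sub_cancel_right]
      have hnorm := normP_sub_nsmul hνm
      have hnm := hnorm m
      rw [hμν, sub_self, mul_zero, zero_mul, sub_zero] at hnm
      have hheight : heightP b ν = heightP b μ + 2 * m := by
        have := heightP_sub_nsmul ν hi m
        rw [hμν] at this
        lia
      have hle := heightP_le_normP (b := b) ν
      have hvan : ∀ j < m, g (ν - j • corootP R i) = 0 := by
        intro j hj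
        rcases Nat.eq_zero_or_pos j with rfl | hj0
        · rw [zero_smul, sub_zero]
          refine ihH _ ?_ ν (by rw [← hnm, hN]) rfl
          lia
        · refine ihN _ ?_ _ rfl
          rw [hnorm j]
          have h1 : (0 : ℤ) < j * (m - j) * normP (corootP R i) := by
            have : (0 : ℤ) < m - j := by lia
            have := normP_corootP_pos (R := R) i
            positivity
          have h2 := normP_nonneg μ
          have h3 := normP_nonneg (ν - j • corootP R i)
          rw [hnorm j] at h3
          lia
      have h1 := hg ⟨i, hi⟩ m ν hνm
      rw [Finset.sum_eq_zero fun j hj => hvan j (Finset.mem_range.1 hj), mul_zero, hμν] at h1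
      have h2 := hvan 0 hm0
      rw [zero_smul, sub_zero] at h2
      rw [h2, zero_sub] at h1
      have h3 : ((√(q (some ⟨i, hi⟩)) : ℝ) : ℂ) ≠ 0 := by
        exact_mod_cast (Real.sqrt_pos.2 (zero_lt_one.trans (hq.one_lt _))).ne'
      exact neg_eq_zero.1 ((mul_eq_zero.1 h1).resolve_left h3)

lemma IsBernstein.eq (hq : IsReducedParameterSystem b q) {g g' : coweightLattice R → ℂ}
    (hg : IsBernstein q g) (hg' : IsBernstein q g') (h : ∀ μ, IsDominant b μ → g μ = g' μ) :
    g = g' := by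
  funext μ
  refine sub_eq_zero.1 (IsBernstein.eq_zero hq (g := fun μ => g μ - g' μ) ?_
    (fun μ hμ => sub_eq_zero.2 (h μ hμ)) μ)
  intro i m μ hm
  rw [Finset.sum_sub_distrib, mul_sub (quadCoeff q _), ← hg i m μ hm, ← hg' i m μ hm]
  ring

/-! ### The function `μ ↦ Tr(x^μ 1_0)` -/

/-- Tr(T_{s_i} x^μ 1_0) is computed twice: cyclically, with T_{s_i} acting on 1_0 from the right,
and by the Bernstein relation, with T_{s_i} acting on 1_0 from the left. -/
lemma isBernstein_trace (hq : IsReducedParameterSystem b q) :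
    IsBernstein q fun μ => trace b q (xPow b q μ * oneZero b q) := by
  intro i m μ hm
  have htr := isHeckeTrace_trace hq
  have h1 : trace b q (T b q (simpleRefl b (some i)) * (xPow b q μ * oneZero b q)) =
      ((√(q (some i)) : ℝ) : ℂ) * trace b q (xPow b q μ * oneZero b q) := by
    rw [htr.mul_comm, mul_assoc, oneZero_mul_T hq, mul_smul_comm, map_smul, smul_eq_mul]
  rw [← mul_assoc, T_simpleRefl_mul_xPow hm, add_mul, mul_assoc, T_mul_oneZero hq, mul_smul_comm,
    smul_mul_assoc, Finset.sum_mul, map_add, map_smul, map_smul, map_sum, smul_eq_mul,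
    smul_eq_mul] at h1
  rw [mul_sub, ← h1]
  ring

open Classical in
lemma trace_xPow_mul_oneZero_of_isDominant (hq : IsReducedParameterSystem b q)
    {μ : coweightLattice R} (hμ : IsDominant b μ) :
    trace b q (xPow b q μ * oneZero b q) = if μ = 0 then ((poincare b q : ℝ) : ℂ)⁻¹ else 0 := by
  classical
  have htr := isHeckeTrace_trace hq
  have hone : ∀ w : weylGroup R, transl R μ * ofWeyl R w = 1 → μ = 0 ∧ w = 1 := fun w h => by
    have h1 : w = 1 := by
      have := congrArg SemidirectProduct.right h
      simpa [transl, ofWeyl] using this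
    rw [h1, ofWeyl_one, mul_one, ← transl_zero] at h
    exact ⟨transl_injective h, h1⟩
  rw [xPow_of_isDominant hμ, oneZero, mul_smul_comm, map_smul, Finset.mul_sum, map_sum]
  simp_rw [mul_smul_comm, map_smul, htr.T_mul_T]
  split_ifs with h0
  · rw [Finset.sum_eq_single 1 (fun w _ hw => ?_) (by simp)]
    · rw [h0, transl_zero, ofWeyl_one, mul_one, if_pos rfl, qElt_one hq]
      simp
    · rw [if_neg fun h => hw (hone w h).2, smul_zero]
  · rw [Finset.sum_eq_zero fun w _ => ?_, smul_zero]
    rw [if_neg fun h => h0 (hone w h).1, smul_zero]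

end Recursion

end

end AffineHecke

namespace AffineHecke

noncomputable section

open MeasureTheory

set_option linter.unusedSectionVars false

/-! ### Characters of the torus and the moments of 1/c(t⁻¹) -/

section Torus

variable {ι V E : Type*} [AddCommGroup V] [Module ℝ V] [AddCommGroup E] [Module ℝ E]
variable {R : RootPairing ι ℝ V E} {b : R.Base} [Fintype ι] [Nonempty ι]
variable [R.IsCrystallographic] [R.IsReduced] [R.IsIrreducible]
variable {q : Option b.support → ℝ}

/-! ### Characters of the torus -/

variable (b) in
/-- The homomorphism `P → ℝ/ℤ` with coordinates `t`. -/
def torusEval (t : UnitAddTorus b.support) : coweightLattice R →+ UnitAddCircle :=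
  AddMonoidHom.mk' (fun μ => ∑ j : b.support, coweightPairing R μ j • t j) fun μ ν => by
    simp_rw [coweightPairing_add, add_smul, Finset.sum_add_distrib]

lemma torusEval_apply (t : UnitAddTorus b.support) (μ : coweightLattice R) :
    torusEval b t μ = ∑ j : b.support, coweightPairing R μ j • t j := rfl

lemma tPow_eq_toCircle (t : UnitAddTorus b.support) (μ : coweightLattice R) :
    tPow b t μ = AddCircle.toCircle (torusEval b t μ) := by
  classical
  have key : ∀ s : Finset b.support, ∏ j ∈ s, (fourier (coweightPairing R μ j) (t j) : ℂ) =
      AddCircle.toCircle (∑ j ∈ s, coweightPairing R μ j • t j) := fun s => by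
    induction s using Finset.induction_on with
    | empty => simp
    | insert a s ha ih =>
      rw [Finset.prod_insert ha, Finset.sum_insert ha, ih, AddCircle.toCircle_add, Circle.coe_mul,
        fourier_apply]
  exact key _

lemma tPow_add (t : UnitAddTorus b.support) (μ ν : coweightLattice R) :
    tPow b t (μ + ν) = tPow b t μ * tPow b t ν := by
  simp_rw [tPow_eq_toCircle, map_add, AddCircle.toCircle_add, Circle.coe_mul]

@[simp] lemma tPow_zero (t : UnitAddTorus b.support) : tPow b t (0 : coweightLattice R) = 1 := by
  simp [tPow_eq_toCircle]

lemma norm_tPow (t : UnitAddTorus b.support) (μ : coweightLattice R) : ‖tPow b t μ‖ = 1 := by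
  rw [tPow_eq_toCircle, Circle.norm_coe]

lemma tPow_ne_zero (t : UnitAddTorus b.support) (μ : coweightLattice R) : tPow b t μ ≠ 0 :=
  norm_ne_zero_iff.1 (by rw [norm_tPow]; exact one_ne_zero)

lemma tPow_neg (t : UnitAddTorus b.support) (μ : coweightLattice R) :
    tPow b t (-μ) = (tPow b t μ)⁻¹ :=
  eq_inv_of_mul_eq_one_left (by rw [← tPow_add, neg_add_cancel, tPow_zero])

lemma tPow_sub (t : UnitAddTorus b.support) (μ ν : coweightLattice R) :
    tPow b t (μ - ν) = tPow b t μ * (tPow b t ν)⁻¹ := by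
  rw [sub_eq_add_neg, tPow_add, tPow_neg]

lemma tPow_neg_left (t : UnitAddTorus b.support) (μ : coweightLattice R) :
    tPow b (-t) μ = (tPow b t μ)⁻¹ := by
  rw [← tPow_neg, tPow_eq_toCircle, tPow_eq_toCircle, map_neg]
  congr 2
  simp_rw [torusEval_apply, Pi.neg_apply, smul_neg, Finset.sum_neg_distrib]

lemma tPow_sum {κ : Type*} (t : UnitAddTorus b.support) (s : Finset κ)
    (f : κ → coweightLattice R) : tPow b t (∑ k ∈ s, f k) = ∏ k ∈ s, tPow b t (f k) := by
  classical
  induction s using Finset.induction_on with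
  | empty => simp
  | insert a s ha ih => rw [Finset.sum_insert ha, Finset.prod_insert ha, tPow_add, ih]

@[fun_prop] lemma continuous_tPow (μ : coweightLattice R) :
    Continuous fun t : UnitAddTorus b.support => tPow b t μ :=
  (UnitAddTorus.mFourier _).continuous

instance : IsProbabilityMeasure (torusHaar b) := by
  rw [torusHaar]; infer_instance

instance : (torusHaar b).IsAddHaarMeasure := by
  rw [torusHaar]; infer_instance

lemma integrable_torusHaar {f : UnitAddTorus b.support → ℂ} (hf : Continuous f) :
    Integrable f (torusHaar b) :=
  hf.integrable_of_hasCompactSupport (HasCompactSupport.of_compactSpace f)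

lemma integral_tPow {μ : coweightLattice R} (hμ : μ ≠ 0) : ∫ t, tPow b t μ ∂(torusHaar b) = 0 := by
  obtain ⟨j, hj⟩ : ∃ j : b.support, coweightPairing R μ j ≠ 0 := by
    by_contra! hc
    exact hμ (ext_coweightPairing_support (b := b) fun j hj => by
      rw [hc ⟨j, hj⟩, coweightPairing_zero])
  have h := integral_fintype_prod_eq_prod (𝕜 := ℂ)
    (fun (j : b.support) (x : UnitAddCircle) => fourier (coweightPairing R μ j) x)
    (μ := fun _ => AddCircle.haarAddCircle)
  refine h.trans (Finset.prod_eq_zero (Finset.mem_univ j) ?_)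
  exact integral_eq_zero_of_add_right_eq_neg (fourier_add_half_inv_index hj one_pos)

/-! ### The action of the Weyl group on the torus -/

open Classical in
lemma exists_fundCoweight (j : b.support) : ∃ μ : coweightLattice R, ∀ k : b.support,
    coweightPairing R μ k = if k = j then 1 else 0 := by
  obtain ⟨μ, hμ⟩ := exists_coweightPairing_eq b fun k => if k = (j : ι) then 1 else 0
  exact ⟨μ, fun k => by rw [hμ k k.2]; exact if_congr Subtype.ext_iff.symm rfl rfl⟩

variable (b) in
/-- The fundamental coweights. -/
def fundCoweight (j : b.support) : coweightLattice R := (exists_fundCoweight j).choose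

open Classical in
lemma coweightPairing_fundCoweight (j k : b.support) :
    coweightPairing R (fundCoweight b j) k = if k = j then 1 else 0 :=
  (exists_fundCoweight j).choose_spec k

lemma torusEval_fundCoweight (t : UnitAddTorus b.support) (j : b.support) :
    torusEval b t (fundCoweight b j) = t j := by
  rw [torusEval_apply, Finset.sum_eq_single j (fun k _ hk => ?_) (by simp),
    coweightPairing_fundCoweight, if_pos rfl, one_smul]
  rw [coweightPairing_fundCoweight, if_neg hk, zero_smul]

lemma sum_fundCoweight (μ : coweightLattice R) :
    ∑ j : b.support, coweightPairing R μ j • fundCoweight b j = μ := by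
  have hsum : ∀ (s : Finset b.support) (k : ι),
      coweightPairing R (∑ j ∈ s, coweightPairing R μ j • fundCoweight b j) k =
        ∑ j ∈ s, coweightPairing R μ j * coweightPairing R (fundCoweight b j) k := fun s k => by
    classical
    induction s using Finset.induction_on with
    | empty => simp [coweightPairing_zero]
    | insert a s ha ih =>
      rw [Finset.sum_insert ha, Finset.sum_insert ha, coweightPairing_add, coweightPairing_zsmul, ih]
  refine ext_coweightPairing_support (b := b) fun k hk => ?_
  rw [hsum, Finset.sum_eq_single ⟨k, hk⟩ (fun j _ hj => ?_) (by simp)]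
  · rw [coweightPairing_fundCoweight _ ⟨k, hk⟩, if_pos rfl, mul_one]
  · rw [coweightPairing_fundCoweight _ ⟨k, hk⟩, if_neg hj.symm, mul_zero]

variable (b) in
/-- The automorphism of the torus dual to the action of `w` on the coweight lattice. -/
def weylTorus (w : weylGroup R) : UnitAddTorus b.support →+ UnitAddTorus b.support :=
  AddMonoidHom.mk' (fun t j => torusEval b t (weylAct R w (fundCoweight b j))) fun t u => by
    funext j
    simp only [torusEval_apply, Pi.add_apply, smul_add, Finset.sum_add_distrib]

lemma torusEval_weylTorus (w : weylGroup R) (t : UnitAddTorus b.support) (μ : coweightLattice R) :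
    torusEval b (weylTorus b w t) μ = torusEval b t (weylAct R w μ) := by
  conv_rhs => rw [← sum_fundCoweight (b := b) μ]
  simp_rw [map_sum, map_zsmul]
  rfl

@[simp] lemma tPow_weylTorus (w : weylGroup R) (t : UnitAddTorus b.support)
    (μ : coweightLattice R) : tPow b (weylTorus b w t) μ = tPow b t (weylAct R w μ) := by
  rw [tPow_eq_toCircle, torusEval_weylTorus, tPow_eq_toCircle]

lemma continuous_weylTorus (w : weylGroup R) : Continuous (weylTorus b w) := by
  refine continuous_pi fun j => ?_
  change Continuous fun t => torusEval b t (weylAct R w (fundCoweight b j))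
  simp_rw [torusEval_apply]
  fun_prop

lemma weylTorus_surjective (w : weylGroup R) : Function.Surjective (weylTorus b w) := fun t => by
  refine ⟨weylTorus b w⁻¹ t, funext fun j => ?_⟩
  change torusEval b (weylTorus b w⁻¹ t) (weylAct R w (fundCoweight b j)) = t j
  have h : weylAct R w⁻¹ (weylAct R w (fundCoweight b j)) = fundCoweight b j :=
    Subtype.ext (w.1.symm_apply_apply _)
  rw [torusEval_weylTorus, h, torusEval_fundCoweight]

lemma measurePreserving_weylTorus (w : weylGroup R) :
    MeasurePreserving (weylTorus b w) (torusHaar b) (torusHaar b) :=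
  AddMonoidHom.measurePreserving (continuous_weylTorus w) (weylTorus_surjective w) rfl

lemma integral_weylTorus (w : weylGroup R) {f : UnitAddTorus b.support → ℂ} (hf : Continuous f) :
    ∫ t, f (weylTorus b w t) ∂(torusHaar b) = ∫ t, f t ∂(torusHaar b) := by
  have h := measurePreserving_weylTorus (b := b) w
  conv_rhs => rw [← h.map_eq]
  rw [integral_map h.measurable.aemeasurable hf.aestronglyMeasurable]

/-! ### The parameters `q_α` -/

lemma exists_weylPerm_eq (b : R.Base) (α : ι) :
    ∃ (i : b.support) (w : weylGroup R), weylPerm R w i = α := by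
  refine b.induction_reflect α (p := fun α => ∃ (i : b.support) (w : weylGroup R),
    weylPerm R w i = α) ?_ ?_ ?_
  · rintro _ ⟨i, w, rfl⟩
    exact ⟨i, w * rootRefl R i, by
      rw [map_mul, Equiv.Perm.mul_apply, weylPerm_rootRefl, weylPerm_reflectionPerm_self]⟩
  · exact fun i hi => ⟨⟨i, hi⟩, 1, by rw [map_one, Equiv.Perm.one_apply]⟩
  · rintro _ j ⟨i, w, rfl⟩ -
    exact ⟨i, rootRefl R j * w, by rw [map_mul, Equiv.Perm.mul_apply, weylPerm_rootRefl]⟩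

lemma qRoot_eq_qAff (hq : IsReducedParameterSystem b q) (α : ι) : qRoot b q α = qAff q (α, 0) := by
  obtain ⟨i, w, hw, hr⟩ : ∃ i : b.support, ∃ w : weylGroup R,
      w.1 (R.coroot i) = R.coroot α ∧ qRoot b q α = q (some i) := by
    have hex : ∃ r, ∃ i : b.support, (∃ w : weylGroup R, w.1 (R.coroot i) = R.coroot α) ∧
        r = q (some i) := by
      obtain ⟨i, w, rfl⟩ := exists_weylPerm_eq b α
      exact ⟨_, i, ⟨w, (coroot_weylPerm w i).symm⟩, rfl⟩
    obtain ⟨i, ⟨w, hw⟩, h⟩ := Classical.epsilon_spec hex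
    exact ⟨i, w, hw, h⟩
  have hα : α = weylPerm R w i := R.coroot.injective (by rw [coroot_weylPerm, hw])
  rw [hr, hα, ← qAff_affAct hq (ofWeyl R w) (some i), affAct_ofWeyl]
  rfl

lemma qRoot_weylPerm (hq : IsReducedParameterSystem b q) (w : weylGroup R) (α : ι) :
    qRoot b q (weylPerm R w α) = qRoot b q α := by
  rw [qRoot_eq_qAff hq, qRoot_eq_qAff hq, ← qAff_affAct' hq (ofWeyl R w) (α, 0), affAct_ofWeyl]

lemma qRoot_coe (hq : IsReducedParameterSystem b q) (i : b.support) :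
    qRoot b q i = q (some i) := by
  rw [qRoot_eq_qAff hq, ← qAff_affAct hq 1 (some i), map_one]
  rfl

lemma one_lt_qRoot (hq : IsReducedParameterSystem b q) (α : ι) : 1 < qRoot b q α := by
  obtain ⟨i, w, rfl⟩ := exists_weylPerm_eq b α
  rw [qRoot_weylPerm hq, qRoot_coe hq]
  exact hq.one_lt _

/-! ### The `c`-function -/

variable (b q) in
/-- The denominators of the factors of `c(t⁻¹)⁻¹`. -/
def rootDenom (α : ι) (t : UnitAddTorus b.support) : ℂ :=
  1 - ((qRoot b q α : ℝ) : ℂ)⁻¹ * tPow b t (corootP R α)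

variable (b q) in
/-- The factors of `c(t⁻¹)⁻¹`. -/
def rootFactor (α : ι) (t : UnitAddTorus b.support) : ℂ :=
  (1 - tPow b t (corootP R α)) / rootDenom b q α t

lemma rootDenom_ne_zero (hq : IsReducedParameterSystem b q) (α : ι)
    (t : UnitAddTorus b.support) : rootDenom b q α t ≠ 0 := by
  intro h
  have h1 := congrArg norm (sub_eq_zero.1 h)
  have h2 := one_lt_qRoot hq α
  rw [norm_mul, norm_tPow, mul_one, norm_inv, norm_one, Complex.norm_real, Real.norm_eq_abs,
    abs_of_pos (zero_lt_one.trans h2)] at h1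
  exact h2.ne' (inv_eq_one.1 h1.symm)

@[fun_prop] lemma continuous_rootDenom (α : ι) : Continuous (rootDenom b q α) := by
  unfold rootDenom
  fun_prop

lemma continuous_rootFactor (hq : IsReducedParameterSystem b q) (α : ι) :
    Continuous (rootFactor b q α) := by
  unfold rootFactor
  exact (by fun_prop : Continuous fun t => 1 - tPow b t (corootP R α)).div (by fun_prop)
    (rootDenom_ne_zero hq α)

/-- The identity holds at every t: where t^{α^∨} = 1, the quotient in `cFun` is 0 by convention, and
so is the corresponding factor on the right. Hence the reciprocal is a continuous function and
integrability is automatic on the compact torus. -/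
lemma inv_cFun_neg (t : UnitAddTorus b.support) :
    (cFun b q (-t))⁻¹ = ∏ α ∈ posRoots b, rootFactor b q α t := by
  rw [cFun, posRoots, ← Finset.prod_inv_distrib]
  refine Finset.prod_congr rfl fun α _ => ?_
  rw [inv_div, tPow_neg, tPow_neg_left, inv_inv]
  rfl

lemma inv_cFun (t : UnitAddTorus b.support) :
    (cFun b q t)⁻¹ = ∏ α ∈ posRoots b, rootFactor b q α (-t) := by
  rw [← inv_cFun_neg, neg_neg]

lemma continuous_inv_cFun_neg (hq : IsReducedParameterSystem b q) :
    Continuous fun t => (cFun b q (-t))⁻¹ := by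
  simp_rw [inv_cFun_neg]
  exact continuous_finsetProd _ fun α _ => continuous_rootFactor hq α

lemma continuous_inv_cFun (hq : IsReducedParameterSystem b q) :
    Continuous fun t => (cFun b q t)⁻¹ := by
  simp_rw [inv_cFun]
  exact continuous_finsetProd _ fun α _ => (continuous_rootFactor hq α).comp continuous_neg

lemma weylAct_corootP (w : weylGroup R) (α : ι) :
    weylAct R w (corootP R α) = corootP R (weylPerm R w α) :=
  Subtype.ext (coroot_weylPerm w α).symm

lemma rootFactor_weylTorus (hq : IsReducedParameterSystem b q) (w : weylGroup R) (α : ι)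
    (t : UnitAddTorus b.support) :
    rootFactor b q α (weylTorus b w t) = rootFactor b q (weylPerm R w α) t := by
  rw [rootFactor, rootDenom, rootFactor, rootDenom, tPow_weylTorus, weylAct_corootP,
    qRoot_weylPerm hq]

/-! ### The moments of `c(t⁻¹)⁻¹` -/

variable (b) in
/-- The cone `Q⁺` in the coweight lattice. -/
def posCone : AddSubmonoid (coweightLattice R) :=
  (AddSubmonoid.closure (R.coroot '' b.support)).comap (coweightLattice R).subtype

lemma mem_posCone {μ : coweightLattice R} :
    μ ∈ posCone b ↔ (μ : E) ∈ AddSubmonoid.closure (R.coroot '' b.support) := Iff.rfl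

lemma corootP_mem_posCone {α : ι} (hα : α ∈ posRoots b) : corootP R α ∈ posCone b :=
  IsPos.coroot_mem (mem_posRoots.1 hα)

variable (b) in
lemma heightP_add (μ ν : coweightLattice R) : heightP b (μ + ν) = heightP b μ + heightP b ν := by
  simp_rw [heightP, coweightPairing_add, Finset.sum_add_distrib]

lemma heightP_zero : heightP b (0 : coweightLattice R) = 0 := by
  simp_rw [heightP, coweightPairing_zero, Finset.sum_const_zero]

lemma heightP_neg (μ : coweightLattice R) : heightP b (-μ) = -heightP b μ := by
  simp_rw [heightP, coweightPairing_neg, Finset.sum_neg_distrib]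

lemma eq_zero_or_heightP_pos {μ : coweightLattice R} (hμ : μ ∈ posCone b) :
    μ = 0 ∨ 0 < heightP b μ := by
  obtain ⟨x, hx⟩ := μ
  rw [mem_posCone] at hμ
  change x ∈ _ at hμ
  induction hμ using AddSubmonoid.closure_induction with
  | mem x h =>
    obtain ⟨i, hi, rfl⟩ := h
    right
    have := heightP_corootP (R := R) hi
    rw [corootP] at this
    rw [this]
    norm_num
  | zero => exact Or.inl rfl
  | add x y hx' hy' ihx ihy =>
    have hle : AddSubmonoid.closure (R.coroot '' b.support) ≤
        (coweightLattice R).toAddSubmonoid := by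
      rw [AddSubmonoid.closure_le]
      rintro _ ⟨i, -, rfl⟩
      exact coroot_mem R i
    have hxP : x ∈ coweightLattice R := hle hx'
    have hyP : y ∈ coweightLattice R := hle hy'
    have hadd : (⟨x + y, hx⟩ : coweightLattice R) = ⟨x, hxP⟩ + ⟨y, hyP⟩ := rfl
    rw [hadd, heightP_add]
    rcases ihx hxP with h1 | h1 <;> rcases ihy hyP with h2 | h2
    · exact Or.inl (by rw [h1, h2, add_zero])
    · right; rw [h1, heightP_zero, zero_add]; exact h2
    · right; rw [h2, heightP_zero, add_zero]; exact h1
    · exact Or.inr (add_pos h1 h2)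

lemma eq_zero_of_mem_posCone_of_neg_mem {μ : coweightLattice R} (h : μ ∈ posCone b)
    (h' : heightP b μ ≤ 0) : μ = 0 :=
  (eq_zero_or_heightP_pos h).resolve_right (not_lt.2 h')

lemma IsDominant.heightP_nonneg {μ : coweightLattice R} (h : IsDominant b μ) : 0 ≤ heightP b μ :=
  Finset.sum_nonneg fun _ hα => h.nonneg (mem_posRoots.1 hα)

/-- Expanding each 1/(1 - q_α⁻¹ t^{α^∨}) geometrically would show only exponents in Q⁺, with
constant term 1. The proof adds one root β at a time: for u = q_β⁻¹, the moments a of F/(1 - u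
t^{β^∨}) satisfy a(μ) - u a(μ + β^∨) = moment of F, which determines them as |u| < 1. -/
lemma moments_prod_rootFactor (hq : IsReducedParameterSystem b q) {A : Finset ι}
    (hA : A ⊆ posRoots b) :
    (∀ μ : coweightLattice R, -μ ∉ posCone b →
      ∫ t, tPow b t μ * ∏ α ∈ A, rootFactor b q α t ∂(torusHaar b) = 0) ∧
    ∫ t, ∏ α ∈ A, rootFactor b q α t ∂(torusHaar b) = 1 := by
  classical
  induction A using Finset.induction_on with
  | empty =>
    refine ⟨fun μ hμ => ?_, by simp⟩
    simp_rw [Finset.prod_empty, mul_one]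
    exact integral_tPow fun h => hμ (by rw [h, neg_zero]; exact zero_mem _)
  | insert β A hβ ih =>
    rw [Finset.insert_subset_iff] at hA
    obtain ⟨ih0, ih1⟩ := ih hA.2
    set F : UnitAddTorus b.support → ℂ := fun t => ∏ α ∈ A, rootFactor b q α t with hF
    have hFc : Continuous F := continuous_finsetProd _ fun α _ => continuous_rootFactor hq α
    set h : UnitAddTorus b.support → ℂ := fun t => F t / rootDenom b q β t with hh
    have hhc : Continuous h := hFc.div (by fun_prop) (rootDenom_ne_zero hq β)
    set u : ℂ := ((qRoot b q β : ℝ) : ℂ)⁻¹ with hu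
    have hu1 : ‖u‖ < 1 := by
      have h2 := one_lt_qRoot hq β
      rw [hu, norm_inv, Complex.norm_real, Real.norm_eq_abs, abs_of_pos (zero_lt_one.trans h2)]
      exact inv_lt_one_of_one_lt₀ h2
    set a : coweightLattice R → ℂ := fun μ => ∫ t, tPow b t μ * h t ∂(torusHaar b) with ha
    have hint : ∀ μ, Integrable (fun t => tPow b t μ * h t) (torusHaar b) := fun μ =>
      integrable_torusHaar ((continuous_tPow μ).mul hhc)
    have hrec : ∀ μ, ∫ t, tPow b t μ * F t ∂(torusHaar b) = a μ - u * a (μ + corootP R β) := by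
      intro μ
      rw [ha, ← integral_const_mul, ← integral_sub (hint μ) ((hint _).const_mul u)]
      refine integral_congr_ae (Filter.Eventually.of_forall fun t => ?_)
      have hd := rootDenom_ne_zero hq β t
      simp only [hh, tPow_add]
      field_simp
      rw [rootDenom, ← hu]
    have hβQ := corootP_mem_posCone hA.1
    have hvan : ∀ μ : coweightLattice R, -μ ∉ posCone b → a μ = 0 := by
      intro μ hμ
      have hmem : ∀ n : ℕ, -(μ + n • corootP R β) ∉ posCone b := fun n hc => hμ <| by
        have := add_mem hc (nsmul_mem hβQ n)
        rwa [neg_add, neg_add_cancel_right] at this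
      -- Off -Q⁺ the moments of F vanish all along μ + nβ^∨, so a(μ) = uⁿ a(μ + nβ^∨) with bounded
      -- a, and this tends to 0.
      have hpow : ∀ n : ℕ, a μ = u ^ n * a (μ + n • corootP R β) := by
        intro n
        induction n with
        | zero => simp
        | succ n ihn =>
          have h1 := hrec (μ + n • corootP R β)
          rw [ih0 _ (hmem n), eq_comm, sub_eq_zero, add_assoc, ← succ_nsmul] at h1
          rw [ihn, h1, pow_succ, mul_assoc]
      have hbound : ∀ ν, ‖a ν‖ ≤ ∫ t, ‖h t‖ ∂(torusHaar b) := fun ν => by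
        refine (norm_integral_le_integral_norm _).trans_eq ?_
        simp_rw [norm_mul, norm_tPow, one_mul]
      have hlim : Filter.Tendsto (fun n : ℕ => ‖u‖ ^ n * ∫ t, ‖h t‖ ∂(torusHaar b)) Filter.atTop
          (nhds 0) := by
        simpa using (tendsto_pow_atTop_nhds_zero_of_lt_one (norm_nonneg u) hu1).mul_const
          (∫ t, ‖h t‖ ∂(torusHaar b))
      refine norm_le_zero_iff.1 (ge_of_tendsto' hlim fun n => ?_)
      rw [hpow n, norm_mul, norm_pow]
      exact mul_le_mul_of_nonneg_left (hbound _) (by positivity)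
    have hins : ∀ μ, ∫ t, tPow b t μ * ∏ α ∈ insert β A, rootFactor b q α t ∂(torusHaar b) =
        a μ - a (μ + corootP R β) := by
      intro μ
      rw [ha, ← integral_sub (hint μ) (hint _)]
      refine integral_congr_ae (Filter.Eventually.of_forall fun t => ?_)
      simp only [hh, tPow_add, Finset.prod_insert hβ]
      rw [show ∏ α ∈ A, rootFactor b q α t = F t from rfl, rootFactor]
      ring
    -- Since β^∨ is a non-zero element of Q⁺, it is not in -Q⁺; therefore the new constant term a(0)
    -- - a(β^∨) equals a(0) - u a(β^∨), the old one.
    have hβ' : a (corootP R β) = 0 := by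
      refine hvan _ fun hc => ?_
      have h1 := eq_zero_or_heightP_pos hβQ
      have h2 := coweightPairing_corootP_self (R := R) β
      have h0 : corootP R β ≠ 0 := fun h => by rw [h, coweightPairing_zero] at h2; norm_num at h2
      have h3 := eq_zero_of_mem_posCone_of_neg_mem hc (by
        rw [heightP_neg]; linarith [h1.resolve_left h0])
      exact h0 (neg_eq_zero.1 h3)
    refine ⟨fun μ hμ => ?_, ?_⟩
    · rw [hins, hvan μ hμ, hvan, sub_zero]
      intro hc
      have := add_mem hc hβQ
      rw [neg_add, neg_add_cancel_right] at this
      exact hμ this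
    · have h1 := hins 0
      have h2 := hrec 0
      simp_rw [tPow_zero, one_mul, zero_add] at h1 h2
      rw [h1, hβ', sub_zero]
      rw [hβ', mul_zero, sub_zero] at h2
      rw [← h2]
      exact ih1

variable (b q) in
/-- The moments of `c(t⁻¹)⁻¹`. -/
def cMoment (μ : coweightLattice R) : ℂ := ∫ t, tPow b t μ / cFun b q (-t) ∂(torusHaar b)

lemma cMoment_eq_zero (hq : IsReducedParameterSystem b q) {μ : coweightLattice R}
    (hμ : -μ ∉ posCone b) : cMoment b q μ = 0 := by
  simp_rw [cMoment, div_eq_mul_inv, inv_cFun_neg]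
  exact (moments_prod_rootFactor hq subset_rfl).1 μ hμ

lemma cMoment_zero (hq : IsReducedParameterSystem b q) :
    cMoment b q (0 : coweightLattice R) = 1 := by
  simp_rw [cMoment, div_eq_mul_inv, inv_cFun_neg, tPow_zero, one_mul]
  exact (moments_prod_rootFactor hq subset_rfl).2

/-- Only the factor of α_i in 1/c(t⁻¹) fails to be s_i-invariant. Multiplying it by the recursion's
coefficients clears its denominator, leaving q_i^{1/2} times the integral of (t^μ - t^{s_i μ}) J
with J invariant, which is 0. -/
lemma isBernstein_cMoment (hq : IsReducedParameterSystem b q) : IsBernstein q (cMoment b q) := by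
  classical
  intro i m μ hm
  have hi := i.2
  set J : UnitAddTorus b.support → ℂ := fun t => ∏ α ∈ (posRoots b).erase i, rootFactor b q α t
    with hJ
  have hJc : Continuous J := continuous_finsetProd _ fun α _ => continuous_rootFactor hq α
  have hJs : ∀ t, J (weylTorus b (rootRefl R i) t) = J t := fun t => by
    simp_rw [hJ, rootFactor_weylTorus hq, weylPerm_rootRefl]
    exact prod_posRoots_erase hi fun α => rootFactor b q α t
  have hsplit : ∀ t, (cFun b q (-t))⁻¹ = rootFactor b q i t * J t := fun t => by
    rw [inv_cFun_neg, hJ, Finset.mul_prod_erase _ (fun α => rootFactor b q α t)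
      (mem_posRoots.2 (RootPairing.Base.isPos_of_mem_support hi))]
  have hinv : ∫ t, tPow b t μ * J t ∂(torusHaar b) =
      ∫ t, tPow b t (μ - m • corootP R i) * J t ∂(torusHaar b) := by
    rw [← integral_weylTorus (rootRefl R i) (f := fun t => tPow b t μ * J t)
      ((continuous_tPow μ).mul hJc)]
    simp_rw [hJs, tPow_weylTorus, weylAct_rootRefl, hm, natCast_zsmul]
  have hint : ∀ ν, Integrable (fun t => tPow b t ν * (cFun b q (-t))⁻¹) (torusHaar b) := fun ν =>
    integrable_torusHaar ((continuous_tPow ν).mul (continuous_inv_cFun_neg hq))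
  have hintJ : ∀ ν, Integrable (fun t => tPow b t ν * J t) (torusHaar b) := fun ν =>
    integrable_torusHaar ((continuous_tPow ν).mul hJc)
  have hi1 : Integrable (fun t => ((√(q (some i)) : ℝ) : ℂ) * (tPow b t μ * (cFun b q (-t))⁻¹ -
      tPow b t (μ - m • corootP R i) * (cFun b q (-t))⁻¹)) (torusHaar b) :=
    ((hint _).sub (hint _)).const_mul _
  have hi2 : Integrable (fun t => quadCoeff q (some i) * ∑ j ∈ Finset.range m,
      tPow b t (μ - j • corootP R i) * (cFun b q (-t))⁻¹) (torusHaar b) :=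
    (integrable_finsetSum _ fun j _ => hint _).const_mul _
  rw [← sub_eq_zero]
  simp_rw [cMoment, div_eq_mul_inv]
  rw [← integral_sub (hint _) (hint _), ← integral_finsetSum _ fun j _ => hint _,
    ← integral_const_mul, ← integral_const_mul, ← integral_sub hi1 hi2]
  have key : ∀ t, ((√(q (some i)) : ℝ) : ℂ) * (tPow b t μ * (cFun b q (-t))⁻¹ -
        tPow b t (μ - m • corootP R i) * (cFun b q (-t))⁻¹) - quadCoeff q (some i) *
          ∑ j ∈ Finset.range m, tPow b t (μ - j • corootP R i) * (cFun b q (-t))⁻¹ =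
      ((√(q (some i)) : ℝ) : ℂ) * (tPow b t μ * J t - tPow b t (μ - m • corootP R i) * J t) := by
    intro t
    set z := tPow b t (corootP R i) with hz
    have hz0 : z ≠ 0 := tPow_ne_zero _ _
    have hpow : ∀ j : ℕ, tPow b t (μ - j • corootP R i) = tPow b t μ * z⁻¹ ^ j := fun j => by
      have : tPow b t (j • corootP R i) = z ^ j := by
        induction j with
        | zero => simp
        | succ j ihj => rw [succ_nsmul, tPow_add, ihj, pow_succ]
      rw [tPow_sub, this, inv_pow]
    have hgeom : (1 - z⁻¹) * ∑ j ∈ Finset.range m, z⁻¹ ^ j = 1 - z⁻¹ ^ m := by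
      rw [mul_comm, geom_sum_mul_neg]
    have hs : (√(q (some i)) : ℝ) ≠ 0 :=
      (Real.sqrt_pos.2 (zero_lt_one.trans (hq.one_lt _))).ne'
    have hs2 : (((√(q (some i)) : ℝ) : ℂ)) ^ 2 = ((q (some i) : ℝ) : ℂ) := by
      rw [← Complex.ofReal_pow, Real.sq_sqrt (zero_lt_one.trans (hq.one_lt _)).le]
    have hq0 : ((q (some i) : ℝ) : ℂ) ≠ 0 := by
      exact_mod_cast (zero_lt_one.trans (hq.one_lt _)).ne'
    have hquad : quadCoeff q (some i) = ((√(q (some i)) : ℝ) : ℂ) *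
        (1 - ((q (some i) : ℝ) : ℂ)⁻¹) := by
      have hs' : ((√(q (some i)) : ℝ) : ℂ) ≠ 0 := by exact_mod_cast hs
      rw [quadCoeff, ← hs2]
      push_cast
      field_simp
    -- The bracket is q_i⁻¹ - z⁻¹ = -z⁻¹(1 - q_i⁻¹ z), which cancels the denominator of the factor.
    have hf : (1 - z⁻¹ - (1 - ((q (some i) : ℝ) : ℂ)⁻¹)) * rootFactor b q i t = 1 - z⁻¹ := by
      have hd := rootDenom_ne_zero hq i t
      rw [rootFactor, ← hz, mul_div_assoc', div_eq_iff hd, rootDenom, ← hz, qRoot_coe hq]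
      field_simp
      ring
    simp_rw [hpow, hsplit, hquad, ← Finset.sum_mul, ← Finset.mul_sum]
    set S := ∑ j ∈ Finset.range m, z⁻¹ ^ j
    have e1 : tPow b t μ * (rootFactor b q i t * J t) -
        tPow b t μ * z⁻¹ ^ m * (rootFactor b q i t * J t) =
        tPow b t μ * ((1 - z⁻¹) * S) * (rootFactor b q i t * J t) := by rw [hgeom]; ring
    have e2 : tPow b t μ * J t - tPow b t μ * z⁻¹ ^ m * J t =
        tPow b t μ * ((1 - z⁻¹) * S) * J t := by rw [hgeom]; ring
    rw [e1, e2]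
    linear_combination ((√(q (some i)) : ℝ) : ℂ) * tPow b t μ * S * J t * hf
  simp_rw [key]
  rw [integral_const_mul, integral_sub (hintJ _) (hintJ _), hinv, sub_self, mul_zero]

/-- Two solutions of the recursion are compared at dominant ν. If moreover -ν lies in Q⁺, then the
height of ν has both signs, so ν = 0. -/
theorem trace_xPow_mul_oneZero (hq : IsReducedParameterSystem b q) (μ : coweightLattice R) :
    trace b q (xPow b q μ * oneZero b q) = ((poincare b q : ℝ) : ℂ)⁻¹ * cMoment b q μ := by
  have hB : IsBernstein q fun μ => ((poincare b q : ℝ) : ℂ)⁻¹ * cMoment b q μ := by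
    intro i m ν hν
    have := isBernstein_cMoment hq i m ν hν
    simp_rw [← Finset.mul_sum]
    linear_combination ((poincare b q : ℝ) : ℂ)⁻¹ * this
  refine congrFun ((isBernstein_trace hq).eq hq hB fun ν hν => ?_) μ
  rw [trace_xPow_mul_oneZero_of_isDominant hq hν]
  split_ifs with h0
  · rw [h0, cMoment_zero hq, mul_one]
  · rw [cMoment_eq_zero hq fun hc => h0 ?_, mul_zero]
    exact neg_eq_zero.1 (eq_zero_of_mem_posCone_of_neg_mem hc (by
      rw [heightP_neg]; linarith [hν.heightP_nonneg]))

end Torus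

end

end AffineHecke

namespace AffineHecke

noncomputable section

open MeasureTheory

set_option linter.unusedSectionVars false

/-! ### Symmetrisation over the finite Weyl group -/

section Spherical

variable {ι V E : Type*} [AddCommGroup V] [Module ℝ V] [AddCommGroup E] [Module ℝ E]
variable {R : RootPairing ι ℝ V E} {b : R.Base} [Fintype ι] [Nonempty ι]
variable [R.IsCrystallographic] [R.IsReduced] [R.IsIrreducible]
variable {q : Option b.support → ℝ}

/-! ### Generation of the Weyl group by simple reflections, and the exchange property -/

lemma rootRefl_inv (i : ι) : (rootRefl R i)⁻¹ = rootRefl R i :=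
  inv_eq_of_mul_eq_one_left (rootRefl_mul_self i)

lemma rootRefl_reflectionPerm (j i : ι) :
    rootRefl R (R.reflectionPerm j i) = rootRefl R j * rootRefl R i * (rootRefl R j)⁻¹ := by
  rw [← weylPerm_rootRefl, rootRefl_weylPerm]

lemma closure_simpleReflections (b : R.Base) :
    Subgroup.closure (Set.range fun i : b.support => rootRefl R i) = ⊤ := by
  set H := Subgroup.closure (Set.range fun i : b.support => rootRefl R i)
  have hroot : ∀ α, rootRefl R α ∈ H := fun α => by
    refine b.induction_reflect α (p := fun α => rootRefl R α ∈ H) (fun i hi => ?_) (fun i hi => ?_)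
      fun i j hi hj => ?_
    · rw [rootRefl_reflectionPerm]
      exact mul_mem (mul_mem hi hi) (inv_mem hi)
    · exact Subgroup.subset_closure ⟨⟨i, hi⟩, rfl⟩
    · have hj' : rootRefl R j ∈ H := Subgroup.subset_closure ⟨⟨j, hj⟩, rfl⟩
      rw [rootRefl_reflectionPerm]
      exact mul_mem (mul_mem hj' hi) (inv_mem hj')
  rw [eq_top_iff]
  rintro ⟨w, hw⟩ -
  have hw' : w ∈ Subgroup.closure (Set.range R.coreflection) := hw
  suffices w ∈ H.map (weylGroup R).subtype by
    obtain ⟨u, hu, rfl⟩ := this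
    exact hu
  refine (Subgroup.closure_le _).2 ?_ hw'
  rintro _ ⟨α, rfl⟩
  exact ⟨rootRefl R α, hroot α, rfl⟩

lemma weyl_induction (b : R.Base) {p : weylGroup R → Prop} (one : p 1)
    (mul : ∀ (i : b.support) (w : weylGroup R), p w → p (rootRefl R i * w)) (w : weylGroup R) :
    p w := by
  have hw : w ∈ Subgroup.closure (Set.range fun i : b.support => rootRefl R i) := by
    rw [closure_simpleReflections]; trivial
  induction hw using Subgroup.closure_induction_left with
  | one => exact one
  | mul_left x hx y _ ih =>
    obtain ⟨i, rfl⟩ := hx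
    exact mul i y ih
  | inv_mul_cancel x hx y _ ih =>
    obtain ⟨i, rfl⟩ := hx
    rw [rootRefl_inv]
    exact mul i y ih

lemma exists_list_prod_eq (b : R.Base) (w : weylGroup R) :
    ∃ L : List b.support, w = (L.map fun i : b.support => rootRefl R (i : ι)).prod := by
  refine weyl_induction b (p := fun w => ∃ L : List b.support,
    w = (L.map fun i : b.support => rootRefl R (i : ι)).prod) ⟨[], rfl⟩ ?_ w
  rintro i _ ⟨L, rfl⟩
  exact ⟨i :: L, by simp⟩

lemma weylPerm_mul_apply (u w : weylGroup R) (α : ι) :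
    weylPerm R (u * w) α = weylPerm R u (weylPerm R w α) := by
  rw [map_mul, Equiv.Perm.mul_apply]

lemma weylPerm_inv_apply_self (w : weylGroup R) (α : ι) :
    weylPerm R w⁻¹ (weylPerm R w α) = α := by
  rw [← weylPerm_mul_apply, inv_mul_cancel, map_one, Equiv.Perm.one_apply]

/-- Letters are applied to β until it meets its own simple root, where it turns negative; that
letter is deleted. -/
lemma exchange (L : List b.support) {β : ι} (hβ : b.IsPos β)
    (h : ¬ b.IsPos (weylPerm R (L.map fun i : b.support => rootRefl R (i : ι)).prod⁻¹ β)) :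
    ∃ L' : List b.support, L'.length + 1 = L.length ∧
      rootRefl R β * (L.map fun i : b.support => rootRefl R (i : ι)).prod =
        (L'.map fun i : b.support => rootRefl R (i : ι)).prod := by
  induction L generalizing β with
  | nil => simp [hβ] at h
  | cons j L ih =>
    by_cases hj : β = j
    · refine ⟨L, rfl, ?_⟩
      rw [List.map_cons, List.prod_cons, hj, ← mul_assoc, rootRefl_mul_self, one_mul]
    · rw [List.map_cons, List.prod_cons, mul_inv_rev, weylPerm_mul_apply, rootRefl_inv,
        weylPerm_rootRefl] at h
      obtain ⟨L', h1, h2⟩ := ih (hβ.reflectionPerm j.2 hj) h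
      refine ⟨j :: L', by rw [List.length_cons, h1, List.length_cons], ?_⟩
      rw [List.map_cons, List.prod_cons, List.map_cons, List.prod_cons, ← h2,
        rootRefl_reflectionPerm, rootRefl_inv]
      simp only [mul_assoc]
      rw [← mul_assoc (rootRefl R (j : ι)) (rootRefl R (j : ι)), rootRefl_mul_self, one_mul]

/-- If a word for w starts with s_i, positivity of w⁻¹α_i makes α_i an inversion of the rest, and
the exchange property yields a word for w with two letters fewer. -/
lemma eq_one_of_forall_isPos {w : weylGroup R}
    (h : ∀ α, b.IsPos α → b.IsPos (weylPerm R w⁻¹ α)) : w = 1 := by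
  obtain ⟨L, hL⟩ := exists_list_prod_eq b w
  induction hn : L.length using Nat.strong_induction_on generalizing L with
  | _ n ih =>
    cases L with
    | nil => exact hL
    | cons i L =>
      have hi := h i (RootPairing.Base.isPos_of_mem_support i.2)
      rw [hL, List.map_cons, List.prod_cons, mul_inv_rev, weylPerm_mul_apply, rootRefl_inv,
        weylPerm_rootRefl, weylPerm_reflectionPerm_self, isPos_reflectionPerm_self] at hi
      obtain ⟨L', h1, h2⟩ := exchange L (RootPairing.Base.isPos_of_mem_support i.2) hi
      exact ih L'.length (by rw [← hn, List.length_cons]; omega) L'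
        (by rw [hL, List.map_cons, List.prod_cons, h2]) rfl

/-! ### Inversions of the elements of the Weyl group -/

open Classical in
variable (b) in
/-- The positive roots `α` with `w⁻¹α` negative. -/
def weylInv (w : weylGroup R) : Finset ι :=
  (posRoots b).filter fun α => ¬ b.IsPos (weylPerm R w⁻¹ α)

open Classical in
lemma mem_weylInv {w : weylGroup R} {α : ι} :
    α ∈ weylInv b w ↔ b.IsPos α ∧ ¬ b.IsPos (weylPerm R w⁻¹ α) := by
  rw [weylInv, Finset.mem_filter, mem_posRoots]

open Classical in
lemma weylInv_subset (w : weylGroup R) : weylInv b w ⊆ posRoots b := Finset.filter_subset _ _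

lemma weylInv_one : weylInv b (1 : weylGroup R) = ∅ := by
  ext α
  simp [mem_weylInv]

lemma weylInv_injective : Function.Injective (weylInv b) := fun w u h => by
  have key : ∀ α, b.IsPos α → (b.IsPos (weylPerm R w⁻¹ α) ↔ b.IsPos (weylPerm R u⁻¹ α)) :=
    fun α hα => by
      have := Finset.ext_iff.1 h α
      simp only [mem_weylInv, hα, true_and] at this
      exact not_iff_not.1 this
  have key' : ∀ α, b.IsPos (weylPerm R w⁻¹ α) ↔ b.IsPos (weylPerm R u⁻¹ α) := fun α => by
    by_cases hα : b.IsPos α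
    · exact key α hα
    · have := key _ ((isPos_reflectionPerm_self b).2 hα)
      rw [weylPerm_reflectionPerm_self, weylPerm_reflectionPerm_self, isPos_reflectionPerm_self,
        isPos_reflectionPerm_self] at this
      exact not_iff_not.1 this
  have h1 : u⁻¹ * w = 1 := eq_one_of_forall_isPos (b := b) fun α hα => by
    rw [mul_inv_rev, inv_inv, weylPerm_mul_apply, key', weylPerm_inv_apply_self]
    exact hα
  exact (inv_mul_eq_one.1 h1).symm

open Classical in
variable (b) in
/-- The operation on sets of positive roots that corresponds to `w ↦ s_i w` on inversion sets. -/
def swapSet (i : ι) (S : Finset ι) : Finset ι :=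
  (posRoots b).filter fun α => if α = i then i ∉ S else R.reflectionPerm i α ∈ S

open Classical in
lemma swapSet_subset (i : ι) (S : Finset ι) : swapSet b i S ⊆ posRoots b := Finset.filter_subset _ _

lemma self_mem_posRoots (i : b.support) : (i : ι) ∈ posRoots b :=
  mem_posRoots.2 (RootPairing.Base.isPos_of_mem_support i.2)

open Classical in
lemma self_mem_swapSet {i : b.support} {S : Finset ι} :
    (i : ι) ∈ swapSet b i S ↔ (i : ι) ∉ S := by
  rw [swapSet, Finset.mem_filter, if_pos rfl, and_iff_right (self_mem_posRoots i)]

open Classical in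
lemma mem_swapSet_of_ne {i α : ι} (h : α ≠ i) {S : Finset ι} :
    α ∈ swapSet b i S ↔ α ∈ posRoots b ∧ R.reflectionPerm i α ∈ S := by
  rw [swapSet, Finset.mem_filter, if_neg h]

lemma swapSet_swapSet (i : b.support) {S : Finset ι} (hS : S ⊆ posRoots b) :
    swapSet b i (swapSet b i S) = S := by
  classical
  ext α
  by_cases h : α = i
  · rw [h, self_mem_swapSet, self_mem_swapSet, not_not]
  · rw [mem_swapSet_of_ne h]
    constructor
    · rintro ⟨h1, h2⟩
      have h3 := reflectionPerm_mem_posRoots_erase i.2 (Finset.mem_erase.2 ⟨h, h1⟩)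
      rw [mem_swapSet_of_ne (Finset.mem_erase.1 h3).1, R.reflectionPerm_self] at h2
      exact h2.2
    · intro h1
      have h3 := reflectionPerm_mem_posRoots_erase i.2 (Finset.mem_erase.2 ⟨h, hS h1⟩)
      rw [Finset.mem_erase] at h3
      rw [mem_swapSet_of_ne h3.1, R.reflectionPerm_self]
      exact ⟨hS h1, h3.2, h1⟩

lemma swapSet_of_notMem [DecidableEq ι] (i : b.support) {S : Finset ι} (hS : S ⊆ posRoots b)
    (hi : (i : ι) ∉ S) :
    swapSet b i S = insert (i : ι) (S.map (R.reflectionPerm i).toEmbedding) := by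
  ext α
  by_cases h : α = i
  · rw [h, self_mem_swapSet]
    simp [hi]
  · rw [mem_swapSet_of_ne h, Finset.mem_insert, or_iff_right h, Finset.mem_map]
    constructor
    · rintro ⟨-, h2⟩
      exact ⟨_, h2, R.reflectionPerm_self i α⟩
    · rintro ⟨β, h2, rfl⟩
      have h3 := reflectionPerm_mem_posRoots_erase i.2
        (Finset.mem_erase.2 ⟨fun he => hi (he ▸ h2), hS h2⟩)
      rw [Finset.mem_erase] at h3
      exact ⟨h3.2, by rw [Equiv.coe_toEmbedding, R.reflectionPerm_self]; exact h2⟩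

lemma notMem_map_reflectionPerm (i : b.support) {S : Finset ι} (hS : S ⊆ posRoots b) :
    (i : ι) ∉ S.map (R.reflectionPerm i).toEmbedding := fun h => by
  obtain ⟨β, h2, h3⟩ := Finset.mem_map.1 h
  have h4 := mem_posRoots.1 (hS h2)
  rw [← R.reflectionPerm_self i β, show R.reflectionPerm i β = i from h3,
    isPos_reflectionPerm_self] at h4
  exact h4 (RootPairing.Base.isPos_of_mem_support i.2)

lemma card_swapSet_of_notMem (i : b.support) {S : Finset ι} (hS : S ⊆ posRoots b)
    (hi : (i : ι) ∉ S) : (swapSet b i S).card = S.card + 1 := by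
  classical
  rw [swapSet_of_notMem i hS hi, Finset.card_insert_of_notMem (notMem_map_reflectionPerm i hS),
    Finset.card_map]

lemma neg_one_pow_card_swapSet (i : b.support) {S : Finset ι} (hS : S ⊆ posRoots b) :
    (-1 : ℂ) ^ (swapSet b i S).card = -(-1) ^ S.card := by
  by_cases hi : (i : ι) ∈ S
  · have h := card_swapSet_of_notMem i (swapSet_subset (i : ι) S) (by rwa [self_mem_swapSet, not_not])
    rw [swapSet_swapSet i hS] at h
    rw [h, pow_succ]
    ring
  · rw [card_swapSet_of_notMem i hS hi, pow_succ]
    ring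

lemma weylInv_rootRefl_mul (i : b.support) (w : weylGroup R) :
    weylInv b (rootRefl R i * w) = swapSet b i (weylInv b w) := by
  classical
  ext α
  rw [mem_weylInv, mul_inv_rev, weylPerm_mul_apply, rootRefl_inv, weylPerm_rootRefl]
  by_cases h : α = i
  · have hi := RootPairing.Base.isPos_of_mem_support i.2
    rw [h, self_mem_swapSet, mem_weylInv, weylPerm_reflectionPerm_self, isPos_reflectionPerm_self]
    simp [hi]
  · rw [mem_swapSet_of_ne h, mem_weylInv, mem_posRoots]
    refine and_congr_right fun hα => ?_
    rw [and_iff_right (hα.reflectionPerm i.2 h)]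

/-! ### Exponents of the expanded Weyl denominator -/

variable (b) in
/-- The coweight `ρ - ∑_{α ∈ S} α^∨`. -/
def rhoSub (S : Finset ι) : coweightLattice R := sumFund b - ∑ α ∈ S, corootP R α

lemma rhoSub_empty : rhoSub b (∅ : Finset ι) = sumFund b := by
  rw [rhoSub, Finset.sum_empty, sub_zero]

lemma weylAct_rootRefl_rootRefl (i : ι) (μ : coweightLattice R) :
    weylAct R (rootRefl R i) (weylAct R (rootRefl R i) μ) = μ :=
  Subtype.ext (LinearEquiv.congr_fun (congrArg Subtype.val (rootRefl_mul_self (R := R) i)) _)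

/-- Since s_i ρ = ρ - α_i^∨ and s_i permutes the other positive coroots, membership of α_i in S
toggles and the rest of S is permuted. -/
lemma weylAct_rhoSub (i : b.support) {S : Finset ι} (hS : S ⊆ posRoots b) :
    weylAct R (rootRefl R i) (rhoSub b S) = rhoSub b (swapSet b i S) := by
  classical
  have key : ∀ S ⊆ posRoots b, (i : ι) ∉ S →
      weylAct R (rootRefl R i) (rhoSub b S) = rhoSub b (swapSet b i S) := fun S hS hi => by
    rw [swapSet_of_notMem i hS hi, rhoSub, rhoSub, map_sub, weylAct_rootRefl (i : ι) (sumFund b),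
      coweightPairing_sumFund i.2, one_smul, map_sum,
      Finset.sum_insert (notMem_map_reflectionPerm i hS), Finset.sum_map]
    simp_rw [weylAct_corootP, weylPerm_rootRefl, Equiv.coe_toEmbedding]
    abel
  by_cases hi : (i : ι) ∈ S
  · have h := key _ (swapSet_subset (i : ι) S) (by rwa [self_mem_swapSet, not_not])
    rw [swapSet_swapSet i hS] at h
    rw [← h, weylAct_rootRefl_rootRefl]
  · exact key S hS hi

lemma corootP_ne_zero (α : ι) : corootP R α ≠ 0 := fun h => by
  have h2 := coweightPairing_corootP_self (R := R) α
  rw [h, coweightPairing_zero] at h2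
  norm_num at h2

lemma heightP_corootP_pos {α : ι} (hα : α ∈ posRoots b) : 0 < heightP b (corootP R α) :=
  (eq_zero_or_heightP_pos (corootP_mem_posCone hα)).resolve_left (corootP_ne_zero α)

lemma heightP_sum (S : Finset ι) :
    heightP b (∑ α ∈ S, corootP R α) = ∑ α ∈ S, heightP b (corootP R α) := by
  classical
  induction S using Finset.induction_on with
  | empty => simp [heightP_zero]
  | insert a s ha ih => rw [Finset.sum_insert ha, Finset.sum_insert ha, heightP_add, ih]

lemma heightP_sub (μ ν : coweightLattice R) : heightP b (μ - ν) = heightP b μ - heightP b ν := by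
  rw [sub_eq_add_neg, heightP_add, heightP_neg, sub_eq_add_neg]

lemma heightP_rhoSub_le {S : Finset ι} (hS : S ⊆ posRoots b) :
    heightP b (rhoSub b S) ≤ heightP b (sumFund b) := by
  rw [rhoSub, heightP_sub, heightP_sum]
  have := Finset.sum_nonneg fun α (hα : α ∈ S) => (heightP_corootP_pos (hS hα)).le
  linarith

/-- A function on the coweight lattice, odd under simple reflections, vanishes at
`ρ - ∑_{α ∈ S} α^∨` unless `S` is the set of inversions of an element of the Weyl group. -/
lemma eq_zero_or_eq_weylInv {I : coweightLattice R → ℂ}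
    (hI : ∀ (i : b.support) (μ : coweightLattice R), I (weylAct R (rootRefl R i) μ) = -I μ)
    {S : Finset ι} (hS : S ⊆ posRoots b) : I (rhoSub b S) = 0 ∨ ∃ w, weylInv b w = S := by
  induction hN : (heightP b (sumFund b) - heightP b (rhoSub b S)).toNat using
    Nat.strong_induction_on generalizing S with
  | _ N ih =>
    by_cases hdom : IsDominant b (rhoSub b S)
    -- On a wall oddness gives I = -I. In the strictly dominant case all simple pairings are at
    -- least 1, so -Σ_S α^∨ is dominant and by height S must be empty.
    · by_cases hreg : ∃ i ∈ b.support, coweightPairing R (rhoSub b S) i = 0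
      · obtain ⟨i, hi, h0⟩ := hreg
        left
        have h1 := hI ⟨i, hi⟩ (rhoSub b S)
        rw [weylAct_rootRefl, h0, zero_smul, sub_zero] at h1
        exact self_eq_neg.1 h1
      · push Not at hreg
        right
        refine ⟨1, ?_⟩
        have hd : IsDominant b (rhoSub b S - sumFund b) := fun j hj => by
          rw [coweightPairing_sub, coweightPairing_sumFund hj]
          have h1 := hdom j hj
          have h2 := hreg j hj
          lia
        have h1 := hd.heightP_nonneg
        rw [rhoSub, sub_sub_cancel_left, heightP_neg, heightP_sum] at h1
        rw [weylInv_one, eq_comm, Finset.eq_empty_iff_forall_notMem]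
        intro α hα
        have h2 := Finset.sum_pos (fun β hβ => heightP_corootP_pos (hS hβ)) ⟨α, hα⟩
        linarith
    · obtain ⟨i, hi, hneg⟩ : ∃ i ∈ b.support, coweightPairing R (rhoSub b S) i < 0 := by
        simpa [IsDominant] using hdom
      have hact := weylAct_rhoSub ⟨i, hi⟩ hS
      have hle := heightP_rhoSub_le (swapSet_subset (b := b) i S)
      -- Reflecting along a negative pairing adds a positive multiple of α_i^∨, so the height rises
      -- towards that of ρ, its upper bound.
      have hlt : heightP b (rhoSub b S) < heightP b (rhoSub b (swapSet b i S)) := by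
        obtain ⟨m, hm⟩ : ∃ m : ℕ, coweightPairing R (rhoSub b S) i = -m :=
          ⟨(coweightPairing R (rhoSub b S) i).natAbs, by lia⟩
        rw [weylAct_rootRefl, hm] at hact
        change _ = rhoSub b (swapSet b i S) at hact
        have h1 := heightP_sub_nsmul (rhoSub b (swapSet b i S)) hi m
        have h2 : rhoSub b (swapSet b i S) - m • corootP R i = rhoSub b S := by
          rw [← hact, neg_smul, natCast_zsmul]
          abel
        rw [h2] at h1
        lia
      rcases ih _ (by lia) (swapSet_subset (b := b) i S) rfl with h | ⟨w, hw⟩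
      · left
        have h1 := hI ⟨i, hi⟩ (rhoSub b S)
        rw [hact] at h1
        change I (rhoSub b (swapSet b i S)) = _ at h1
        rw [h, eq_comm, neg_eq_zero] at h1
        exact h1
      · right
        refine ⟨rootRefl R i * w, ?_⟩
        have h1 := weylInv_rootRefl_mul ⟨i, hi⟩ w
        rw [hw] at h1
        exact h1.trans (swapSet_swapSet ⟨i, hi⟩ hS)

lemma apply_rhoSub_weylInv {I : coweightLattice R → ℂ}
    (hI : ∀ (i : b.support) (μ : coweightLattice R), I (weylAct R (rootRefl R i) μ) = -I μ)
    (w : weylGroup R) :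
    I (rhoSub b (weylInv b w)) = (-1) ^ (weylInv b w).card * I (sumFund b) := by
  refine weyl_induction b (p := fun w => I (rhoSub b (weylInv b w)) =
    (-1) ^ (weylInv b w).card * I (sumFund b)) ?_ (fun i w ih => ?_) w
  · rw [weylInv_one, rhoSub_empty, Finset.card_empty, pow_zero, one_mul]
  · rw [weylInv_rootRefl_mul, ← weylAct_rhoSub i (weylInv_subset w), hI, ih,
      neg_one_pow_card_swapSet i (weylInv_subset w)]
    ring

/-! ### Integrals against the Weyl denominator -/

variable (b) in
/-- `∏_{α > 0} (1 - t^{α^∨})`. -/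
def weylDenom (t : UnitAddTorus b.support) : ℂ := ∏ α ∈ posRoots b, (1 - tPow b t (corootP R α))

lemma continuous_weylDenom : Continuous (weylDenom b) := by
  unfold weylDenom
  fun_prop

lemma corootP_reflectionPerm_self (i : ι) :
    corootP R (R.reflectionPerm i i) = -corootP R i :=
  Subtype.ext (by
    change R.coroot (R.reflectionPerm i i) = -R.coroot i
    rw [R.coroot_reflectionPerm, R.coreflection_apply_self])

/-- Only the α_i-factor changes, to 1 - t^{-α_i^∨}. Equivalently, t^{-ρ} times `weylDenom` is odd
under s_i. -/
lemma weylDenom_weylTorus (i : b.support) (t : UnitAddTorus b.support) :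
    weylDenom b (weylTorus b (rootRefl R i) t) * tPow b t (corootP R i) = -weylDenom b t := by
  classical
  simp_rw [weylDenom, tPow_weylTorus, weylAct_corootP, weylPerm_rootRefl]
  rw [← Finset.mul_prod_erase _ _ (self_mem_posRoots i),
    ← Finset.mul_prod_erase _ _ (self_mem_posRoots i),
    prod_posRoots_erase i.2 fun α => 1 - tPow b t (corootP R α), corootP_reflectionPerm_self,
    tPow_neg]
  have := tPow_ne_zero t (corootP R (i : ι))
  field_simp
  ring

/-- For a function `G` on the torus invariant under the Weyl group and a function `r` on the roots
invariant under the Weyl group, the integral of `G ∏_{α > 0} (1 - r_α t^{-α^∨}) (1 - t^{α^∨})`. -/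
lemma integral_mul_prod_mul_weylDenom {G : UnitAddTorus b.support → ℂ} (hG : Continuous G)
    (hGw : ∀ (i : b.support) t, G (weylTorus b (rootRefl R i) t) = G t) (r : ι → ℂ) :
    ∫ t, G t * (∏ α ∈ posRoots b, (1 - r α * (tPow b t (corootP R α))⁻¹)) * weylDenom b t
      ∂(torusHaar b) =
    (∑ w : weylGroup R, ∏ α ∈ weylInv b w, r α) * ∫ t, G t * weylDenom b t ∂(torusHaar b) := by
  classical
  -- The shift by ρ turns the transformation rule of `weylDenom` into plain oddness of I.
  set I : coweightLattice R → ℂ := fun ν =>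
    ∫ t, G t * (tPow b t (ν - sumFund b) * weylDenom b t) ∂(torusHaar b) with hIdef
  have hcont : ∀ ν : coweightLattice R,
      Continuous fun t => G t * (tPow b t (ν - sumFund b) * weylDenom b t) := fun ν =>
    hG.mul ((continuous_tPow _).mul continuous_weylDenom)
  have hI : ∀ (i : b.support) (μ : coweightLattice R),
      I (weylAct R (rootRefl R i) μ) = -I μ := fun i μ => by
    change ∫ t, G t * (tPow b t (weylAct R (rootRefl R i) μ - sumFund b) * weylDenom b t)
      ∂(torusHaar b) = -∫ t, G t * (tPow b t (μ - sumFund b) * weylDenom b t) ∂(torusHaar b)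
    rw [← integral_neg, ← integral_weylTorus (rootRefl R i) (hcont _)]
    refine integral_congr_ae (Filter.Eventually.of_forall fun t => ?_)
    simp only [hGw, tPow_weylTorus]
    rw [map_sub, weylAct_rootRefl_rootRefl, weylAct_rootRefl (i : ι) (sumFund b),
      coweightPairing_sumFund i.2, one_smul,
      show μ - (sumFund b - corootP R i) = μ - sumFund b + corootP R i by abel, tPow_add]
    linear_combination G t * tPow b t (μ - sumFund b) * weylDenom_weylTorus i t
  have hexp : ∀ t, G t * (∏ α ∈ posRoots b, (1 - r α * (tPow b t (corootP R α))⁻¹)) *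
      weylDenom b t = ∑ S ∈ (posRoots b).powerset, (∏ α ∈ S, -r α) *
        (G t * (tPow b t (rhoSub b S - sumFund b) * weylDenom b t)) := fun t => by
    simp_rw [sub_eq_add_neg (1 : ℂ), Finset.prod_one_add, Finset.mul_sum, Finset.sum_mul]
    refine Finset.sum_congr rfl fun S _ => ?_
    rw [rhoSub, sub_sub_cancel_left, tPow_neg, tPow_sum, ← Finset.prod_inv_distrib]
    simp_rw [← neg_mul, Finset.prod_mul_distrib]
    ring
  simp_rw [hexp]
  rw [integral_finsetSum _ fun S _ => (integrable_torusHaar (hcont _)).const_mul _]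
  simp_rw [integral_const_mul]
  rw [Finset.sum_mul]
  symm
  refine Finset.sum_of_injOn (weylInv b) weylInv_injective.injOn
    (fun w _ => Finset.mem_coe.2 (Finset.mem_powerset.2 (weylInv_subset w))) (fun S hS hS' => ?_)
    fun w _ => ?_
  · rw [Finset.mem_powerset] at hS
    rcases eq_zero_or_eq_weylInv hI hS with h | ⟨w, hw⟩
    · exact mul_eq_zero_of_right _ h
    · exact absurd ⟨w, Finset.mem_coe.2 (Finset.mem_univ w), hw⟩ hS'
  · have h1 := apply_rhoSub_weylInv hI w
    have h2 : I (sumFund b) = ∫ t, G t * weylDenom b t ∂(torusHaar b) := by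
      simp_rw [hIdef, sub_self, tPow_zero, one_mul]
    change _ = _ * I (rhoSub b (weylInv b w))
    rw [h1, h2, Finset.prod_neg]
    -- The sign from expanding the product over S cancels the sign from oddness.
    have h3 : ((-1 : ℂ) ^ (weylInv b w).card) * (-1) ^ (weylInv b w).card = 1 := by
      rw [← mul_pow]; norm_num
    linear_combination (-(∏ α ∈ weylInv b w, r α) * ∫ t, G t * weylDenom b t ∂(torusHaar b)) * h3

/-! ### The Poincaré polynomial -/

/-- Elements of W₀ preserve levels, so their affine inversions all have level 0. -/
lemma qElt_ofWeyl (hq : IsReducedParameterSystem b q) (w : weylGroup R) :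
    qElt b q (ofWeyl R w) = ∏ α ∈ weylInv b w, qRoot b q α := by
  have hset : invSet b (ofWeyl R w) =
      ((weylInv b w).map ⟨fun α => (α, (0 : ℤ)), fun _ _ h => (Prod.ext_iff.1 h).1⟩ :
        Finset (ι × ℤ)) := by
    ext ⟨α, k⟩
    rw [mem_invSet, ← ofWeyl_inv, affAct_ofWeyl]
    rw [Finset.mem_coe, Finset.mem_map]
    constructor
    · rintro ⟨h1 | ⟨h1, h3⟩, h2⟩
      · exact absurd (Or.inl h1) h2
      · exact ⟨α, mem_weylInv.2 ⟨h3, fun hc => h2 (Or.inr ⟨h1, hc⟩)⟩, Prod.ext rfl h1.symm⟩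
    · rintro ⟨β, hβ, h⟩
      obtain ⟨rfl, rfl⟩ := Prod.ext_iff.1 h
      obtain ⟨h1, h2⟩ := mem_weylInv.1 hβ
      exact ⟨Or.inr ⟨rfl, h1⟩, fun hc => h2 (hc.resolve_left (lt_irrefl _)).2⟩
  rw [qElt_eq_finprod hq, hset, finprod_mem_coe_finset, Finset.prod_map]
  exact Finset.prod_congr rfl fun α _ => (qRoot_eq_qAff hq α).symm

/-- By maximal length, w₀⁻¹ makes each simple root negative. So -w₀ρ pairs positively with the
simple roots, hence with all positive roots, and the rest follows from the sign of the pairing with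
ρ. -/
lemma not_isPos_longest {α : ι} (hα : b.IsPos α) :
    ¬ b.IsPos (weylPerm R (longest b)⁻¹ α) := by
  have hmax : ∀ w : weylGroup R, length b (ofWeyl R w) ≤ length b (ofWeyl R (longest b)) :=
    (Finite.exists_max fun w : weylGroup R => length b (ofWeyl R w)).choose_spec
  have hsimple : ∀ i : b.support, ¬ b.IsPos (weylPerm R (longest b)⁻¹ i) := fun i hi => by
    have h1 := hmax (rootRefl R i * longest b)
    rw [ofWeyl_mul, ← simpleRefl_some, length_simpleRefl_mul_iff.2] at h1
    · omega
    · rw [← ofWeyl_inv, affAct_ofWeyl]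
      exact Or.inr ⟨rfl, hi⟩
  have hval : ∀ β, R.root' β (-(longest b).1 (sumFund b : E)) =
      -(coweightPairing R (sumFund b) (weylPerm R (longest b)⁻¹ β) : ℝ) := fun β => by
    rw [← coweightPairing_spec, root'_weylPerm', map_neg, inv_inv]
  have h := IsPos.root'_pos hα (x := -(longest b).1 (sumFund b : E)) fun j hj => by
    rw [hval, neg_pos]
    exact_mod_cast coweightPairing_sumFund_neg (hsimple ⟨j, hj⟩)
  rw [hval, neg_pos] at h
  intro hc
  have h2 : (0 : ℝ) < coweightPairing R (sumFund b) (weylPerm R (longest b)⁻¹ α) := by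
    exact_mod_cast coweightPairing_sumFund_pos hc
  linarith

/-- The inversions of w w₀ are the positive roots that are not inversions of w. -/
lemma qElt_mul_longest (hq : IsReducedParameterSystem b q) (w : weylGroup R) :
    qElt b q (ofWeyl R (w * longest b)) =
      qElt b q (ofWeyl R (longest b)) * (qElt b q (ofWeyl R w))⁻¹ := by
  classical
  have h1 : weylInv b (longest b) = posRoots b := by
    ext α
    rw [mem_weylInv, mem_posRoots, and_iff_left_iff_imp]
    exact not_isPos_longest
  have h2 : weylInv b (w * longest b) = posRoots b \ weylInv b w := by
    ext α
    rw [mem_weylInv, Finset.mem_sdiff, mem_weylInv, mem_posRoots, mul_inv_rev, weylPerm_mul_apply]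
    refine and_congr_right fun hα => ?_
    rw [not_and_not_right, imp_iff_right hα, not_iff_comm]
    constructor
    · intro h
      have h3 := not_isPos_longest ((isPos_reflectionPerm_self b).2 h)
      rwa [weylPerm_reflectionPerm_self, isPos_reflectionPerm_self, not_not] at h3
    · exact fun h hc => not_isPos_longest hc h
  rw [qElt_ofWeyl hq, qElt_ofWeyl hq, qElt_ofWeyl hq w, h1, h2, eq_mul_inv_iff_mul_eq₀,
    Finset.prod_sdiff (weylInv_subset w)]
  exact Finset.prod_ne_zero_iff.2 fun α _ => (zero_lt_one.trans (one_lt_qRoot hq α)).ne'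

lemma poincare_eq (hq : IsReducedParameterSystem b q) :
    poincare b q = qElt b q (ofWeyl R (longest b)) *
      ∑ w : weylGroup R, ∏ α ∈ weylInv b w, (qRoot b q α)⁻¹ := by
  rw [poincare, ← Equiv.sum_comp (Equiv.mulRight (longest b)), Finset.mul_sum]
  refine Finset.sum_congr rfl fun w _ => ?_
  rw [Equiv.coe_mulRight, qElt_mul_longest hq, qElt_ofWeyl hq w, Finset.prod_inv_distrib]

/-! ### The trace of the invariant elements -/

lemma evalT_weylTorus {p : AddMonoidAlgebra ℂ (coweightLattice R)} (hp : IsWeylInvariant p)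
    (w : weylGroup R) (t : UnitAddTorus b.support) :
    evalT b p (weylTorus b w t) = evalT b p t := by
  conv_rhs => rw [← hp w]
  rw [evalT, evalT, AddMonoidAlgebra.coeff_mapDomain, Finsupp.sum_mapDomain_index]
  · simp_rw [tPow_weylTorus]
  · simp
  · intros; ring

lemma continuous_evalT (p : AddMonoidAlgebra ℂ (coweightLattice R)) : Continuous (evalT b p) := by
  unfold evalT Finsupp.sum
  fun_prop

lemma trace_evalX_mul_oneZero (hq : IsReducedParameterSystem b q)
    (p : AddMonoidAlgebra ℂ (coweightLattice R)) :
    trace b q (evalX b q p * oneZero b q) = ((poincare b q : ℝ) : ℂ)⁻¹ *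
      ∫ t, evalT b p t / cFun b q (-t) ∂(torusHaar b) := by
  rw [evalX, Finsupp.sum, Finset.sum_mul, map_sum]
  simp_rw [smul_mul_assoc, map_smul, trace_xPow_mul_oneZero hq, evalT, Finsupp.sum,
    Finset.sum_div, mul_div_assoc]
  rw [integral_finsetSum, Finset.mul_sum]
  · refine Finset.sum_congr rfl fun μ _ => ?_
    rw [integral_const_mul, cMoment, smul_eq_mul]
    ring
  · intro μ _
    simp_rw [div_eq_mul_inv]
    exact (integrable_torusHaar ((continuous_tPow μ).mul (continuous_inv_cFun_neg hq))).const_mul _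

variable (b q) in
/-- `∏_{α > 0} (1 - q_α⁻¹ t^{α^∨}) (1 - q_α⁻¹ t^{-α^∨})`. -/
def plancherelDenom (t : UnitAddTorus b.support) : ℂ :=
  ∏ α ∈ posRoots b, rootDenom b q α t * rootDenom b q α (-t)

lemma plancherelDenom_ne_zero (hq : IsReducedParameterSystem b q) (t : UnitAddTorus b.support) :
    plancherelDenom b q t ≠ 0 :=
  Finset.prod_ne_zero_iff.2 fun α _ =>
    mul_ne_zero (rootDenom_ne_zero hq α t) (rootDenom_ne_zero hq α (-t))

lemma continuous_plancherelDenom : Continuous (plancherelDenom b q) :=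
  continuous_finsetProd _ fun α _ => (continuous_rootDenom α).mul
    ((continuous_rootDenom α).comp continuous_neg)

lemma rootDenom_weylTorus (hq : IsReducedParameterSystem b q) (w : weylGroup R) (α : ι)
    (t : UnitAddTorus b.support) :
    rootDenom b q α (weylTorus b w t) = rootDenom b q (weylPerm R w α) t := by
  rw [rootDenom, rootDenom, tPow_weylTorus, weylAct_corootP, qRoot_weylPerm hq]

lemma rootDenom_reflectionPerm_self (hq : IsReducedParameterSystem b q) (α : ι)
    (t : UnitAddTorus b.support) :
    rootDenom b q (R.reflectionPerm α α) t = rootDenom b q α (-t) := by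
  rw [rootDenom, rootDenom, corootP_reflectionPerm_self, tPow_neg, tPow_neg_left,
    ← weylPerm_rootRefl, qRoot_weylPerm hq]

lemma plancherelDenom_weylTorus (hq : IsReducedParameterSystem b q) (i : b.support)
    (t : UnitAddTorus b.support) :
    plancherelDenom b q (weylTorus b (rootRefl R i) t) = plancherelDenom b q t := by
  classical
  simp_rw [plancherelDenom, ← map_neg, rootDenom_weylTorus hq, weylPerm_rootRefl]
  rw [← Finset.mul_prod_erase _ _ (self_mem_posRoots i),
    ← Finset.mul_prod_erase (posRoots b) (fun α => rootDenom b q α t * rootDenom b q α (-t))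
      (self_mem_posRoots i),
    prod_posRoots_erase i.2 fun α => rootDenom b q α t * rootDenom b q α (-t),
    rootDenom_reflectionPerm_self hq, rootDenom_reflectionPerm_self hq, neg_neg,
    mul_comm (rootDenom b q i (-t))]

lemma inv_cFun_neg_eq (t : UnitAddTorus b.support) :
    (cFun b q (-t))⁻¹ = weylDenom b t / ∏ α ∈ posRoots b, rootDenom b q α t := by
  rw [inv_cFun_neg, weylDenom, ← Finset.prod_div_distrib]
  rfl

/-- Both integrals come from the same invariant G = p / `plancherelDenom`. Weights q_α⁻¹ cancel half
of the denominator and give p(t)/c(t⁻¹), while weights 1 give p(t)/(c(t)c(t⁻¹)) with the sum over W₀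
equal to |W₀|. -/
theorem integral_div_cFun_neg (hq : IsReducedParameterSystem b q)
    {p : AddMonoidAlgebra ℂ (coweightLattice R)} (hp : IsWeylInvariant p) :
    (Nat.card (weylGroup R) : ℂ) * ∫ t, evalT b p t / cFun b q (-t) ∂(torusHaar b) =
      (∑ w : weylGroup R, ∏ α ∈ weylInv b w, ((qRoot b q α : ℝ) : ℂ)⁻¹) *
        ∫ t, evalT b p t / (cFun b q t * cFun b q (-t)) ∂(torusHaar b) := by
  set G : UnitAddTorus b.support → ℂ := fun t => evalT b p t / plancherelDenom b q t with hGdef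
  have hG : Continuous G :=
    (continuous_evalT p).div continuous_plancherelDenom (plancherelDenom_ne_zero hq)
  have hGw : ∀ (i : b.support) t, G (weylTorus b (rootRefl R i) t) = G t := fun i t => by
    rw [hGdef]
    simp only [evalT_weylTorus hp, plancherelDenom_weylTorus hq]
  have h1 := integral_mul_prod_mul_weylDenom hG hGw fun α => ((qRoot b q α : ℝ) : ℂ)⁻¹
  have h2 := integral_mul_prod_mul_weylDenom hG hGw fun _ => 1
  have e1 : ∀ t, G t * (∏ α ∈ posRoots b,
      (1 - ((qRoot b q α : ℝ) : ℂ)⁻¹ * (tPow b t (corootP R α))⁻¹)) * weylDenom b t =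
      evalT b p t / cFun b q (-t) := fun t => by
    have h3 : ∏ α ∈ posRoots b, (1 - ((qRoot b q α : ℝ) : ℂ)⁻¹ * (tPow b t (corootP R α))⁻¹) =
        ∏ α ∈ posRoots b, rootDenom b q α (-t) :=
      Finset.prod_congr rfl fun α _ => by rw [rootDenom, tPow_neg_left]
    have h4 : ∏ α ∈ posRoots b, rootDenom b q α (-t) ≠ 0 :=
      Finset.prod_ne_zero_iff.2 fun α _ => rootDenom_ne_zero hq α (-t)
    have h5 : ∏ α ∈ posRoots b, rootDenom b q α t ≠ 0 :=
      Finset.prod_ne_zero_iff.2 fun α _ => rootDenom_ne_zero hq α t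
    rw [h3, div_eq_mul_inv _ (cFun b q (-t)), inv_cFun_neg_eq, hGdef]
    simp only [plancherelDenom, Finset.prod_mul_distrib]
    field_simp
  have e2 : ∀ t, G t * (∏ α ∈ posRoots b, (1 - 1 * (tPow b t (corootP R α))⁻¹)) * weylDenom b t =
      evalT b p t / (cFun b q t * cFun b q (-t)) := fun t => by
    have h3 : ∏ α ∈ posRoots b, (1 - 1 * (tPow b t (corootP R α))⁻¹) = weylDenom b (-t) :=
      Finset.prod_congr rfl fun α _ => by rw [one_mul, tPow_neg_left]
    have h6 := inv_cFun_neg_eq (q := q) (-t)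
    rw [neg_neg] at h6
    rw [h3, div_eq_mul_inv _ (_ * _), mul_inv, inv_cFun_neg_eq, h6, hGdef]
    simp only [plancherelDenom, Finset.prod_mul_distrib, div_eq_mul_inv, mul_inv]
    ring
  simp_rw [e1] at h1
  simp_rw [e2, Finset.prod_const_one, Finset.sum_const, Finset.card_univ, nsmul_eq_mul, mul_one,
    ← Nat.card_eq_fintype_card] at h2
  rw [h1, h2]
  ring

end Spherical

end

end AffineHecke

/-! ### The trace formulas -/

open AffineHecke MeasureTheory in
theorem theorem6p2 {ι V E : Type*} [Fintype ι] [Nonempty ι]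
    [AddCommGroup V] [Module ℝ V] [AddCommGroup E] [Module ℝ E]
    (R : RootPairing ι ℝ V E) [R.IsCrystallographic] [R.IsReduced] [R.IsIrreducible]
    (b : R.Base) (q : Option b.support → ℝ) (hq : IsReducedParameterSystem b q) :
    IsHeckeTrace b q (trace b q) ∧
    (∀ (v : ExtWeyl R) (h : Hecke b q), IsAlcoveElement b q v h ↔ h = alcoveElt b q v) ∧
    (∀ p : AddMonoidAlgebra ℂ (coweightLattice R), IsWeylInvariant p →
      Integrable (fun t => evalT b p t / (cFun b q t * cFun b q (-t))) (torusHaar b) ∧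
      trace b q (evalX b q p * oneZero b q) =
        1 / ((Nat.card (weylGroup R) : ℂ) * ((qElt b q (ofWeyl R (longest b)) : ℝ) : ℂ)) *
          ∫ t, evalT b p t / (cFun b q t * cFun b q (-t)) ∂(torusHaar b)) ∧
    (∀ μ : coweightLattice R,
      Integrable (fun t => tPow b t μ / cFun b q (-t)) (torusHaar b) ∧
      trace b q (xPow b q μ * oneZero b q) =
        1 / ((poincare b q : ℝ) : ℂ) * ∫ t, tPow b t μ / cFun b q (-t) ∂(torusHaar b) ∧
      (-(μ : E) ∉ AddSubmonoid.closure (R.coroot '' b.support) →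
        trace b q (xPow b q μ * oneZero b q) = 0)) := by
  refine ⟨isHeckeTrace_trace hq, isAlcoveElement_iff, fun p hp => ⟨?_, ?_⟩,
    fun μ => ⟨?_, ?_, fun hμ => ?_⟩⟩
  · simp_rw [div_eq_mul_inv, mul_inv]
    exact integrable_torusHaar ((continuous_evalT p).mul
      ((continuous_inv_cFun hq).mul (continuous_inv_cFun_neg hq)))
  · have hcard : (Nat.card (weylGroup R) : ℂ) ≠ 0 := by
      exact_mod_cast Nat.card_pos.ne'
    have hlong : ((qElt b q (ofWeyl R (longest b)) : ℝ) : ℂ) ≠ 0 := by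
      exact_mod_cast (qElt_pos hq _).ne'
    have hW : ((poincare b q : ℝ) : ℂ) ≠ 0 := by exact_mod_cast (poincare_pos hq).ne'
    have h1 := congrArg (fun x : ℝ => (x : ℂ)) (poincare_eq hq)
    push_cast at h1
    have h2 := integral_div_cFun_neg hq hp
    rw [trace_evalX_mul_oneZero hq, inv_mul_eq_iff_eq_mul₀ hW, h1]
    -- After W₀(q) = q_{w₀} K has been substituted, q_{w₀} cancels and the claim is the comparison
    -- of the two integrals with K left opaque.
    generalize ∑ w : weylGroup R, ∏ α ∈ weylInv b w, ((qRoot b q α : ℝ) : ℂ)⁻¹ = K at h2 ⊢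
    field_simp
    linear_combination h2
  · simp_rw [div_eq_mul_inv]
    exact integrable_torusHaar ((continuous_tPow μ).mul (continuous_inv_cFun_neg hq))
  · rw [trace_xPow_mul_oneZero hq, one_div, cMoment]
  · rw [trace_xPow_mul_oneZero hq, cMoment_eq_zero hq hμ, mul_zero]
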